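/- All Turing machines below are multi-stack (equivalently, multi-tape) Turing machines, and polynomial time means time polynomial in the length of the input string. \textbf{Definitions.} A concept class $\mathcal C$ over a finite domain $X$ is a nonempty set of functions $X\to\{0,1\}$; it is given as input explicitly, as the $|X|\times|\mathcal C|$ binary matrix whose (pairwise distinct) columns are the concepts. $\mathrm{VC}(\mathcal C)$ is the largest size of a set $S\subseteq X$ such that the restrictions of the concepts in $\mathcal C$ to $S$ are all the functions $S\to\{0,1\}$. An online learner predicts, given the labelled samples $(x_1,y_1),\dots,(x_{i-1},y_{i-1})$ and $x_i$, the label $y_i$; $\mathrm{Ldim}(\mathcal C)$ (Littlestone's dimension) is the minimum, over all deterministic online learners, of the maximum number of wrong predictions over all sequences $(x_1,y_1),\dots,(x_T,y_T)$ with distinct $x_i$ for which some $c\in\mathcal C$ satisfies $c(x_i)=y_i$ for all $i$. For $r\ge 1$, an algorithm approximates $\mathrm{VC}$ (resp. $\mathrm{Ldim}$) to within a factor $r$ if it is deterministic and, on every input $\mathcal C$, outputs an integer that lies between $\mathrm{OPT}/r$ and $\mathrm{OPT}$, where $\mathrm{OPT}$ is $\mathrm{VC}(\mathcal C)$ (resp.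 $\mathrm{Ldim}(\mathcal C)$). $\mathcal G(N,\tfrac12)$ is the random graph on $N$ labelled vertices in which each pair is an edge independently with probability $\tfrac12$, and $\mathcal G(N,\tfrac12,\kappa)$ is the law of the graph obtained from it by adding all edges inside an independent uniformly random set of $\kappa$ vertices. \textbf{Planted Clique Hypothesis.} There is $\delta\in(0,1)$ such that no randomized polynomial-time algorithm $\mathbb A$ satisfies, for all sufficiently large $N$, both $$\Pr_{G\sim\mathcal G(N,1/2,\lceil N^\delta\rceil)}[\mathbb A(G)=1]\ge \tfrac23\quad\text{and}\quad \Pr_{G\sim\mathcal G(N,1/2)}[\mathbb A(G)=1]\le\tfrac13,$$ where the probabilities are over $G$ and the random bits of $\mathbb A$. \textbf{Theorem.} Assume the Planted Clique Hypothesis. Then for every constant $C\ge 1$ there is no polynomial-time algorithm that approximates $\mathrm{VC}$ to within a factor $C$, and there is no polynomial-time algorithm that approximates $\mathrm{Ldim}$ to within a factor $C$. -/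

import Mathlib

open Computability

namespace Learning

/-! ### Concept classes, VC dimension, Littlestone's dimension

A concept `c : X → {0, 1}` is identified with the set `{x | c x = 1}`. The VC dimension is
`Finset.vcDim`. -/

variable {X : Type*}

/-- A deterministic online learner: from the labelled samples seen so far (in order of arrival) and
the current sample, it predicts the label of the current sample. -/
abbrev OnlineLearner (X : Type*) := List (X × Bool) → X → Bool

/-- The number of wrong predictions of `A` on a sequence of labelled samples, when the samples in
`past` have been presented already. -/
def mistakesFrom (A : OnlineLearner X) : List (X × Bool) → List (X × Bool) → ℕ
  | _, [] => 0
  | past, (x, y) :: s =>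
    (if A past x ≠ y then 1 else 0) + mistakesFrom A (past ++ [(x, y)]) s

/-- The number of wrong predictions of `A` on a sequence of labelled samples. -/
def mistakes (A : OnlineLearner X) (s : List (X × Bool)) : ℕ := mistakesFrom A [] s

/-- Some concept of the class is consistent with all labels of the sequence. -/
def Realizable [DecidableEq X] (𝒞 : Finset (Finset X)) (s : List (X × Bool)) : Prop :=
  ∃ c ∈ 𝒞, ∀ p ∈ s, p.2 = decide (p.1 ∈ c)

/-- `A` makes at most `d` mistakes on every realizable sequence of distinct samples. -/
def HasMistakeBound [DecidableEq X] (𝒞 : Finset (Finset X)) (A : OnlineLearner X) (d : ℕ) : Prop :=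
  ∀ s : List (X × Bool), (s.map Prod.fst).Nodup → Realizable 𝒞 s → mistakes A s ≤ d

/-- Littlestone's dimension: the least mistake bound of an online learner for the class. -/
noncomputable def littlestoneDim [DecidableEq X] (𝒞 : Finset (Finset X)) : ℕ :=
  sInf {d | ∃ A : OnlineLearner X, HasMistakeBound 𝒞 A d}

theorem mistakesFrom_le (A : OnlineLearner X) (past s : List (X × Bool)) :
    mistakesFrom A past s ≤ s.length := by
  induction s generalizing past with
  | nil => simp [mistakesFrom]
  | cons p s ih =>
    have := ih (past ++ [p])
    obtain ⟨x, y⟩ := p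
    simp only [mistakesFrom, List.length_cons]
    split_ifs <;> omega

/-- Over a finite domain the minimum in `littlestoneDim` is attained. -/
theorem exists_hasMistakeBound_littlestoneDim [DecidableEq X] [Fintype X]
    (𝒞 : Finset (Finset X)) :
    ∃ A : OnlineLearner X, HasMistakeBound 𝒞 A (littlestoneDim 𝒞) := by
  refine Nat.sInf_mem (s := {d | ∃ A : OnlineLearner X, HasMistakeBound 𝒞 A d})
    ⟨Fintype.card X, fun _ _ => true, fun s hs _ => ?_⟩
  have h := hs.length_le_card
  rw [List.length_map] at h
  exact (mistakesFrom_le _ _ _).trans h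

/-! ### Inputs -/

/-- A 0/1 matrix as a string: the rows from top to bottom, each terminated by the symbol `none`. -/
def encodeMatrix {m n : ℕ} (M : Fin m → Fin n → Bool) : List (Option Bool) :=
  (List.finRange m).flatMap fun i => (List.finRange n).map (fun j => some (M i j)) ++ [none]

/-- A nonempty concept class given explicitly, as the `|X| × |𝒞|` matrix whose columns are the
concepts: rows are the points of the domain `X = Fin m`, and the columns are pairwise distinct. -/
structure ExplicitClass where
  /-- the size of the domain -/
  m : ℕ
  /-- the number of concepts -/
  n : ℕ
  /-- the entry at `x`, `j` is the value of the `j`-th concept at `x` -/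
  entry : Fin m → Fin n → Bool
  n_pos : 0 < n
  columns_injective : Function.Injective fun (j : Fin n) (x : Fin m) => entry x j

namespace ExplicitClass

/-- The concept class given by the matrix. -/
def concepts (I : ExplicitClass) : Finset (Finset (Fin I.m)) :=
  Finset.univ.image fun j : Fin I.n => Finset.univ.filter fun x => I.entry x j = true

/-- The VC dimension of the class. -/
def vc (I : ExplicitClass) : ℕ := I.concepts.vcDim

/-- Littlestone's dimension of the class. -/
noncomputable def ldim (I : ExplicitClass) : ℕ := littlestoneDim I.concepts

/-- The input string. -/
def encode (I : ExplicitClass) : List (Option Bool) := encodeMatrix I.entry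

end ExplicitClass

/-- The output always lies between `OPT / r` and `OPT`. -/
def ApproximatesWithin (r : ℝ) (opt alg : ExplicitClass → ℕ) : Prop :=
  ∀ I, (opt I : ℝ) / r ≤ alg I ∧ alg I ≤ opt I

/-- Some Turing machine computes `alg`, from the matrix to the binary representation of the output,
in time polynomial in the length of the input. -/
def PolyTime (alg : ExplicitClass → ℕ) : Prop :=
  Nonempty (Turing.TM2ComputableInPolyTime ExplicitClass.encode encodeNat alg)

end Learning

namespace PlantedClique

open MeasureTheory
open scoped ENNReal

/-- The clique on the vertex set `S`, all other vertices being isolated. -/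
def cliqueOn {V : Type*} (S : Finset V) : SimpleGraph V :=
  SimpleGraph.fromRel fun u v => u ∈ S ∧ v ∈ S

/-- The law `G(N, p, κ)` of a graph sampled from `G(N, p)` in which a clique is then planted on a
uniformly random set of `κ` vertices (for `κ ≤ N`). -/
noncomputable def plantedLaw (N : ℕ) (p : unitInterval) (κ : ℕ) : Measure (SimpleGraph (Fin N)) :=
  ((N.choose κ : ℝ≥0∞)⁻¹) • ∑ S ∈ Finset.powersetCard κ (Finset.univ : Finset (Fin N)),
    (SimpleGraph.binomialRandom (Fin N) p).map fun G => G ⊔ cliqueOn S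

/-- `plantedLaw` is a probability measure; in particular the maps in it are measurable. -/
theorem isProbabilityMeasure_plantedLaw {N κ : ℕ} (h : κ ≤ N) (p : unitInterval) :
    IsProbabilityMeasure (plantedLaw N p κ) := by
  have hs : MeasurableSingletonClass (SimpleGraph (Fin N)) := ⟨fun G => by
    have : ({G} : Set (SimpleGraph (Fin N))) = SimpleGraph.edgeSet ⁻¹' {G.edgeSet} := by
      ext H
      simp
    rw [this]
    exact SimpleGraph.measurable_edgeSet (measurableSet_singleton _)⟩
  have hm (S : Finset (Fin N)) : Measurable fun G : SimpleGraph (Fin N) => G ⊔ cliqueOn S :=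
    Measurable.of_discrete
  have hS (S : Finset (Fin N)) : IsProbabilityMeasure
      ((SimpleGraph.binomialRandom (Fin N) p).map fun G => G ⊔ cliqueOn S) :=
    Measure.isProbabilityMeasure_map (hm S).aemeasurable
  constructor
  simp only [plantedLaw, Measure.smul_apply, Measure.coe_finsetSum, Finset.sum_apply,
    measure_univ, Finset.sum_const, Finset.card_powersetCard, Finset.card_univ, Fintype.card_fin,
    smul_eq_mul, nsmul_eq_mul, mul_one]
  exact ENNReal.inv_mul_cancel (by exact_mod_cast (Nat.choose_pos h).ne') (by simp)

/-- A graph on the vertices `0, …, N - 1`, for some `N`. -/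
abbrev Graph := Σ N : ℕ, SimpleGraph (Fin N)

open Classical in
/-- A graph as a string: its adjacency matrix. -/
noncomputable def encodeGraph (G : Graph) : List (Option Bool) :=
  Learning.encodeMatrix fun u v => decide (G.2.Adj u v)

/-- A graph followed by a string of random bits, as one string. -/
noncomputable def encodeGraphCoins (x : Graph × List Bool) : List (Option Bool ⊕ Bool) :=
  (encodeGraph x.1).map Sum.inl ++ x.2.map Sum.inr

/-- A randomized polynomial-time algorithm that accepts or rejects graphs: a polynomial-time Turing
machine that is given the graph together with polynomially many random bits. -/
structure RandomizedTest where
  /-- the answer on a graph and a string of random bits -/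
  run : Graph × List Bool → Bool
  /-- the number of random bits, in terms of the number of vertices -/
  numCoins : Polynomial ℕ
  polyTime : Nonempty (Turing.TM2ComputableInPolyTime encodeGraphCoins encodeBool run)

/-- The probability that the test accepts, over a random graph of law `μ` and independent uniform
random bits. -/
noncomputable def RandomizedTest.acceptProb (A : RandomizedTest) {N : ℕ}
    (μ : Measure (SimpleGraph (Fin N))) : ℝ≥0∞ :=
  (μ.prod (PMF.uniformOfFintype (Fin (A.numCoins.eval N) → Bool)).toMeasure)
    {ω | A.run (⟨N, ω.1⟩, List.ofFn ω.2) = true}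

/-- The edge probability `1/2`. -/
noncomputable def half : unitInterval := ⟨1 / 2, by norm_num, by norm_num⟩

/-- The Planted Clique Hypothesis: for some `0 < δ < 1`, no randomized polynomial-time algorithm
tells `G(N, 1/2, ⌈N ^ δ⌉)` from `G(N, 1/2)`, in the sense of accepting with probability at least
`2/3` and at most `1/3` respectively, for all sufficiently large `N`. -/
def Hypothesis : Prop :=
  ∃ δ : ℝ, 0 < δ ∧ δ < 1 ∧ ¬ ∃ A : RandomizedTest, ∀ᶠ N : ℕ in Filter.atTop,
    2 / 3 ≤ A.acceptProb (plantedLaw N half ⌈(N : ℝ) ^ δ⌉₊) ∧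
      A.acceptProb (SimpleGraph.binomialRandom (Fin N) half) ≤ 1 / 3

end PlantedClique

/-! A graph on `N` vertices is turned into a concept class with a large shattered set if a clique is
planted, and with a small Littlestone dimension if the graph is random; the gap is an arbitrary
constant factor. Fix `r ≥ 2 / δ` and let `q` be the number of digits of `N` in base `2 ^ r`, so that
`2 ^ q` is at most `2 * N ^ (δ / 2)`. The concepts are the `l`-tuples `t` of vertices. Each vertex
`u` is a point of the domain and has a colour `(j, i)` in `[l] × [q]`; `t` contains `u` if `u` is
adjacent to all coordinates of `t` and bit `i` of `t_j + 1` is set. Further points `(w, j)` test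
whether `t_j = w`; they make the columns distinct.

A random set of `⌈N ^ δ⌉` vertices meets, with probability at least `2/3`, every colour class in the
lower half of the vertices and every residue class of `w + 1` modulo `2 ^ q` in the upper half. If
it is a clique, adjacency between the two halves is automatic, and choosing the coordinates by
residue realises every pattern on `l * q` vertices of distinct colours
(`exists_shatters_graphClass`, `le_plantedLaw_graphClass`).

A random graph has, except with probability at most `1/3`, no two disjoint completely joined sets of
`k = 2 * r * q + 2` vertices (`binomialRandom_half_biclique_le`). A concept contains at most `l` of
the points `(w, j)`. So if `k + l` points lie in a concept, at least `k` of them are vertices, and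
the coordinates of every such concept are among their at most `k` common neighbours: there are at
most `k ^ l` such concepts. Predicting `false` until `k + l` positive labels have been seen, and
then following the majority, costs about `k + l + l * log k` mistakes, which is less than `4 * r *
q` for large `N` (`littlestoneDim_le`, `ldim_graphClass_le`). Since `l` is free, a constant-factor
approximation of either dimension separates the two cases (`not_exists_approximatesWithin`).

The remaining work is to carry out the reduction on a multi-stack machine in polynomial time.
Programs are composed from routines with the time-bounded specification `Runs`. Each row of the
matrix is a tensor product of `l` masked copies of one vector (`tensor_eq`), which leads to
`runs_reduction`. The threshold is a power of two, so comparing with it only requires the length of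
the binary output (`lt_length_encodeNat`, `exists_randomizedTest`). -/

/-! ### Structured multi-stack programs -/

namespace StackProgram

open Turing TM2

/-- A program for a multi-stack machine with stack alphabets `Γ` and internal states `σ`. It ends by
halting; sequential composition replaces halting by a jump. -/
structure Routine {K : Type} (Γ : K → Type) (σ : Type) where
  /-- the labels -/
  Λ : Type
  [fin : Fintype Λ]
  /-- the entry point -/
  main : Λ
  /-- the statement at each label -/
  code : Λ → Stmt Γ Λ σ

attribute [instance] Routine.fin

/-! ### Relabelling of statements. -/

section Relabel

variable {K : Type} {Γ : K → Type} {σ Λ Λ' : Type}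

/-- Rename the labels of a statement, and replace halting by a jump to `e` if `e` is a label. -/
def relabel (f : Λ → Λ') (e : Option Λ') : Stmt Γ Λ σ → Stmt Γ Λ' σ
  | .push k g q => .push k g (relabel f e q)
  | .peek k g q => .peek k g (relabel f e q)
  | .pop k g q => .pop k g (relabel f e q)
  | .load g q => .load g (relabel f e q)
  | .branch p q₁ q₂ => .branch p (relabel f e q₁) (relabel f e q₂)
  | .goto l => .goto fun v => f (l v)
  | .halt => e.elim .halt fun x => .goto fun _ => x

/-- One step executes a whole statement, so the renaming affects only the label reached at its end;
in particular, jumping instead of halting costs no additional step. -/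
theorem stepAux_relabel [DecidableEq K] (f : Λ → Λ') (e : Option Λ') (q : Stmt Γ Λ σ) (v : σ)
    (S : ∀ k, List (Γ k)) :
    stepAux (relabel f e q) v S =
      ⟨(stepAux q v S).l.elim e fun l => some (f l), (stepAux q v S).var,
        (stepAux q v S).stk⟩ := by
  induction q generalizing v S with
  | branch p q₁ q₂ h₁ h₂ =>
    simp only [relabel, stepAux, h₁, h₂]
    cases p v <;> rfl
  | halt => cases e <;> rfl
  | goto l => rfl
  | load g q ih => simp only [relabel, stepAux, ih]
  | push k g q ih => simp only [relabel, stepAux, ih]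
  | peek k g q ih => simp only [relabel, stepAux, ih]
  | pop k g q ih => simp only [relabel, stepAux, ih]

end Relabel

/-! ### Runs with an exact number of steps. -/

section Steps

variable {K : Type} [DecidableEq K] {Γ : K → Type} {σ Λ Λ' : Type}

/-- The machine goes from one configuration to another in exactly `t` steps. -/
inductive StepsTo (M : Λ → Stmt Γ Λ σ) : ℕ → Cfg Γ Λ σ → Cfg Γ Λ σ → Prop
  | refl (c) : StepsTo M 0 c c
  | head {t l v S c} : StepsTo M t (stepAux (M l) v S) c → StepsTo M (t + 1) ⟨some l, v, S⟩ c

theorem StepsTo.trans {M : Λ → Stmt Γ Λ σ} {t₁ t₂ : ℕ} {a b c : Cfg Γ Λ σ}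
    (h₁ : StepsTo M t₁ a b) (h₂ : StepsTo M t₂ b c) : StepsTo M (t₁ + t₂) a c := by
  induction h₁ with
  | refl => simpa using h₂
  | head _ ih => rw [Nat.add_right_comm]; exact .head (ih h₂)

theorem StepsTo.iterate {M : Λ → Stmt Γ Λ σ} {t : ℕ} {a b : Cfg Γ Λ σ} (h : StepsTo M t a b) :
    (flip bind (step M))^[t] (some a) = some b := by
  induction h with
  | refl => rfl
  | head _ ih => rw [Function.iterate_succ_apply]; exact ih

/-- `none` is absorbing under the iterated step, so an iteration that ends in a configuration has
never stepped from a halted one. This imports the run of a given machine. -/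
theorem StepsTo.of_iterate {M : Λ → Stmt Γ Λ σ} {t : ℕ} {a b : Cfg Γ Λ σ}
    (h : (flip bind (step M))^[t] (some a) = some b) : StepsTo M t a b := by
  have hn (n : ℕ) : (flip bind (step M))^[n] none = none := by
    induction n with
    | zero => rfl
    | succ n ih => rw [Function.iterate_succ_apply]; exact ih
  induction t generalizing a with
  | zero => cases h; exact .refl _
  | succ t ih =>
    rw [Function.iterate_succ_apply] at h
    obtain ⟨l, v, S⟩ := a
    cases l with
    | none =>
      change (flip bind (step M))^[t] none = some b at h
      rw [hn] at h
      cases h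
    | some l => exact .head (ih h)

theorem StepsTo.relabel {M : Λ → Stmt Γ Λ σ} {M' : Λ' → Stmt Γ Λ' σ} {f : Λ → Λ'}
    {e : Option Λ'} (hM : ∀ l, M' (f l) = relabel f e (M l)) {t : ℕ} {a b : Cfg Γ Λ σ}
    (h : StepsTo M t a b) :
    StepsTo M' t ⟨a.l.elim e fun l => some (f l), a.var, a.stk⟩
      ⟨b.l.elim e fun l => some (f l), b.var, b.stk⟩ := by
  induction h with
  | refl => exact .refl _
  | head _ ih =>
    refine .head ?_
    rw [hM, stepAux_relabel]
    exact ih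

end Steps

/-! ### Specifications of routines and their composition. -/

namespace Routine

variable {K : Type} [DecidableEq K] {Γ : K → Type} {σ : Type}

/-- Started with the stacks `S`, the routine ends after at most `t` steps with the stacks `S'`. -/
def Runs (R : Routine Γ σ) (S : ∀ k, List (Γ k)) (t : ℕ) (S' : ∀ k, List (Γ k)) : Prop :=
  ∀ v, ∃ v', ∃ t' ≤ t, StepsTo R.code t' ⟨some R.main, v, S⟩ ⟨none, v', S'⟩

/-- A single statement. -/
def single (q : Stmt Γ Unit σ) : Routine Γ σ := ⟨Unit, (), fun _ => q⟩

/-- Do nothing. -/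
def skip : Routine Γ σ := single .halt

/-- Push a symbol. -/
def push (k : K) (a : Γ k) : Routine Γ σ := single (.push k (fun _ => a) .halt)

/-- Drop the top symbol, if there is one. -/
def pop (k : K) : Routine Γ σ := single (.pop k (fun v _ => v) .halt)

/-- Run `P`, then `Q`. -/
def seq (P Q : Routine Γ σ) : Routine Γ σ where
  Λ := P.Λ ⊕ Q.Λ
  main := .inl P.main
  code := Sum.elim (fun l => relabel .inl (some (.inr Q.main)) (P.code l))
    fun l => relabel .inr none (Q.code l)

/-- Run `P 0, …, P (n - 1)`. -/
def seqRange (P : ℕ → Routine Γ σ) : ℕ → Routine Γ σ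
  | 0 => skip
  | n + 1 => (seqRange P n).seq (P n)

theorem Runs.skip {S : ∀ k, List (Γ k)} : (skip : Routine Γ σ).Runs S 1 S :=
  fun v => ⟨v, 1, le_rfl, .head (.refl _)⟩

theorem Runs.push {k : K} {a : Γ k} {S : ∀ k, List (Γ k)} :
    (push k a : Routine Γ σ).Runs S 1 (Function.update S k (a :: S k)) :=
  fun v => ⟨v, 1, le_rfl, .head (.refl _)⟩

theorem Runs.pop {k : K} {S : ∀ k, List (Γ k)} :
    (pop k : Routine Γ σ).Runs S 1 (Function.update S k (S k).tail) :=
  fun v => ⟨v, 1, le_rfl, .head (.refl _)⟩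

/-- `Runs` holds for every initial internal state, so whatever state `P` leaves behind is acceptable
to `Q`. The times add exactly, as the jump replaces the halting of `P`. -/
theorem Runs.seq {P Q : Routine Γ σ} {S S' S'' : ∀ k, List (Γ k)} {t t' : ℕ}
    (hP : P.Runs S t S') (hQ : Q.Runs S' t' S'') : (P.seq Q).Runs S (t + t') S'' := by
  intro v
  obtain ⟨v', s, hs, h⟩ := hP v
  obtain ⟨v'', s', hs', h'⟩ := hQ v'
  exact ⟨v'', s + s', Nat.add_le_add hs hs',
    (h.relabel (M' := (P.seq Q).code) (f := Sum.inl) (e := some (.inr Q.main))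
      fun _ => rfl).trans (h'.relabel (f := Sum.inr) (e := none) fun _ => rfl)⟩

theorem Runs.mono {P : Routine Γ σ} {S S' : ∀ k, List (Γ k)} {t t' : ℕ}
    (h : P.Runs S t S') (ht : t ≤ t') : P.Runs S t' S' := fun v => by
  obtain ⟨v', s, hs, h⟩ := h v
  exact ⟨v', s, hs.trans ht, h⟩

theorem Runs.congr {P : Routine Γ σ} {S S' T T' : ∀ k, List (Γ k)} {t t' : ℕ}
    (h : P.Runs S t S') (hS : S = T) (ht : t ≤ t') (hS' : S' = T') : P.Runs T t' T' := by
  subst hS hS'; exact h.mono ht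

theorem Runs.seqRange {P : ℕ → Routine Γ σ} {c n : ℕ} {st : ℕ → ∀ k, List (Γ k)}
    (h : ∀ j < n, (P j).Runs (st j) c (st (j + 1))) :
    (seqRange P n).Runs (st 0) (n * c + 1) (st n) := by
  induction n with
  | zero => exact Runs.skip.mono (by simp)
  | succ n ih =>
    exact ((ih fun j hj => h j (hj.trans n.lt_succ_self)).seq (h n n.lt_succ_self)).mono
      (by rw [add_mul]; omega)

/-! ### Case distinctions and loops. -/

section Branching

variable {A τ : Type}

/-- Continue with a routine that depends on the top symbol. -/
def switch [Fintype A] (k : K) (e : Γ k → A) (P : Option A → Routine Γ (Option A × τ)) :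
    Routine Γ (Option A × τ) where
  Λ := Option (Σ o, (P o).Λ)
  main := none
  code
    | none => .peek k (fun v h => (h.map e, v.2)) (.goto fun v => some ⟨v.1, (P v.1).main⟩)
    | some ⟨o, l⟩ => relabel (fun l => some ⟨o, l⟩) none ((P o).code l)

/-- Run `P` as long as the top symbol satisfies `p`. -/
def loop (k : K) (e : Γ k → A) (p : Option A → Bool) (P : Routine Γ (Option A × τ)) :
    Routine Γ (Option A × τ) where
  Λ := Option P.Λ
  main := none
  code
    | none => .peek k (fun v h => (h.map e, v.2))
        (.branch (fun v => p v.1) (.goto fun _ => some P.main) .halt)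
    | some l => relabel some (some none) (P.code l)

theorem Runs.switch [Fintype A] {k : K} {e : Γ k → A} {P : Option A → Routine Γ (Option A × τ)}
    {S S' : ∀ k, List (Γ k)} {t : ℕ} (o : Option A) (ho : (S k).head?.map e = o)
    (h : (P o).Runs S t S') : (Routine.switch k e P).Runs S (t + 1) S' := by
  subst ho
  intro v
  obtain ⟨v', s, hs, h'⟩ := h ((S k).head?.map e, v.2)
  exact ⟨v', s + 1, Nat.succ_le_succ hs, .head (h'.relabel (M' := (Routine.switch k e P).code)
    (f := fun l => some ⟨_, l⟩) (e := none) fun _ => rfl)⟩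

theorem Runs.loop_done {k : K} {e : Γ k → A} {p : Option A → Bool}
    {P : Routine Γ (Option A × τ)} {S : ∀ k, List (Γ k)} (h : p ((S k).head?.map e) = false) :
    (loop k e p P).Runs S 1 S := by
  intro v
  refine ⟨((S k).head?.map e, v.2), 1, le_rfl, .head ?_⟩
  have : stepAux ((loop k e p P).code (loop k e p P).main) v S =
      ⟨none, ((S k).head?.map e, v.2), S⟩ := by
    simp [loop, h]
  rw [this]
  exact .refl _

theorem Runs.loop_step {k : K} {e : Γ k → A} {p : Option A → Bool}
    {P : Routine Γ (Option A × τ)} {S S' S'' : ∀ k, List (Γ k)} {t t' : ℕ}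
    (h : p ((S k).head?.map e) = true) (hP : P.Runs S t S') (hL : (loop k e p P).Runs S' t' S'') :
    (loop k e p P).Runs S (t + t' + 1) S'' := by
  intro v
  obtain ⟨v', s, hs, h'⟩ := hP ((S k).head?.map e, v.2)
  obtain ⟨v'', s', hs', h''⟩ := hL v'
  refine ⟨v'', s + s' + 1, by omega, .head ?_⟩
  have : stepAux ((loop k e p P).code (loop k e p P).main) v S =
      ⟨some (some P.main), ((S k).head?.map e, v.2), S⟩ := by
    simp [loop, h]
  rw [this]
  exact (h'.relabel (M' := (loop k e p P).code) (f := some) (e := some none) fun _ => rfl).trans h''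

/-- A loop that consumes a list `l`, while the rest of the stacks is described by `g`. -/
theorem Runs.loop_foldl {β γ : Type*} {k : K} {e : Γ k → A} {p : Option A → Bool}
    {P : Routine Γ (Option A × τ)} (Q : β → Prop) (c : ℕ) (st : List β → γ → ∀ k, List (Γ k))
    (f : γ → β → γ) (hdone : ∀ g, p ((st [] g k).head?.map e) = false)
    (hcont : ∀ x l g, p ((st (x :: l) g k).head?.map e) = true)
    (hP : ∀ x l g, Q x → P.Runs (st (x :: l) g) c (st l (f g x))) (l : List β)
    (hl : ∀ x ∈ l, Q x) (g : γ) :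
    (loop k e p P).Runs (st l g) (l.length * (c + 1) + 1) (st [] (l.foldl f g)) := by
  induction l generalizing g with
  | nil => exact (Runs.loop_done (hdone g)).mono (by simp)
  | cons x l ih =>
    exact (Runs.loop_step (hcont x l g) (hP x l g (hl x (by simp)))
      (ih (fun y hy => hl y (by simp [hy])) (f g x))).mono
      (by rw [List.length_cons, add_mul]; omega)

/-- A loop that is run `n` times. -/
theorem Runs.loop_iterate {k : K} {e : Γ k → A} {p : Option A → Bool}
    {P : Routine Γ (Option A × τ)} (n c : ℕ) (st : ℕ → ∀ k, List (Γ k))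
    (hdone : p ((st n k).head?.map e) = false)
    (hcont : ∀ i < n, p ((st i k).head?.map e) = true)
    (hP : ∀ i < n, P.Runs (st i) c (st (i + 1))) :
    (loop k e p P).Runs (st 0) (n * (c + 1) + 1) (st n) := by
  induction n generalizing st with
  | zero => exact (Runs.loop_done hdone).mono (by simp)
  | succ n ih =>
    exact (Runs.loop_step (hcont 0 n.succ_pos) (hP 0 n.succ_pos)
      (ih (fun i => st (i + 1)) hdone (fun i hi => hcont _ (by omega))
        fun i hi => hP _ (by omega))).mono (by rw [add_mul]; omega)

end Branching

/-! ### Polynomial bounds -/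

/-- `f` is bounded by a polynomial in `sz`. -/
def PolyBdd {α : Type*} (sz f : α → ℕ) : Prop := ∃ p : Polynomial ℕ, ∀ a, f a ≤ p.eval (sz a)

end Routine

theorem eval_mono (p : Polynomial ℕ) {m n : ℕ} (h : m ≤ n) : p.eval m ≤ p.eval n := by
  induction p using Polynomial.induction_on' with
  | add p q hp hq => simpa using Nat.add_le_add hp hq
  | monomial i a => simpa using Nat.mul_le_mul_left a (Nat.pow_le_pow_left h i)

namespace Routine

namespace PolyBdd

variable {α : Type*} {sz f g : α → ℕ}

theorem self : PolyBdd sz sz := ⟨.X, fun _ => by simp⟩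

theorem const (c : ℕ) : PolyBdd sz fun _ => c := ⟨.C c, fun _ => by simp⟩

theorem mono (hg : PolyBdd sz g) (h : ∀ a, f a ≤ g a) : PolyBdd sz f :=
  hg.imp fun _ hp a => (h a).trans (hp a)

theorem add (hf : PolyBdd sz f) (hg : PolyBdd sz g) : PolyBdd sz fun a => f a + g a := by
  obtain ⟨p, hp⟩ := hf
  obtain ⟨q, hq⟩ := hg
  exact ⟨p + q, fun a => by simpa using Nat.add_le_add (hp a) (hq a)⟩

theorem mul (hf : PolyBdd sz f) (hg : PolyBdd sz g) : PolyBdd sz fun a => f a * g a := by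
  obtain ⟨p, hp⟩ := hf
  obtain ⟨q, hq⟩ := hg
  exact ⟨p * q, fun a => by simpa using Nat.mul_le_mul (hp a) (hq a)⟩

theorem pow (hf : PolyBdd sz f) (n : ℕ) : PolyBdd sz fun a => f a ^ n := by
  induction n with
  | zero => simpa using const 1
  | succ n ih => simpa only [pow_succ] using ih.mul hf

end PolyBdd

end Routine

/-! ### Embedding into a larger machine -/

section Lift

variable {K K' : Type} (ι : K → K') (Γ : K' → Type) {Λ σ σ' : Type}
  (get : σ' → σ) (set : σ → σ' → σ')

/-- A statement about the stacks in the range of `ι` and a component of the internal state. -/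
def liftStmt : Stmt (fun k => Γ (ι k)) Λ σ → Stmt Γ Λ σ'
  | .push k g q => .push (ι k) (fun v => g (get v)) (liftStmt q)
  | .peek k g q => .peek (ι k) (fun v h => set (g (get v) h) v) (liftStmt q)
  | .pop k g q => .pop (ι k) (fun v h => set (g (get v) h) v) (liftStmt q)
  | .load g q => .load (fun v => set (g (get v)) v) (liftStmt q)
  | .branch p q₁ q₂ => .branch (fun v => p (get v)) (liftStmt q₁) (liftStmt q₂)
  | .goto l => .goto fun v => l (get v)
  | .halt => .halt

/-- `Routine` on part of the stacks. -/
def Routine.lift (R : Routine (fun k => Γ (ι k)) σ) : Routine Γ σ' :=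
  ⟨R.Λ, R.main, fun l => liftStmt ι Γ get set (R.code l)⟩

variable {ι Γ get set} [DecidableEq K] [DecidableEq K']

/-- Only the component `get v` of the state influences the lifted statement, so `get (set a v) = a`
is the only law needed; the rest of the final state may remain unspecified. Injectivity of `ι` makes
updates commute with the restriction to the smaller set of stacks. -/
theorem stepAux_liftStmt (hι : Function.Injective ι) (hget : ∀ a v, get (set a v) = a)
    (q : Stmt (fun k => Γ (ι k)) Λ σ) (v : σ') (S : ∀ k, List (Γ k)) :
    ∃ v' S', stepAux (liftStmt ι Γ get set q) v S =
        ⟨(stepAux q (get v) fun k => S (ι k)).l, v', S'⟩ ∧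
      get v' = (stepAux q (get v) fun k => S (ι k)).var ∧
      (fun k => S' (ι k)) = (stepAux q (get v) fun k => S (ι k)).stk ∧
      ∀ k, k ∉ Set.range ι → S' k = S k := by
  have hu (S : ∀ k, List (Γ k)) (k : K) (l : List (Γ (ι k))) :
      (fun i => Function.update S (ι k) l (ι i)) = Function.update (fun i => S (ι i)) k l := by
    funext i
    by_cases h : i = k
    · subst h; simp
    · rw [Function.update_of_ne h, Function.update_of_ne (hι.ne h)]
  have hn {S : ∀ k, List (Γ k)} {k : K} {l : List (Γ (ι k))} {i : K'} (hi : i ∉ Set.range ι) :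
      Function.update S (ι k) l i = S i :=
    Function.update_of_ne (fun h => hi ⟨k, h.symm⟩) _ _
  induction q generalizing v S with
  | push k g q ih =>
    obtain ⟨v', S', h₁, h₂, h₃, h₄⟩ := ih v (Function.update S (ι k) (g (get v) :: S (ι k)))
    rw [hu] at h₁ h₂ h₃
    exact ⟨v', S', h₁, h₂, h₃, fun i hi => (h₄ i hi).trans (hn hi)⟩
  | peek k g q ih =>
    obtain ⟨v', S', h₁, h₂, h₃, h₄⟩ := ih (set (g (get v) (S (ι k)).head?) v) S
    rw [hget] at h₁ h₂ h₃
    exact ⟨v', S', h₁, h₂, h₃, h₄⟩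
  | pop k g q ih =>
    obtain ⟨v', S', h₁, h₂, h₃, h₄⟩ := ih (set (g (get v) (S (ι k)).head?) v)
      (Function.update S (ι k) (S (ι k)).tail)
    rw [hget, hu] at h₁ h₂ h₃
    exact ⟨v', S', h₁, h₂, h₃, fun i hi => (h₄ i hi).trans (hn hi)⟩
  | load g q ih =>
    obtain ⟨v', S', h₁, h₂, h₃, h₄⟩ := ih (set (g (get v)) v) S
    rw [hget] at h₁ h₂ h₃
    exact ⟨v', S', h₁, h₂, h₃, h₄⟩
  | branch p q₁ q₂ h₁ h₂ =>
    simp only [liftStmt, stepAux]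
    cases p (get v)
    · exact h₂ v S
    · exact h₁ v S
  | goto l => exact ⟨v, S, rfl, rfl, rfl, fun _ _ => rfl⟩
  | halt => exact ⟨v, S, rfl, rfl, rfl, fun _ _ => rfl⟩

theorem StepsTo.lift (hι : Function.Injective ι) (hget : ∀ a v, get (set a v) = a)
    {M : Λ → Stmt (fun k => Γ (ι k)) Λ σ} {t : ℕ} {a b : Cfg (fun k => Γ (ι k)) Λ σ}
    (h : StepsTo M t a b) (v : σ') (S : ∀ k, List (Γ k)) (hv : get v = a.var)
    (hS : (fun k => S (ι k)) = a.stk) :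
    ∃ v' S', StepsTo (fun l => liftStmt ι Γ get set (M l)) t ⟨a.l, v, S⟩ ⟨b.l, v', S'⟩ ∧
      (fun k => S' (ι k)) = b.stk ∧ ∀ k, k ∉ Set.range ι → S' k = S k := by
  induction h generalizing v S with
  | refl => exact ⟨v, S, .refl _, hS, fun _ _ => rfl⟩
  | @head t l w T c _ ih =>
    subst hv hS
    obtain ⟨v', S', h₁, h₂, h₃, h₄⟩ := stepAux_liftStmt hι hget (M l) v S
    obtain ⟨v'', S'', h₅, h₆, h₇⟩ := ih v' S' h₂ h₃
    exact ⟨v'', S'', .head (by simpa only [h₁] using h₅), h₆,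
      fun k hk => (h₇ k hk).trans (h₄ k hk)⟩

theorem Routine.Runs.lift (hι : Function.Injective ι) (hget : ∀ a v, get (set a v) = a)
    {R : Routine (fun k => Γ (ι k)) σ} {S S' : ∀ k, List (Γ k)} {t : ℕ}
    (h : R.Runs (fun k => S (ι k)) t fun k => S' (ι k))
    (hS : ∀ k, k ∉ Set.range ι → S' k = S k) : (R.lift ι Γ get set).Runs S t S' := by
  intro v
  obtain ⟨w, s, hs, hw⟩ := h (get v)
  obtain ⟨v', S'', h₁, h₂, h₃⟩ := hw.lift hι hget v S rfl rfl
  refine ⟨v', s, hs, ?_⟩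
  have : S'' = S' := by
    funext k
    by_cases hk : k ∈ Set.range ι
    · obtain ⟨i, rfl⟩ := hk
      exact congrFun h₂ i
    · rw [h₃ k hk, hS k hk]
  exact this ▸ h₁

end Lift

end StackProgram

namespace StackProgram

open Turing TM2 Routine

/-! ### The core program -/

/-- The input alphabet of a randomized test on graphs. -/
abbrev Sym := Option Bool ⊕ Bool

/-- A bit of a matrix. -/
abbrev bit (b : Bool) : Sym := .inl (some b)

/-- The end of a row. -/
abbrev sep : Sym := .inl none

/-- The work stacks. -/
inductive Stack
  | inp | mat | one | ins | x | y | t | u | acc | out | car | car2 | cnt | cnt2 | lp | qs | ss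
  | vec | reg
  deriving DecidableEq

instance : Fintype Stack :=
  ⟨{.inp, .mat, .one, .ins, .x, .y, .t, .u, .acc, .out, .car, .car2, .cnt, .cnt2, .lp, .qs, .ss,
    .vec, .reg}, fun k => by cases k <;> decide⟩

/-- The contents of the work stacks. -/
structure Regs where
  (inp mat one ins x y t u acc out car car2 cnt cnt2 lp qs ss vec reg : List Sym := [])

/-- The contents of the work stacks, as a function. -/
def Regs.get (r : Regs) : Stack → List Sym
  | .inp => r.inp | .mat => r.mat | .one => r.one | .ins => r.ins | .x => r.x | .y => r.y
  | .t => r.t | .u => r.u | .acc => r.acc | .out => r.out | .car => r.car | .car2 => r.car2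
  | .cnt => r.cnt | .cnt2 => r.cnt2 | .lp => r.lp | .qs => r.qs | .ss => r.ss | .vec => r.vec
  | .reg => r.reg

/-- Programs for the work stacks. -/
abbrev Prog := Routine (fun _ : Stack => Sym) (Option Sym × Unit)

/-- Continue according to the top symbol. -/
def onTop (k : Stack) (P : Option Sym → Prog) : Prog := switch k id P

/-- Run `P` while the stack `k` is nonempty. -/
def whileNonempty (k : Stack) (P : Prog) : Prog := loop k id Option.isSome P

/-- Push the top symbol of `a` to `b`. -/
def copyTop (a b : Stack) : Prog := onTop a fun o => o.elim skip fun s => push b s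

/-- Move the contents of `a` to `b`; they are reversed. -/
def move (a b : Stack) : Prog := whileNonempty a ((copyTop a b).seq (pop a))

/-- Empty the stack `a`. -/
def clear (a : Stack) : Prog := whileNonempty a (pop a)

/-- Put a copy of `a` on top of `b`. -/
def copy (a b : Stack) : Prog :=
  (move a .t).seq (whileNonempty .t ((copyTop .t a).seq ((copyTop .t b).seq (pop .t))))

/-- Push `n` copies of a symbol. -/
def pushN (k : Stack) (a : Sym) (n : ℕ) : Prog := seqRange (fun _ => push k a) n

/-- Drop `n` symbols. -/
def popN (k : Stack) (n : ℕ) : Prog := seqRange (fun _ => pop k) n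

/-! ### Elementary stack operations. -/

variable {S : Stack → List Sym} {a b k : Stack}

theorem Runs.onTop {P : Option Sym → Prog} {S S' : Stack → List Sym} {c : ℕ} (o : Option Sym)
    (ho : (S k).head? = o) (h : (P o).Runs S c S') : (onTop k P).Runs S (c + 1) S' :=
  Runs.switch o (by simpa using ho) h

theorem runs_copyTop {s : Sym} (h : (S a).head? = some s) :
    (copyTop a b).Runs S 2 (Function.update S b (s :: S b)) :=
  Runs.onTop (some s) h .push

theorem runs_move (hab : a ≠ b) :
    (move a b).Runs S ((S a).length * 4 + 1)
      (Function.update (Function.update S a []) b ((S a).reverse ++ S b)) := by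
  have h := Runs.loop_foldl (k := a) (e := id) (p := Option.isSome)
    (P := ((copyTop a b).seq (pop a) : Prog)) (fun _ => True) 3
    (fun l g => Function.update (Function.update S a l) b g) (fun g s => s :: g)
    (fun g => by simp [hab]) (fun s l g => by simp [hab])
    (fun s l g _ => (Runs.seq (runs_copyTop (s := s) (by simp [hab])) .pop).congr rfl le_rfl (by
      funext k
      by_cases hb : k = b
      · subst hb; simp [hab.symm]
      · by_cases ha : k = a
        · subst ha; simp [hab]
        · simp [ha, hb])) (S a) (fun _ _ => trivial) (S b)
  refine h.congr (by simp) le_rfl ?_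
  congr 1
  simp

theorem runs_clear : (clear a).Runs S ((S a).length * 2 + 1) (Function.update S a []) := by
  have h := Runs.loop_foldl (k := a) (e := id) (p := Option.isSome) (P := (pop a : Prog))
    (fun _ => True) 1 (fun l _ => Function.update S a l) (fun (g : Unit) _ => g)
    (fun g => by simp) (fun s l g => by simp)
    (fun s l g _ => Runs.pop.congr rfl le_rfl (by simp)) (S a) (fun _ _ => trivial) ()
  exact h.congr (by simp) le_rfl rfl

/-- Moving `a` to the auxiliary stack reverses it; popping from there onto both stacks restores the
order. -/
theorem runs_copy (hab : a ≠ b) (ha : a ≠ .t) (hb : b ≠ .t) (ht : S .t = []) :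
    (copy a b).Runs S ((S a).length * 10 + 2) (Function.update S b (S a ++ S b)) := by
  have h₁ := runs_move (S := S) ha
  have h₂ := Runs.loop_foldl (k := .t) (e := id) (p := Option.isSome)
    (P := ((copyTop .t a).seq ((copyTop .t b).seq (pop .t)) : Prog)) (fun _ => True) 5
    (fun l g => Function.update (Function.update (Function.update S .t l) b (g ++ S b)) a g)
    (fun g s => s :: g)
    (fun g => by simp [ha.symm, hb.symm]) (fun s l g => by simp [ha.symm, hb.symm])
    (fun s l g _ => (Runs.seq (runs_copyTop (s := s) (by simp [ha.symm, hb.symm]))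
      (Runs.seq (runs_copyTop (s := s) (by simp [ha.symm, hb.symm])) .pop)).congr rfl le_rfl (by
      funext k
      by_cases hkt : k = .t
      · subst hkt; simp [ha.symm, hb.symm]
      · by_cases hkb : k = b
        · subst hkb; simp [hab.symm, hkt]
        · by_cases hka : k = a
          · subst hka; simp [hab, hkt]
          · simp [hka, hkb, hkt])) (S a).reverse (fun _ _ => trivial) []
  refine (h₁.seq (h₂.congr ?_ le_rfl rfl)).congr rfl ?_ ?_
  · funext k
    by_cases hkt : k = .t
    · subst hkt; simp [ha.symm, hb.symm, ht]
    · by_cases hkb : k = b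
      · subst hkb; simp [hab.symm, hkt]
      · by_cases hka : k = a
        · subst hka; simp [hkt]
        · simp [hka, hkb, hkt]
  · rw [List.length_reverse]; omega
  · funext k
    by_cases hkt : k = .t
    · subst hkt; simp [ha.symm, hb.symm, ht]
    · by_cases hkb : k = b
      · subst hkb; simp [hab.symm]
      · by_cases hka : k = a
        · subst hka; simp [hab]
        · simp [hka, hkb, hkt]

theorem runs_pushN {s : Sym} {n : ℕ} :
    (pushN k s n).Runs S (n + 1) (Function.update S k (List.replicate n s ++ S k)) := by
  have h := Runs.seqRange (P := fun _ => (push k s : Prog)) (c := 1) (n := n)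
    (st := fun j => Function.update S k (List.replicate j s ++ S k))
    (fun j _ => Runs.push.congr rfl le_rfl (by simp [List.replicate_succ]))
  exact h.congr (by simp) (by simp) rfl

theorem runs_popN {n : ℕ} :
    (popN k n).Runs S (n + 1) (Function.update S k ((S k).drop n)) := by
  have h := Runs.seqRange (P := fun _ => (pop k : Prog)) (c := 1) (n := n)
    (st := fun j => Function.update S k ((S k).drop j))
    (fun j _ => Runs.pop.congr rfl le_rfl (by simp))
  exact h.congr (by simp) (by simp) rfl

/-! #### Reading the input -/

/-- Move the matrix from the input to the stack `mat`, and write the number of rows on `one`. -/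
def readInput : Prog :=
  whileNonempty .inp ((onTop .inp fun
    | some (.inl (some b)) => push .mat (bit b)
    | some (.inl none) => (push .mat sep).seq (push .one (bit true))
    | _ => skip).seq (pop .inp))

/-- The end marks of the rows are counted on `one`, which gives the number of vertices in unary; the
random bits are discarded. -/
theorem runs_readInput (L : List (Option Bool)) (B : List Bool) :
    readInput.Runs (Regs.get { inp := L.map .inl ++ B.map .inr })
      ((L.length + B.length) * 5 + 1)
      (Regs.get { mat := (L.map .inl).reverse, one := .replicate (L.count none) (bit true) }) := by
  let f : List Sym × List Sym → Sym → List Sym × List Sym := fun g s =>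
    match s with
    | .inl (some b) => (bit b :: g.1, g.2)
    | .inl none => (sep :: g.1, bit true :: g.2)
    | .inr _ => g
  have h := Runs.loop_foldl (k := .inp) (e := id) (p := Option.isSome)
    (P := ((onTop .inp fun
      | some (.inl (some b)) => push .mat (bit b)
      | some (.inl none) => (push .mat sep).seq (push .one (bit true))
      | _ => skip).seq (pop .inp) : Prog)) (fun _ => True) 4
    (fun l g => Regs.get { inp := l, mat := g.1, one := g.2 }) f
    (fun g => rfl) (fun s l g => rfl)
    (fun s l g _ => by
      match s with
      | .inl (some b) =>
        exact (Runs.seq (Runs.onTop (some (.inl (some b))) rfl .push) .pop).congr rfl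
          (by norm_num) (by funext k; cases k <;> rfl)
      | .inl none =>
        exact (Runs.seq (Runs.onTop (some (.inl none)) rfl (.seq .push .push)) .pop).congr rfl
          le_rfl (by funext k; cases k <;> rfl)
      | .inr c =>
        exact (Runs.seq (Runs.onTop (some (.inr c)) rfl .skip) .pop).congr rfl
          (by norm_num) (by funext k; cases k <;> rfl))
    (L.map .inl ++ B.map .inr) (fun _ _ => trivial) ([], [])
  refine h.congr rfl (by simp) ?_
  have h₁ : ∀ (B : List Bool) g, (B.map Sum.inr).foldl f g = g := by
    intro B g
    induction B generalizing g with
    | nil => rfl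
    | cons c B ih => exact ih g
  have h₂ : ∀ (L : List (Option Bool)) g, (L.map Sum.inl).foldl f g =
      ((L.map .inl).reverse ++ g.1, .replicate (L.count none) (bit true) ++ g.2) := by
    intro L g
    induction L generalizing g with
    | nil => rfl
    | cons o L ih =>
      rw [List.map_cons, List.foldl_cons, ih]
      cases o with
      | none => simp [f, List.replicate_succ']
      | some b => simp [f]
  rw [List.foldl_append, h₁, h₂]
  simp

/-! #### Logarithms of unary numbers -/

/-- A number in unary. -/
abbrev unary (n : ℕ) : List Sym := .replicate n (bit true)

/-- Divide the unary number `cnt` by `R`, rounding down. -/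
def divide (R : ℕ) : Prog :=
  (popN .cnt (R - 1)).seq ((whileNonempty .cnt ((push .cnt2 (bit true)).seq (popN .cnt R))).seq
    (move .cnt2 .cnt))

/-- The loop writes one unit per started block of `R`, hence it rounds up. Dropping `R - 1` units
beforehand turns this into rounding down. -/
theorem runs_divide {R n : ℕ} (hR : 0 < R) (h₁ : S .cnt = unary n) (h₂ : S .cnt2 = []) :
    (divide R).Runs S (R + n * (R + 7) + 2) (Function.update S .cnt (unary (n / R))) := by
  have hloop : ∀ n m, (whileNonempty .cnt ((push .cnt2 (bit true)).seq (popN .cnt R))).Runs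
      (Function.update (Function.update S .cnt (unary n)) .cnt2 (unary m)) (n * (R + 3) + 1)
      (Function.update (Function.update S .cnt []) .cnt2 (unary (m + (n + (R - 1)) / R))) := by
    intro n
    induction n using Nat.strong_induction_on with
    | _ n ih =>
      intro m
      rcases Nat.eq_zero_or_pos n with rfl | hn
      · refine (Runs.loop_done (by simp)).congr rfl (by simp) ?_
        rw [Nat.zero_add, Nat.div_eq_of_lt (by omega)]
        simp
      · refine (Runs.loop_step (by
            obtain ⟨j, rfl⟩ := Nat.exists_eq_succ_of_ne_zero hn.ne'
            simp [unary, List.replicate_succ])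
          (Runs.seq .push runs_popN) ((ih (n - R) (by omega) (m + 1)).congr ?_ le_rfl rfl)).congr
          rfl ?_ ?_
        · funext k
          by_cases hk : k = .cnt2
          · subst hk; simp [unary, List.replicate_succ]
          · by_cases hk' : k = .cnt
            · subst hk'; simp [unary]
            · simp [hk, hk']
        · have : (n - R) * (R + 3) + (R + 3) ≤ n * (R + 3) := by
            rw [← Nat.succ_mul]
            exact Nat.mul_le_mul_right _ (by omega)
          omega
        · congr 2
          rw [show n + (R - 1) = n - 1 + R by omega, Nat.add_div_right _ hR]
          rcases le_total R n with h | h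
          · rw [show n - R + (R - 1) = n - 1 by omega]; omega
          · rw [Nat.sub_eq_zero_of_le h, Nat.div_eq_of_lt (by omega),
              Nat.div_eq_of_lt (by omega)]
  refine (Runs.seq runs_popN (Runs.seq ((hloop (n - (R - 1)) 0).congr ?_ le_rfl rfl)
    (runs_move (by decide)))).congr rfl ?_ ?_
  · funext k
    by_cases hk : k = .cnt2
    · subst hk; simp [unary, h₂]
    · by_cases hk' : k = .cnt
      · subst hk'; simp [unary, h₁]
      · simp [hk, hk']
  · have h₃ : (n - (R - 1)) * (R + 3) ≤ n * (R + 3) := Nat.mul_le_mul_right _ (by omega)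
    have h₄ : (n - (R - 1) + (R - 1)) / R ≤ n := by
      rcases le_total (R - 1) n with h | h
      · rw [Nat.sub_add_cancel h]; exact Nat.div_le_self _ _
      · rw [Nat.sub_eq_zero_of_le h, Nat.div_eq_of_lt (by omega)]; omega
    have h₅ : n * (R + 7) = n * (R + 3) + n * 4 := by ring
    simp only [Function.update_self, List.length_replicate, Nat.zero_add]
    omega
  · have h₄ : (n - (R - 1) + (R - 1)) / R = n / R := by
      rcases le_total (R - 1) n with h | h
      · rw [Nat.sub_add_cancel h]
      · rw [Nat.sub_eq_zero_of_le h, Nat.div_eq_of_lt (by omega)]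
        rcases h.lt_or_eq with h | h
        · exact (Nat.div_eq_of_lt (by omega)).symm
        · exact (Nat.div_eq_of_lt (by omega)).symm
    funext k
    by_cases hk : k = .cnt2
    · subst hk; simp [h₂]
    · by_cases hk' : k = .cnt
      · subst hk'; simp [unary, h₄]
      · simp [hk, hk']

/-- The number of digits of `n` in base `R`. -/
def numDigits (R n : ℕ) : ℕ := (Nat.digits R n).length

/-- Write the number of digits of the unary number `a` in base `R` on the stack `b`. -/
def logarithm (R : ℕ) (a b : Stack) : Prog :=
  (copy a .cnt).seq (whileNonempty .cnt ((push b (bit true)).seq (divide R)))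

/-- The number of digits is the number of divisions by `R` until zero is reached. -/
theorem runs_logarithm {R n : ℕ} (hR : 1 < R) (ha : a ≠ .cnt) (hat : a ≠ .t) (hb : b ≠ .cnt)
    (hb2 : b ≠ .cnt2) (hba : b ≠ a) (hn : S a = unary n) (ht : S .t = [])
    (hc : S .cnt = []) (hc2 : S .cnt2 = []) (hSb : S b = []) :
    (logarithm R a b).Runs S (n * 10 + n * (R + n * (R + 7) + 4) + 3)
      (Function.update S b (unary (numDigits R n))) := by
  have hloop : ∀ i ≤ n, ∀ m, (whileNonempty .cnt ((push b (bit true)).seq (divide R))).Runs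
      (Function.update (Function.update S .cnt (unary i)) b (unary m))
      (i * (R + n * (R + 7) + 4) + 1)
      (Function.update (Function.update S .cnt []) b (unary (m + numDigits R i))) := by
    intro i
    induction i using Nat.strong_induction_on with
    | _ i ih =>
      intro hi m
      rcases Nat.eq_zero_or_pos i with rfl | hpos
      · exact (Runs.loop_done (by simp [hb.symm])).congr rfl (by simp) (by simp [numDigits])
      · have hlt : i / R < i := Nat.div_lt_self hpos hR
        refine (Runs.loop_step (by
            obtain ⟨j, rfl⟩ := Nat.exists_eq_succ_of_ne_zero hpos.ne'
            simp [unary, List.replicate_succ, hb.symm])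
          (Runs.seq .push (runs_divide (n := i) (by omega) ?_ ?_))
          ((ih _ hlt (by omega) (m + 1)).congr ?_ le_rfl rfl)).congr rfl ?_ ?_
        · simp [hb.symm]
        · simp [hb2.symm, hc2]
        · funext k
          by_cases hk : k = b
          · subst hk; simp [unary, List.replicate_succ, hb]
          · by_cases hk' : k = .cnt
            · subst hk'; simp [unary, hk]
            · simp [hk, hk']
        · have h₁ : i * (R + 7) ≤ n * (R + 7) := Nat.mul_le_mul_right _ hi
          have h₂ : i / R * (R + n * (R + 7) + 4) + (R + n * (R + 7) + 4) ≤
              i * (R + n * (R + 7) + 4) := by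
            rw [← Nat.succ_mul]
            exact Nat.mul_le_mul_right _ hlt
          omega
        · congr 2
          rw [numDigits, numDigits, Nat.digits_def' hR hpos, List.length_cons]
          omega
  refine (Runs.seq (runs_copy ha hat (by decide) ht)
    ((hloop n le_rfl 0).congr ?_ le_rfl rfl)).congr rfl ?_ ?_
  · funext k
    by_cases hk : k = b
    · subst hk; simp [unary, hb, hSb]
    · by_cases hk' : k = .cnt
      · subst hk'; simp [hk, hn, hc]
      · simp [hk, hk']
  · rw [hn, List.length_replicate]
    omega
  · funext k
    by_cases hk : k = b
    · subst hk; simp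
    · by_cases hk' : k = .cnt
      · subst hk'; simp [hk, hc]
      · simp [hk, hk']

end StackProgram

namespace StackProgram

open Turing TM2 Routine

/-! #### Instructions -/

/-- An instruction for the computation of a row, as a string: the vectors by which its tensor
factors are masked. -/
def encInstr (V : List (List Bool)) : List Sym := V.flatMap fun v => v.map bit ++ [sep]

/-- The instruction that masks the `j`-th of `l` tensor factors by `v`; the empty vector does not
mask anything. -/
def instr (l j : ℕ) (v : List Bool) : List (List Bool) :=
  List.replicate j [] ++ v :: List.replicate (l - 1 - j) []

/-- An empty vector is encoded by its end mark alone, so an instruction is one vector between runs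
of end marks. The `l - j` marks after it include its own. -/
theorem encInstr_instr {l j : ℕ} (hj : j < l) (v : List Bool) :
    encInstr (instr l j v) = List.replicate j sep ++ (v.map bit ++ List.replicate (l - j) sep) := by
  have h (n : ℕ) : encInstr (List.replicate n []) = List.replicate n sep := by
    induction n with
    | zero => rfl
    | succ n ih =>
      rw [List.replicate_succ, List.replicate_succ, ← ih]
      rfl
  have h' : l - j = (l - 1 - j) + 1 := by omega
  rw [instr, encInstr, List.flatMap_append, List.flatMap_cons]
  change encInstr _ ++ (_ ++ encInstr _) = _
  rw [h, h, h', List.replicate_succ]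
  simp

/-- Put an instruction on the stack `ins`, where `mv` puts the vector there. -/
def putInstr (l j : ℕ) (mv : Prog) : Prog :=
  (pushN .ins sep (l - j)).seq (mv.seq (pushN .ins sep j))

theorem runs_putInstr {l j : ℕ} (hj : j < l) {v : List Bool} {mv : Prog} {r r' : Regs} {c : ℕ}
    (h : mv.Runs (Regs.get { r with ins := List.replicate (l - j) sep ++ r.ins }) c
      (Regs.get { r' with ins := v.map bit ++ (List.replicate (l - j) sep ++ r.ins) })) :
    (putInstr l j mv).Runs r.get (l + c + 2)
      (Regs.get { r' with ins := encInstr (instr l j v) ++ r.ins }) := by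
  refine (Runs.seq runs_pushN (Runs.seq (h.congr ?_ le_rfl rfl) runs_pushN)).congr rfl
    (by omega) ?_
  · funext k; cases k <;> rfl
  · rw [encInstr_instr hj]
    funext k; cases k <;> first | rfl | simp [Regs.get]

/-! #### Binary counting -/

/-- The values of a bit that is toggled at the marked times. -/
def toggle : Bool → List Bool → List Bool
  | _, [] => []
  | s, c :: l => (s ^^ c) :: toggle (s ^^ c) l

/-- The times at which a bit that is toggled at the marked times becomes `false`. -/
def carryOut : Bool → List Bool → List Bool
  | _, [] => []
  | s, c :: l => (c && s) :: carryOut (s ^^ c) l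

theorem length_carryOut (s : Bool) (l : List Bool) : (carryOut s l).length = l.length := by
  induction l generalizing s with
  | nil => rfl
  | cons c l ih => simp [carryOut, ih]

/-- One pass over the stack `car`: the values of the bit are written on `y`, the carries on
`car`. -/
def scan : Prog :=
  (whileNonempty .car ((onTop .car fun
    | some (.inl (some true)) => onTop .reg fun
      | none => (push .reg (bit true)).seq ((push .y (bit true)).seq (push .car2 (bit false)))
      | some _ => (pop .reg).seq ((push .y (bit false)).seq (push .car2 (bit true)))
    | _ => onTop .reg fun
      | none => (push .y (bit false)).seq (push .car2 (bit false))
      | some _ => (push .y (bit true)).seq (push .car2 (bit false))).seq (pop .car))).seq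
  ((pop .reg).seq (move .car2 .car))

/-- The current value of the bit is held by `reg`: nonempty means `true`. Both results come out
reversed; moving `car2` back to `car` corrects the carries, and `y` is corrected when it is moved to
`ins`. -/
theorem runs_scan (r : Regs) (c : List Bool) :
    scan.Runs (Regs.get { r with car := c.map bit, reg := [], y := [], car2 := [] })
      (c.length * 11 + 3)
      (Regs.get { r with
        car := (carryOut false c).map bit, reg := [], y := ((toggle false c).map bit).reverse,
        car2 := [] }) := by
  let f : Bool × List Bool × List Bool → Bool → Bool × List Bool × List Bool := fun g c =>
    (g.1 ^^ c, (g.1 ^^ c) :: g.2.1, (c && g.1) :: g.2.2)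
  have h := Runs.loop_foldl (k := .car) (e := id) (p := Option.isSome)
    (P := ((onTop .car fun
    | some (.inl (some true)) => onTop .reg fun
      | none => (push .reg (bit true)).seq ((push .y (bit true)).seq (push .car2 (bit false)))
      | some _ => (pop .reg).seq ((push .y (bit false)).seq (push .car2 (bit true)))
    | _ => onTop .reg fun
      | none => (push .y (bit false)).seq (push .car2 (bit false))
      | some _ => (push .y (bit true)).seq (push .car2 (bit false))).seq (pop .car) : Prog))
    (fun _ => True) 6
    (fun l g => Regs.get { r with
      car := l.map bit, reg := if g.1 then [bit true] else [], y := g.2.1.map bit,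
      car2 := g.2.2.map bit }) f
    (fun g => rfl) (fun s l g => rfl)
    (fun s l g _ => by
      obtain ⟨s', y, c2⟩ := g
      cases s <;> cases s'
      · exact (Runs.seq (Runs.onTop (some (bit false)) rfl (Runs.onTop none rfl
          (.seq .push .push))) .pop).congr rfl (by norm_num) (by funext k; cases k <;> rfl)
      · exact (Runs.seq (Runs.onTop (some (bit false)) rfl (Runs.onTop (some (bit true)) rfl
          (.seq .push .push))) .pop).congr rfl (by norm_num) (by funext k; cases k <;> rfl)
      · exact (Runs.seq (Runs.onTop (some (bit true)) rfl (Runs.onTop none rfl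
          (.seq .push (.seq .push .push)))) .pop).congr rfl (by norm_num)
          (by funext k; cases k <;> rfl)
      · exact (Runs.seq (Runs.onTop (some (bit true)) rfl (Runs.onTop (some (bit true)) rfl
          (.seq .pop (.seq .push .push)))) .pop).congr rfl (by norm_num)
          (by funext k; cases k <;> rfl))
    c (fun _ _ => trivial) (false, [], [])
  have hf : ∀ (c : List Bool) g, (c.foldl f g).2 =
      ((toggle g.1 c).reverse ++ g.2.1, (carryOut g.1 c).reverse ++ g.2.2) := by
    intro c
    induction c with
    | nil => intro g; rfl
    | cons c l ih => intro g; rw [List.foldl_cons, ih]; simp [f, toggle, carryOut]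
  refine (h.seq (Runs.seq .pop (runs_move (by decide)))).congr rfl ?_ ?_
  · have : (c.foldl f (false, [], [])).2.2.length = c.length := by simp [hf, length_carryOut]
    simp only [Regs.get, Function.update]
    simp [this]
    omega
  · have hs : ∀ b : Bool, (if b = true then [bit true] else []).tail = [] := by
      intro b; cases b <;> rfl
    funext k
    cases k <;> first | rfl | simp [Regs.get, hf, hs]

/-! #### Masks -/

/-- The times at which the `i`-th bit of a binary counter is toggled. -/
def carries (n i : ℕ) : List Bool := (List.range n).map fun w => decide (2 ^ i ∣ w + 1)

/-- The `i`-th bit of a binary counter. -/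
def mask (n i : ℕ) : List Bool := (List.range n).map fun w => (w + 1).testBit i

/-- The quotient by `2 ^ i` increases by one exactly when `2 ^ i` divides `n + 1`, and this flips
its parity. -/
theorem testBit_succ_eq (n i : ℕ) :
    (n + 1).testBit i = (n.testBit i ^^ decide (2 ^ i ∣ n + 1)) := by
  have h : (n + 1) / 2 ^ i = n / 2 ^ i + if 2 ^ i ∣ n + 1 then 1 else 0 := Nat.succ_div
  rw [Nat.testBit_eq_decide_div_mod_eq, Nat.testBit_eq_decide_div_mod_eq, h]
  by_cases hd : 2 ^ i ∣ n + 1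
  · rcases Nat.mod_two_eq_zero_or_one (n / 2 ^ i) with h | h <;>
      simp [hd, Nat.add_mod, h]
  · simp [hd]

/-- A carry leaves bit `i` exactly when one enters it and the bit was set. -/
theorem dvd_succ_iff (n i : ℕ) :
    decide (2 ^ (i + 1) ∣ n + 1) = (decide (2 ^ i ∣ n + 1) && n.testBit i) := by
  have h := testBit_succ_eq n i
  by_cases hd : 2 ^ i ∣ n + 1
  · obtain ⟨m, hm⟩ := hd
    have h₁ : (n + 1).testBit i = decide (m % 2 = 1) := by
      rw [Nat.testBit_eq_decide_div_mod_eq, hm, Nat.mul_div_cancel_left _ (by positivity)]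
    have h₂ : 2 ^ (i + 1) ∣ n + 1 ↔ m % 2 = 0 := by
      rw [hm, pow_succ, Nat.mul_dvd_mul_iff_left (by positivity), Nat.dvd_iff_mod_eq_zero]
    have h₃ : 2 ^ i ∣ n + 1 := ⟨m, hm⟩
    simp only [h₂, h₃, decide_true, Bool.xor_true, Bool.true_and] at h ⊢
    rw [← Bool.not_not (n.testBit i), ← h, h₁]
    rcases Nat.mod_two_eq_zero_or_one m with h | h <;> simp [h]
  · have : ¬ 2 ^ (i + 1) ∣ n + 1 := fun h => hd ((pow_dvd_pow 2 i.le_succ).trans h)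
    simp [hd, this]

/-- The induction needs an arbitrary starting time `m`, where the bit has the value `m.testBit i`.
-/
theorem toggle_carries (n i : ℕ) : toggle false (carries n i) = mask n i := by
  have h : ∀ n m, toggle (m.testBit i)
      ((List.range' m n).map fun w => decide (2 ^ i ∣ w + 1)) =
      (List.range' m n).map fun w => (w + 1).testBit i := by
    intro n
    induction n with
    | zero => intro m; rfl
    | succ n ih =>
      intro m
      rw [List.range'_succ, List.map_cons, List.map_cons, toggle, ← testBit_succ_eq, ih]
  have := h n 0
  rwa [Nat.zero_testBit, ← List.range_eq_range'] at this

theorem carryOut_carries (n i : ℕ) : carryOut false (carries n i) = carries n (i + 1) := by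
  have h : ∀ n m, carryOut (m.testBit i)
      ((List.range' m n).map fun w => decide (2 ^ i ∣ w + 1)) =
      (List.range' m n).map fun w => decide (2 ^ (i + 1) ∣ w + 1) := by
    intro n
    induction n with
    | zero => intro m; rfl
    | succ n ih =>
      intro m
      rw [List.range'_succ, List.map_cons, List.map_cons, carryOut, ← testBit_succ_eq, ih,
        dvd_succ_iff]
  have := h n 0
  rwa [Nat.zero_testBit, ← List.range_eq_range'] at this

/-- Bit `0` is toggled at every time, so a plain copy of the unary number on `one` is the right
initial content of `car`. -/
theorem carries_zero (n : ℕ) : carries n 0 = List.replicate n true := by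
  simp [carries, List.map_const']

/-- Write instructions for the masking of the `j`-th tensor factor by the bits of a binary
counter. -/
def putMasks (l j : ℕ) : Prog :=
  (copy .one .car).seq ((copy .qs .cnt).seq ((whileNonempty .cnt
    (scan.seq ((putInstr l j (move .y .ins)).seq (pop .cnt)))).seq (clear .car)))

/-- The instructions written by `putMasks`, in the order in which they are written. -/
def maskInstrs (l n q j : ℕ) : List (List (List Bool)) :=
  (List.range q).map fun i => instr l j (mask n i)

/-- A list of instructions, which were written one after the other. -/
def encInstrs (L : List (List (List Bool))) : List Sym := L.reverse.flatMap encInstr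

theorem encInstrs_append (L L' : List (List (List Bool))) :
    encInstrs (L ++ L') = encInstrs L' ++ encInstrs L := by simp [encInstrs]

theorem encInstrs_singleton (V : List (List Bool)) : encInstrs [V] = encInstr V := by
  simp [encInstrs]

theorem runs_putMasks {l j n q : ℕ} (hj : j < l) (r : Regs) (h₁ : r.one = unary n)
    (h₂ : r.qs = unary q) (h₃ : r.car = []) (h₄ : r.cnt = []) (h₅ : r.y = []) (h₆ : r.car2 = [])
    (h₇ : r.t = []) (h₈ : r.reg = []) :
    (putMasks l j).Runs r.get (12 * n + 10 * q + q * (15 * n + l + 8) + 6)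
      (Regs.get { r with ins := encInstrs (maskInstrs l n q j) ++ r.ins }) := by
  have hlen (i : ℕ) : (carries n i).length = n := by simp [carries]
  -- Loop invariant: before the pass for bit `i`, `car` marks the times at which that bit is
  -- toggled; the pass leaves the marks for bit `i + 1`.
  let st : ℕ → Regs := fun i => { r with
    car := (carries n i).map bit, cnt := unary (q - i),
    ins := encInstrs (maskInstrs l n i j) ++ r.ins }
  have hloop := Runs.loop_iterate (k := .cnt) (e := id) (p := Option.isSome)
    (P := (scan.seq ((putInstr l j (move .y .ins)).seq (pop .cnt)) : Prog)) q
    (15 * n + l + 7) (fun i => (st i).get) (by simp [st, Regs.get])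
    (fun i hi => by
      obtain ⟨m, hm⟩ : ∃ m, q - i = m + 1 := ⟨q - i - 1, by omega⟩
      simp [st, Regs.get, hm, List.replicate_succ])
    (fun i hi => by
      have hs := runs_scan (st i) (carries n i)
      rw [carryOut_carries, toggle_carries, hlen] at hs
      refine (Runs.seq (hs.congr ?_ le_rfl rfl) (Runs.seq (runs_putInstr hj (c := 4 * n + 1)
        (v := mask n i) (r' := { st i with
          car := (carries n (i + 1)).map bit, reg := [], car2 := [], y := [] })
        ((runs_move (by decide)).congr rfl ?_ ?_)) .pop)).congr rfl ?_ ?_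
      · funext k; cases k <;> simp [Regs.get, st, h₅, h₆, h₈]
      · simp [Regs.get, mask, mul_comm]
      · funext k; cases k <;> first | rfl | simp [Regs.get]
      · omega
      · funext k
        cases k <;>
          simp [Regs.get, st, h₅, h₆, h₈, maskInstrs, List.range_succ, encInstrs_append,
            encInstrs_singleton, unary, List.tail_replicate]
        omega)
  refine (Runs.seq (runs_copy (by decide) (by decide) (by decide) h₇) (Runs.seq
    (runs_copy (by decide) (by decide) (by decide) ?_)
    (Runs.seq (hloop.congr ?_ le_rfl rfl) runs_clear))).congr rfl ?_ ?_
  · simpa [Regs.get] using h₇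
  · funext k
    cases k <;> simp [Regs.get, st, h₁, h₂, h₃, h₄, carries_zero, maskInstrs, encInstrs]
  · simp [Regs.get, st, h₁, h₂, hlen]
    ring_nf
    omega
  · funext k
    cases k <;> simp [Regs.get, st, h₃, h₄]

/-- Write the instructions for all colours, once for each vertex. -/
def putColors (l : ℕ) : Prog :=
  (copy .one .lp).seq (whileNonempty .lp ((seqRange (putMasks l) l).seq (pop .lp)))

/-- The instructions for all colours. -/
def colorInstrs (l n q : ℕ) : List (List (List Bool)) :=
  (List.range l).flatMap fun j => maskInstrs l n q j

/-- Writing the full list of colours `n` times provides at least one instruction per vertex without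
dividing `n` by `l * q`; the surplus is cleared at the end. -/
theorem runs_putColors {l n q : ℕ} (r : Regs) (h₁ : r.one = unary n)
    (h₂ : r.qs = unary q) (h₃ : r.car = []) (h₄ : r.cnt = []) (h₅ : r.y = []) (h₆ : r.car2 = [])
    (h₇ : r.t = []) (h₈ : r.reg = []) (h₉ : r.lp = []) :
    (putColors l).Runs r.get
      (10 * n + n * (l * (12 * n + 10 * q + q * (15 * n + l + 8) + 6) + 3) + 3)
      (Regs.get { r with
        ins := encInstrs (List.replicate n (colorInstrs l n q)).flatten ++ r.ins }) := by
  let T := 12 * n + 10 * q + q * (15 * n + l + 8) + 6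
  have hin (I : List Sym) (m : ℕ) : (seqRange (putMasks l) l).Runs
      (Regs.get { r with lp := unary m, ins := I }) (l * T + 1)
      (Regs.get { r with lp := unary m, ins := encInstrs (colorInstrs l n q) ++ I }) := by
    have := Runs.seqRange (P := putMasks l) (c := T) (n := l)
      (st := fun j => Regs.get { r with
        lp := unary m,
        ins := encInstrs ((List.range j).flatMap fun j => maskInstrs l n q j) ++ I })
      (fun j hj => (runs_putMasks hj { r with
          lp := unary m
          ins := encInstrs ((List.range j).flatMap fun j => maskInstrs l n q j) ++ I }
          h₁ h₂ h₃ h₄ h₅ h₆ h₇ h₈).congr rfl le_rfl (by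
        simp only [List.range_succ, List.flatMap_append, encInstrs_append, List.append_assoc,
          List.flatMap_cons, List.flatMap_nil, List.append_nil]))
    exact this.congr rfl le_rfl rfl
  have hloop := Runs.loop_iterate (k := .lp) (e := id) (p := Option.isSome)
    (P := ((seqRange (putMasks l) l).seq (pop .lp) : Prog)) n (l * T + 2)
    (fun i => Regs.get { r with
      lp := unary (n - i),
      ins := encInstrs (List.replicate i (colorInstrs l n q)).flatten ++ r.ins })
    (by simp [Regs.get])
    (fun i hi => by
      obtain ⟨m, hm⟩ : ∃ m, n - i = m + 1 := ⟨n - i - 1, by omega⟩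
      simp [Regs.get, hm, List.replicate_succ])
    (fun i hi => (Runs.seq (hin _ _) .pop).congr rfl le_rfl (by
      funext k
      cases k <;> simp [Regs.get, unary, List.tail_replicate, List.replicate_succ',
        encInstrs_append]
      omega))
  refine (Runs.seq (runs_copy (by decide) (by decide) (by decide) h₇)
    (hloop.congr ?_ le_rfl rfl)).congr rfl ?_ ?_
  · funext k
    cases k <;> simp [Regs.get, h₁, h₉, encInstrs]
  · simp only [Regs.get, h₁, List.length_replicate]
    change _ ≤ 10 * n + n * (l * T + 3) + 3
    rw [show l * T + 2 + 1 = l * T + 3 from rfl]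
    omega
  · funext k
    cases k <;> simp [Regs.get, h₉]

/-! #### Unit vectors -/

/-- The indicator of `w`, as a vector of length more than `n`. -/
def unitVec (n w : ℕ) : List Bool := List.replicate w false ++ true :: List.replicate n false

/-- The instructions for the rows that tell the columns from each other. -/
def idInstrs (l n m : ℕ) : List (List (List Bool)) :=
  (List.range m).flatMap fun w => (List.range l).map fun j => instr l j (unitVec n w)

/-- Write the instructions for the rows that tell the columns from each other, and as many rows
`1, …, 1`. -/
def putIds (l : ℕ) : Prog :=
  (copy .one .cnt).seq ((whileNonempty .cnt ((push .vec (bit false)).seq (pop .cnt))).seq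
    ((push .vec (bit true)).seq ((copy .one .lp).seq ((whileNonempty .lp
      ((seqRange (fun j => (putInstr l j (copy .vec .ins)).seq
        ((copy .one .mat).seq (push .mat sep))) l).seq
        ((push .vec (bit false)).seq (pop .lp)))).seq (clear .vec)))))

/-- Some rows `1, …, 1`. -/
def onesRows (n m : ℕ) : List Sym := (List.replicate m (sep :: unary n)).flatten

theorem onesRows_succ_mul (n w l : ℕ) :
    onesRows n ((w + 1) * l) = onesRows n l ++ onesRows n (w * l) := by
  rw [onesRows, add_mul, one_mul, add_comm, List.replicate_add, List.flatten_append]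
  rfl

/-- Masking factor `j` of an all-ones row by a unit vector leaves the indicator of `t_j = w`. One
pushed `false` turns the vector for `w` into the one for `w + 1`. The `n` trailing `false` are
necessary because short masks are continued by `true`. -/
theorem runs_putIds {l n : ℕ} (r : Regs) (h₁ : r.one = unary n) (h₂ : r.cnt = [])
    (h₃ : r.vec = []) (h₄ : r.t = []) (h₅ : r.lp = []) :
    (putIds l).Runs r.get (n * (l * (30 * n + l + 19) + 4) + 27 * n + 12)
      (Regs.get { r with
        ins := encInstrs (idInstrs l n n) ++ r.ins, mat := onesRows n (n * l) ++ r.mat }) := by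
  have hvec := Runs.loop_iterate (k := .cnt) (e := id) (p := Option.isSome)
    (P := ((push .vec (bit false)).seq (pop .cnt) : Prog)) n 2
    (fun i => Regs.get { r with cnt := unary (n - i), vec := List.replicate i (bit false) })
    (by simp [Regs.get])
    (fun i hi => by
      obtain ⟨m, hm⟩ : ∃ m, n - i = m + 1 := ⟨n - i - 1, by omega⟩
      simp [Regs.get, hm, List.replicate_succ])
    (fun i hi => (Runs.seq .push .pop).congr rfl le_rfl (by
      funext k
      cases k <;> simp [Regs.get, unary, List.tail_replicate, List.replicate_succ]
      omega))
  have hin (w m : ℕ) (hw : w < n) (I M : List Sym) :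
      (seqRange (fun j => (putInstr l j (copy .vec .ins)).seq
        ((copy .one .mat).seq (push .mat sep))) l).Runs
      (Regs.get { r with lp := unary m, vec := (unitVec n w).map bit, ins := I, mat := M })
      (l * (30 * n + l + 19) + 1)
      (Regs.get { r with
        lp := unary m, vec := (unitVec n w).map bit
        ins := encInstrs ((List.range l).map fun j => instr l j (unitVec n w)) ++ I
        mat := onesRows n l ++ M }) := by
    have := Runs.seqRange (P := fun j => ((putInstr l j (copy .vec .ins)).seq
        ((copy .one .mat).seq (push .mat sep)) : Prog)) (c := 30 * n + l + 19) (n := l)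
      (st := fun j => Regs.get { r with
        lp := unary m, vec := (unitVec n w).map bit
        ins := encInstrs ((List.range j).map fun j => instr l j (unitVec n w)) ++ I
        mat := onesRows n j ++ M })
      (fun j hj => by
        refine (Runs.seq (runs_putInstr hj (v := unitVec n w) (c := 20 * n + 12)
          (r' := { r with lp := unary m, vec := (unitVec n w).map bit, mat := onesRows n j ++ M })
          ((runs_copy (by decide) (by decide) (by decide) h₄).congr rfl ?_ ?_)) (Runs.seq
          (runs_copy (by decide) (by decide) (by decide) h₄) .push)).congr rfl ?_ ?_
        · simp [Regs.get, unitVec]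
          omega
        · funext k; cases k <;> rfl
        · simp [Regs.get, h₁]
          omega
        · funext k
          cases k <;> simp [Regs.get, List.range_succ, encInstrs_append, encInstrs_singleton,
            onesRows, List.replicate_succ, h₁])
    exact this.congr rfl le_rfl rfl
  have hloop := Runs.loop_iterate (k := .lp) (e := id) (p := Option.isSome)
    (P := ((seqRange (fun j => (putInstr l j (copy .vec .ins)).seq
        ((copy .one .mat).seq (push .mat sep))) l).seq
        ((push .vec (bit false)).seq (pop .lp)) : Prog)) n (l * (30 * n + l + 19) + 3)
    (fun w => Regs.get { r with
      lp := unary (n - w), vec := (unitVec n w).map bit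
      ins := encInstrs (idInstrs l n w) ++ r.ins, mat := onesRows n (w * l) ++ r.mat })
    (by simp [Regs.get])
    (fun i hi => by
      obtain ⟨m, hm⟩ : ∃ m, n - i = m + 1 := ⟨n - i - 1, by omega⟩
      simp [Regs.get, hm, List.replicate_succ])
    (fun w hw => (Runs.seq (hin w _ hw _ _) (.seq .push .pop)).congr rfl (by omega) (by
      funext k
      cases k <;> simp [Regs.get, unary, List.tail_replicate, List.replicate_succ, unitVec,
        idInstrs, List.range_succ, encInstrs_append, onesRows_succ_mul]
      omega))
  refine (Runs.seq (runs_copy (by decide) (by decide) (by decide) h₄) (Runs.seq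
    (hvec.congr ?_ le_rfl rfl) (Runs.seq .push (Runs.seq
    (runs_copy (by decide) (by decide) (by decide) ?_) (Runs.seq (hloop.congr ?_ le_rfl rfl)
    runs_clear))))).congr rfl ?_ ?_
  · funext k
    cases k <;> simp [Regs.get, h₁, h₂, h₃]
  · simpa [Regs.get] using h₄
  · funext k
    cases k <;> simp [Regs.get, h₁, h₂, h₅, unitVec, idInstrs, encInstrs, onesRows]
  · simp [Regs.get, h₁, unitVec]
    ring_nf
    omega
  · funext k
    cases k <;> simp [Regs.get, h₂, h₃, h₅]

end StackProgram

namespace StackProgram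

open Turing TM2 Routine

/-! #### Tensor products -/

/-- The bits of `X` at which the mask `V` is `true`; a mask that is too short is continued by
`true`. -/
def maskBy : List Bool → List Bool → List Bool
  | [], _ => []
  | b :: X, V => (b && V.headD true) :: maskBy X V.tail

theorem length_maskBy (X V : List Bool) : (maskBy X V).length = X.length := by
  induction X generalizing V with
  | nil => rfl
  | cons b X ih => simp [maskBy, ih]

/-- The symbol is a bit. -/
def isBit : Option Sym → Bool
  | some (.inl (some _)) => true
  | _ => false

/-- Mask the vector on `x` by the first vector on `ins`, which is dropped. The result is written
on `y` from right to left. -/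
def applyMask : Prog :=
  (whileNonempty .x ((onTop .ins fun
    | some (.inl (some true)) => (copyTop .x .y).seq (pop .ins)
    | some (.inl (some false)) => (push .y (bit false)).seq (pop .ins)
    | _ => copyTop .x .y).seq ((copyTop .x .t).seq (pop .x)))).seq
  ((loop .ins id isBit (pop .ins)).seq ((pop .ins).seq (move .t .x)))

theorem runs_applyMask (r : Regs) (X V : List Bool) (I : List Sym) :
    applyMask.Runs
      (Regs.get { r with x := X.map bit, y := [], t := [], ins := V.map bit ++ sep :: I })
      (X.length * 12 + V.length * 2 + 4)
      (Regs.get { r with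
        x := X.map bit, y := ((maskBy X V).map bit).reverse, t := [], ins := I }) := by
  let f : List Bool × List Bool × List Bool → Bool → List Bool × List Bool × List Bool :=
    fun g b => (g.1.tail, (b && g.1.headD true) :: g.2.1, b :: g.2.2)
  have h := Runs.loop_foldl (k := .x) (e := id) (p := Option.isSome)
    (P := ((onTop .ins fun
    | some (.inl (some true)) => (copyTop .x .y).seq (pop .ins)
    | some (.inl (some false)) => (push .y (bit false)).seq (pop .ins)
    | _ => copyTop .x .y).seq ((copyTop .x .t).seq (pop .x)) : Prog)) (fun _ => True) 7
    (fun l g => Regs.get { r with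
      x := l.map bit, y := g.2.1.map bit, t := g.2.2.map bit, ins := g.1.map bit ++ sep :: I }) f
    (fun g => rfl) (fun s l g => rfl)
    (fun s l g _ => by
      obtain ⟨V, y, t⟩ := g
      match V with
      | [] =>
        exact (Runs.seq (Runs.onTop (some sep) rfl (runs_copyTop rfl))
          (Runs.seq (runs_copyTop rfl) .pop)).congr rfl (by norm_num)
          (by funext k; cases k <;> first | rfl | simp [Regs.get, f])
      | true :: V =>
        exact (Runs.seq (Runs.onTop (some (bit true)) rfl (.seq (runs_copyTop rfl) .pop))
          (Runs.seq (runs_copyTop rfl) .pop)).congr rfl (by norm_num)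
          (by funext k; cases k <;> first | rfl | simp [Regs.get, f])
      | false :: V =>
        exact (Runs.seq (Runs.onTop (some (bit false)) rfl (.seq .push .pop))
          (Runs.seq (runs_copyTop rfl) .pop)).congr rfl (by norm_num)
          (by funext k; cases k <;> first | rfl | simp [Regs.get, f]))
    X (fun _ _ => trivial) (V, [], [])
  have hf : ∀ (X : List Bool) g, X.foldl f g =
      (g.1.drop X.length, (maskBy X g.1).reverse ++ g.2.1, X.reverse ++ g.2.2) := by
    intro X
    induction X with
    | nil => intro g; rfl
    | cons c l ih => intro g; rw [List.foldl_cons, ih]; simp [f, maskBy]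
  -- The mask may be longer than the row; its unused end is removed up to the end mark.
  have h₂ := Runs.loop_foldl (k := .ins) (e := id) (p := isBit) (P := (pop .ins : Prog))
    (fun _ => True) 1
    (fun (l : List Bool) (_ : Unit) => Regs.get { r with
      x := [], y := ((maskBy X V).map bit).reverse, t := X.reverse.map bit,
      ins := l.map bit ++ sep :: I })
    (fun g _ => g) (fun g => rfl) (fun s l g => rfl)
    (fun s l g _ => Runs.pop.congr rfl le_rfl (by funext k; cases k <;> rfl))
    (V.drop X.length) (fun _ _ => trivial) ()
  refine (h.seq ((h₂.congr ?_ le_rfl rfl).seq (Runs.seq .pop (runs_move (by decide))))).congr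
    rfl ?_ ?_
  · funext k; cases k <;> first | rfl | simp [Regs.get, hf]
  · simp [Regs.get, Function.update]
    omega
  · funext k; cases k <;> first | rfl | simp [Regs.get]

/-- Replace the vector on `acc` by its tensor product with the vector that is written on `y` from
right to left. -/
def applyTensor : Prog :=
  (move .acc .t).seq ((whileNonempty .t ((whileNonempty .y ((onTop .t fun
    | some (.inl (some true)) => copyTop .y .acc
    | _ => push .acc (bit false)).seq ((copyTop .y .u).seq (pop .y)))).seq
    ((move .u .y).seq (pop .t)))).seq (clear .y))

/-- Both factors are processed from their last entry, so pushing the products puts them into the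
right order. The stack `u` preserves `y` for the next entry of the other factor. -/
theorem runs_applyTensor (r : Regs) (A Y : List Bool) :
    applyTensor.Runs
      (Regs.get { r with acc := A.map bit, y := (Y.map bit).reverse, t := [], u := [] })
      (A.length * (Y.length * 11 + 8) + Y.length * 2 + 3)
      (Regs.get { r with
        acc := (A.flatMap fun a => Y.map (a && ·)).map bit, y := [], t := [], u := [] }) := by
  have hin (a : Bool) (T acc : List Bool) : (whileNonempty .y ((onTop .t fun
      | some (.inl (some true)) => copyTop .y .acc
      | _ => push .acc (bit false)).seq ((copyTop .y .u).seq (pop .y)))).Runs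
      (Regs.get { r with
        acc := acc.map bit, y := (Y.map bit).reverse, t := (a :: T).map bit, u := [] })
      (Y.length * 7 + 1)
      (Regs.get { r with
        acc := (Y.map (a && ·) ++ acc).map bit, y := [], t := (a :: T).map bit,
        u := Y.map bit }) := by
    have h := Runs.loop_foldl (k := .y) (e := id) (p := Option.isSome)
      (P := ((onTop .t fun
        | some (.inl (some true)) => copyTop .y .acc
        | _ => push .acc (bit false)).seq ((copyTop .y .u).seq (pop .y)) : Prog))
      (fun _ => True) 6
      (fun l (g : List Bool × List Bool) => Regs.get { r with
        acc := g.1.map bit, y := l.map bit, t := (a :: T).map bit, u := g.2.map bit })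
      (fun g b => ((a && b) :: g.1, b :: g.2))
      (fun g => rfl) (fun s l g => rfl)
      (fun s l g _ => by
        cases a
        · exact (Runs.seq (Runs.onTop (some (bit false)) rfl .push)
            (Runs.seq (runs_copyTop rfl) .pop)).congr rfl (by norm_num)
            (by funext k; cases k <;> rfl)
        · exact (Runs.seq (Runs.onTop (some (bit true)) rfl (runs_copyTop rfl))
            (Runs.seq (runs_copyTop rfl) .pop)).congr rfl (by norm_num)
            (by funext k; cases k <;> rfl))
      Y.reverse (fun _ _ => trivial) (acc, [])
    have hf : ∀ (Y : List Bool) (g : List Bool × List Bool),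
        Y.reverse.foldl (fun g b => ((a && b) :: g.1, b :: g.2)) g =
          (Y.map (a && ·) ++ g.1, Y ++ g.2) := by
      intro Y g
      induction Y with
      | nil => rfl
      | cons c l ih => rw [List.reverse_cons, List.foldl_append, ih]; rfl
    rw [hf] at h
    refine h.congr ?_ (by simp) ?_
    · funext k; cases k <;> first | rfl | simp [Regs.get]
    · funext k; cases k <;> first | rfl | simp [Regs.get]
  have hout := Runs.loop_foldl (k := .t) (e := id) (p := Option.isSome)
    (P := ((whileNonempty .y ((onTop .t fun
      | some (.inl (some true)) => copyTop .y .acc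
      | _ => push .acc (bit false)).seq ((copyTop .y .u).seq (pop .y)))).seq
      ((move .u .y).seq (pop .t)) : Prog)) (fun _ => True) (Y.length * 11 + 3)
    (fun l (g : List Bool) => Regs.get { r with
        acc := g.map bit, y := (Y.map bit).reverse, t := l.map bit, u := [] })
    (fun g a => Y.map (a && ·) ++ g)
    (fun g => rfl) (fun s l g => rfl)
    (fun s l g _ => (Runs.seq (hin s l g) (Runs.seq (runs_move (by decide)) .pop)).congr rfl
      (by simp [Regs.get]; omega)
      (by funext k; cases k <;> first | rfl | simp [Regs.get]))
    A.reverse (fun _ _ => trivial) []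
  have hf : ∀ (A g : List Bool), A.reverse.foldl (fun g a => Y.map (a && ·) ++ g) g =
      (A.flatMap fun a => Y.map (a && ·)) ++ g := by
    intro A g
    induction A with
    | nil => rfl
    | cons c l ih => rw [List.reverse_cons, List.foldl_append, ih]; simp
  rw [hf] at hout
  refine (Runs.seq (runs_move (by decide)) (Runs.seq (hout.congr ?_ le_rfl rfl)
    runs_clear)).congr rfl ?_ ?_
  · funext k; cases k <;> first | rfl | simp [Regs.get]
  · simp [Regs.get]
    ring_nf
    omega
  · funext k; cases k <;> first | rfl | simp [Regs.get]

/-- The tensor product of the vectors `maskBy X v`, for `v` in `V`. -/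
def tensor (X : List Bool) (V : List (List Bool)) : List Bool :=
  V.foldl (fun A v => A.flatMap fun a => (maskBy X v).map (a && ·)) [true]

theorem tensor_append_singleton (X : List Bool) (V : List (List Bool)) (v : List Bool) :
    tensor X (V ++ [v]) = (tensor X V).flatMap fun a => (maskBy X v).map (a && ·) := by
  simp [tensor]

theorem length_tensor (X : List Bool) (V : List (List Bool)) :
    (tensor X V).length = X.length ^ V.length := by
  induction V using List.reverseRecOn with
  | nil => rfl
  | append_singleton V v ih =>
    rw [tensor_append_singleton, List.length_flatMap]
    simp [length_maskBy, ih, pow_succ]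

/-- The matrix rows on `mat` are read from right to left. -/
def loadRow : Prog := (pop .mat).seq (loop .mat id isBit ((copyTop .mat .x).seq (pop .mat)))

/-- The rows on `mat`, each from right to left, with the end mark first. -/
def encRows (L : List (List Bool)) : List Sym := L.flatMap fun X => sep :: (X.map bit).reverse

theorem runs_loadRow (r : Regs) (X : List Bool) (L : List (List Bool)) :
    loadRow.Runs (Regs.get { r with mat := encRows (X :: L), x := [] }) (X.length * 4 + 2)
      (Regs.get { r with mat := encRows L, x := X.map bit }) := by
  have hdone : isBit (encRows L).head? = false := by cases L <;> rfl
  have h := Runs.loop_foldl (k := .mat) (e := id) (p := isBit)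
    (P := ((copyTop .mat .x).seq (pop .mat) : Prog)) (fun _ => True) 3
    (fun l (g : List Bool) => Regs.get { r with
      mat := l.map bit ++ encRows L, x := g.map bit }) (fun g b => b :: g)
    (fun g => by simpa [Regs.get] using hdone) (fun s l g => rfl)
    (fun s l g _ => (Runs.seq (runs_copyTop rfl) .pop).congr rfl le_rfl
      (by funext k; cases k <;> rfl)) X.reverse (fun _ _ => trivial) []
  refine (Runs.seq .pop (h.congr ?_ le_rfl rfl)).congr rfl ?_ ?_
  · funext k; cases k <;> first | rfl | simp [Regs.get, encRows]
  · simp; omega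
  · funext k; cases k <;> first | rfl | simp [Regs.get]

/-- Write one row of the output. -/
def putRow (l : ℕ) : Prog :=
  loadRow.seq ((push .acc (bit true)).seq ((seqRange (fun _ => applyMask.seq applyTensor) l).seq
    ((move .acc .out).seq ((push .out sep).seq (clear .x)))))

theorem runs_putRow {l n m : ℕ} (r : Regs) (h₁ : r.y = []) (h₂ : r.t = []) (h₃ : r.u = [])
    (h₄ : r.acc = []) (h₅ : r.x = []) {X : List Bool} {V : List (List Bool)} (hX : X.length = n)
    (hV : V.length = l) (hVm : ∀ v ∈ V, v.length ≤ m) (L : List (List Bool)) (I : List Sym) :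
    (putRow l).Runs (Regs.get { r with mat := encRows (X :: L), ins := encInstr V ++ I })
      (6 * n + l * (n * 14 + m * 2 + 7 + (n + 1) ^ l * (n * 11 + 8)) + (n + 1) ^ l * 4 + 7)
      (Regs.get { r with
        mat := encRows L, ins := I, out := sep :: ((tensor X V).map bit).reverse ++ r.out }) := by
  let c := n * 14 + m * 2 + 7 + (n + 1) ^ l * (n * 11 + 8)
  have hseq := Runs.seqRange (P := fun _ => (applyMask.seq applyTensor : Prog)) (n := l) (c := c)
    (st := fun j => Regs.get { r with
      mat := encRows L, ins := encInstr (V.drop j) ++ I, x := X.map bit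
      acc := (tensor X (V.take j)).map bit })
    (fun j hj => by
      have hjV : j < V.length := hV ▸ hj
      have hd : encInstr (V.drop j) =
          V[j].map bit ++ sep :: encInstr (V.drop (j + 1)) := by
        rw [List.drop_eq_getElem_cons hjV, encInstr, List.flatMap_cons, List.append_assoc]
        rfl
      refine (Runs.seq ((runs_applyMask { r with
          mat := encRows L, acc := (tensor X (V.take j)).map bit } X V[j]
          (encInstr (V.drop (j + 1)) ++ I)).congr ?_ le_rfl rfl)
        ((runs_applyTensor { r with
          mat := encRows L, ins := encInstr (V.drop (j + 1)) ++ I, x := X.map bit }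
          (tensor X (V.take j)) (maskBy X V[j])).congr ?_ le_rfl rfl)).congr rfl ?_ ?_
      · funext k
        cases k <;> first | rfl | simp [Regs.get, h₁, h₂, hd]
      · funext k
        cases k <;> first | rfl | simp [Regs.get, h₃]
      · have hv := hVm V[j] (List.getElem_mem hjV)
        -- The intermediate product has `n ^ j` entries. The base `n + 1` is positive, so the power
        -- is monotone in the exponent also for `n = 0`.
        have hle : n ^ j ≤ (n + 1) ^ l :=
          (Nat.pow_le_pow_left n.le_succ j).trans (Nat.pow_le_pow_right n.succ_pos hj.le)
        have hmul := Nat.mul_le_mul_right (n * 11 + 8) hle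
        rw [length_tensor, length_maskBy, hX, List.length_take, min_eq_left hjV.le]
        simp only [c]
        omega
      · rw [← tensor_append_singleton, List.take_append_getElem]
        funext k
        cases k <;> first | rfl | simp [Regs.get, h₁, h₂, h₃])
  refine (Runs.seq ((runs_loadRow { r with ins := encInstr V ++ I } X L).congr ?_ le_rfl rfl)
    (Runs.seq .push (Runs.seq (hseq.congr ?_ le_rfl rfl)
    (Runs.seq (runs_move (by decide)) (Runs.seq .push runs_clear))))).congr rfl ?_ ?_
  · funext k
    cases k <;> first | rfl | simp [Regs.get, h₅]
  · funext k
    cases k <;> first | rfl | simp [Regs.get, h₄, tensor]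
  · have hle : n ^ l ≤ (n + 1) ^ l := Nat.pow_le_pow_left n.le_succ l
    simp [Regs.get, Function.update, length_tensor, hX, hV]
    change _ ≤ 6 * n + l * c + (n + 1) ^ l * 4 + 7
    omega
  · funext k
    cases k <;> first | rfl | simp [Regs.get, h₄, h₅, ← hV, encInstr]

/-- Write all rows of the output. -/
def putRows (l : ℕ) : Prog := whileNonempty .mat (putRow l)

/-- The output, from right to left. -/
def encOutput (L : List (List Bool × List (List Bool))) : List Sym :=
  (L.flatMap fun p => (tensor p.1 p.2).map bit ++ [sep]).reverse

theorem runs_putRows {l n m : ℕ} (r : Regs) (h₁ : r.y = []) (h₂ : r.t = []) (h₃ : r.u = [])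
    (h₄ : r.acc = []) (h₅ : r.x = []) (h₆ : r.out = [])
    (L : List (List Bool × List (List Bool)))
    (hL : ∀ p ∈ L, p.1.length = n ∧ p.2.length = l ∧ ∀ v ∈ p.2, v.length ≤ m) (I : List Sym) :
    (putRows l).Runs
      (Regs.get { r with
        mat := encRows (L.map Prod.fst), ins := (L.map Prod.snd).flatMap encInstr ++ I })
      (L.length * (6 * n + l * (n * 14 + m * 2 + 7 + (n + 1) ^ l * (n * 11 + 8)) +
        (n + 1) ^ l * 4 + 8) + 1)
      (Regs.get { r with mat := [], ins := I, out := encOutput L }) := by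
  have h := Runs.loop_foldl (k := .mat) (e := id) (p := Option.isSome) (P := putRow l)
    (fun p : List Bool × List (List Bool) =>
      p.1.length = n ∧ p.2.length = l ∧ ∀ v ∈ p.2, v.length ≤ m)
    (6 * n + l * (n * 14 + m * 2 + 7 + (n + 1) ^ l * (n * 11 + 8)) + (n + 1) ^ l * 4 + 7)
    (fun L g => Regs.get { r with
      mat := encRows (L.map Prod.fst), ins := (L.map Prod.snd).flatMap encInstr ++ I, out := g })
    (fun g p => sep :: ((tensor p.1 p.2).map bit).reverse ++ g)
    (fun g => rfl) (fun s l g => rfl)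
    (fun p L g hp => (runs_putRow { r with out := g } h₁ h₂ h₃ h₄ h₅ hp.1 hp.2.1 hp.2.2
      (L.map Prod.fst) ((L.map Prod.snd).flatMap encInstr ++ I)).congr
      (by funext k; cases k <;> first | rfl | simp [Regs.get]) le_rfl rfl) L hL []
  have hf : ∀ (L : List (List Bool × List (List Bool))) g,
      L.foldl (fun g p => sep :: ((tensor p.1 p.2).map bit).reverse ++ g) g =
        encOutput L ++ g := by
    intro L
    induction L with
    | nil => intro g; rfl
    | cons p L ih => intro g; rw [List.foldl_cons, ih]; simp [encOutput]
  rw [hf] at h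
  refine h.congr ?_ le_rfl ?_
  · funext k; cases k <;> first | rfl | simp [Regs.get, h₆]
  · funext k; cases k <;> first | rfl | simp [Regs.get]

end StackProgram

namespace StackProgram

open Turing TM2 Routine

/-! #### The whole core program -/

/-- The rows of the output matrix, in order: each is a vector together with the masks for the
tensor factors. -/
def rowData (l q : ℕ) (rows : List (List Bool)) : List (List Bool × List (List Bool)) :=
  (idInstrs l rows.length rows.length).reverse.map (List.replicate rows.length true, ·) ++
    rows.reverse.zip
      (List.replicate rows.length (colorInstrs l rows.length q)).flatten.reverse

/-- From the adjacency matrix, compute the matrix of the concept class (on the stack `out`, from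
right to left), and the number of binary digits of the number of digits of the number of vertices in
base `R`, plus `s` (in unary, on the stack `ss`). -/
def reduction (R l s : ℕ) : Prog :=
  readInput.seq ((logarithm R .one .qs).seq ((logarithm 2 .qs .ss).seq ((putColors l).seq
    ((putIds l).seq ((putRows l).seq ((clear .ins).seq ((clear .one).seq ((clear .qs).seq
      (pushN .ss (bit true) s)))))))))

theorem length_instr {l j : ℕ} (hj : j < l) (v : List Bool) : (instr l j v).length = l := by
  simp [instr]; omega

theorem forall_mem_instr {l j m : ℕ} {v : List Bool} (hv : v.length ≤ m) :
    ∀ u ∈ instr l j v, u.length ≤ m := by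
  intro u hu
  simp only [instr, List.mem_append, List.mem_replicate, List.mem_cons] at hu
  rcases hu with ⟨_, rfl⟩ | rfl | ⟨_, rfl⟩ <;> simp [hv]

theorem length_encInstr {l m : ℕ} {V : List (List Bool)} (hV : V.length = l)
    (h : ∀ v ∈ V, v.length ≤ m) : (encInstr V).length ≤ l * (m + 1) := by
  subst hV
  rw [encInstr, List.length_flatMap]
  refine (List.sum_le_card_nsmul _ (m + 1) ?_).trans (by simp)
  intro x hx
  obtain ⟨v, hv, rfl⟩ := List.mem_map.1 hx
  simpa using h v hv

theorem length_flatMap_encInstr {l m : ℕ} {L : List (List (List Bool))}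
    (hL : ∀ V ∈ L, V.length = l ∧ ∀ v ∈ V, v.length ≤ m) :
    (L.flatMap encInstr).length ≤ L.length * (l * (m + 1)) := by
  rw [List.length_flatMap]
  refine (List.sum_le_card_nsmul _ (l * (m + 1)) ?_).trans (by simp)
  intro x hx
  obtain ⟨V, hV, rfl⟩ := List.mem_map.1 hx
  exact length_encInstr (hL V hV).1 (hL V hV).2

theorem mem_colorInstrs {l n q : ℕ} {V : List (List Bool)} (hV : V ∈ colorInstrs l n q) :
    V.length = l ∧ ∀ v ∈ V, v.length ≤ 2 * n + 1 := by
  simp only [colorInstrs, maskInstrs, List.mem_flatMap, List.mem_map, List.mem_range] at hV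
  obtain ⟨j, hj, i, -, rfl⟩ := hV
  exact ⟨length_instr hj _, forall_mem_instr (by simp [mask]; omega)⟩

theorem mem_idInstrs {l n : ℕ} {V : List (List Bool)} (hV : V ∈ idInstrs l n n) :
    V.length = l ∧ ∀ v ∈ V, v.length ≤ 2 * n + 1 := by
  simp only [idInstrs, List.mem_flatMap, List.mem_map, List.mem_range] at hV
  obtain ⟨w, hw, j, hj, rfl⟩ := hV
  exact ⟨length_instr hj _, forall_mem_instr (by simp [unitVec]; omega)⟩

theorem length_idInstrs (l n m : ℕ) : (idInstrs l n m).length = m * l := by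
  simp [idInstrs, List.length_flatMap]

theorem length_colorInstrs (l n q : ℕ) : (colorInstrs l n q).length = l * q := by
  simp [colorInstrs, maskInstrs, List.length_flatMap]

theorem onesRows_eq (n m : ℕ) :
    onesRows n m = encRows (List.replicate m (List.replicate n true)) := by
  induction m with
  | zero => rfl
  | succ m ih =>
    rw [List.replicate_succ, encRows, List.flatMap_cons]
    change sep :: unary n ++ onesRows n m = _
    rw [ih]
    simp [encRows]

theorem encRows_reverse (rows : List (List Bool)) :
    encRows rows.reverse =
      ((rows.flatMap fun X => X.map some ++ [none]).map Sum.inl).reverse := by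
  induction rows with
  | nil => rfl
  | cons X rows ih =>
    rw [List.reverse_cons, encRows, List.flatMap_append]
    change encRows _ ++ _ = _
    rw [ih]
    simp

theorem count_none_rows (rows : List (List Bool)) :
    (rows.flatMap fun X => X.map some ++ [none]).count none = rows.length := by
  induction rows with
  | nil => rfl
  | cons X rows ih =>
    rw [List.flatMap_cons, List.count_append, ih, List.count_append,
      List.count_eq_zero_of_not_mem (by simp)]
    simp [add_comm]

/-- The running time of `reduction`. -/
def reductionTime (R l s n c : ℕ) : ℕ :=
  let q := numDigits R n
  c * 5 + 1 + (n * 10 + n * (R + n * (R + 7) + 4) + 3) +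
    (q * 10 + q * (2 + q * (2 + 7) + 4) + 3) +
    (10 * n + n * (l * (12 * n + 10 * q + q * (15 * n + l + 8) + 6) + 3) + 3) +
    (n * (l * (30 * n + l + 19) + 4) + 27 * n + 12) +
    ((n * l + n) * (6 * n + l * (n * 14 + (2 * n + 1) * 2 + 7 + (n + 1) ^ l * (n * 11 + 8)) +
        (n + 1) ^ l * 4 + 8) + 1) +
    (n * (l * q) * (l * (2 * n + 2)) * 2 + 1) + (n * 2 + 1) + (q * 2 + 1) + (s + 1)

/-- Stacks reverse the order: the instructions for the points `(w, j)`, written last, are used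
first, together with the all-ones rows above the matrix; then the reversed matrix meets the reversed
colour instructions. -/
theorem runs_reduction {R l s n : ℕ} (hR : 1 < R) (hl : 0 < l) (rows : List (List Bool))
    (hn : rows.length = n) (hrows : ∀ X ∈ rows, X.length = n) (B : List Bool) :
    (reduction R l s).Runs
      (Regs.get { inp := (rows.flatMap fun X => X.map some ++ [none]).map .inl ++ B.map .inr })
      (reductionTime R l s n ((rows.flatMap fun X => X.map some ++ [none]).length + B.length))
      (Regs.get {
        out := encOutput (rowData l (numDigits R n) rows)
        ss := unary (numDigits 2 (numDigits R n) + s) }) := by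
  set q := numDigits R n with hq
  set C := colorInstrs l n q with hC
  set F := (List.replicate n C).flatten with hF
  have hFlen : F.length = n * (l * q) := by simp [hF, hC, length_colorInstrs]
  -- There are enough colour instructions, as `l * q` is positive whenever there is a vertex.
  have hnF : n ≤ F.length := by
    rw [hFlen]
    rcases Nat.eq_zero_or_pos n with h | h
    · omega
    · have : 0 < q := by
        rw [hq, numDigits, Nat.digits_def' hR h]
        simp
      exact Nat.le_mul_of_pos_right n (by positivity)
  have hFmem : ∀ V ∈ F, V.length = l ∧ ∀ v ∈ V, v.length ≤ 2 * n + 1 := by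
    intro V hV
    obtain ⟨C', hC', hV⟩ := List.mem_flatten.1 hV
    rw [List.eq_of_mem_replicate hC'] at hV
    exact mem_colorInstrs hV
  have hfst : (rowData l q rows).map Prod.fst =
      List.replicate (n * l) (List.replicate n true) ++ rows.reverse := by
    rw [rowData, hn, List.map_append, List.map_fst_zip (by simpa [hn, hF] using hnF)]
    congr 1
    rw [List.map_map]
    refine List.eq_replicate_iff.2 ⟨by simp [length_idInstrs], ?_⟩
    intro b hb
    obtain ⟨_, _, rfl⟩ := List.mem_map.1 hb
    rfl
  have hsnd : (rowData l q rows).map Prod.snd =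
      (idInstrs l n n).reverse ++ F.reverse.take n := by
    rw [rowData, hn, List.map_append, List.map_map]
    congr 1
    · exact List.map_id _
    · change (rows.reverse.zip F.reverse).map Prod.snd = _
      rw [List.zip_eq_zip_take_min, List.length_reverse, List.length_reverse, hn,
        min_eq_left hnF, List.map_snd_zip (by simp [hn, hnF])]
  have hmat : onesRows n (n * l) ++
      ((rows.flatMap fun X => X.map some ++ [none]).map Sum.inl).reverse =
      encRows ((rowData l q rows).map Prod.fst) := by
    rw [hfst, onesRows_eq, ← encRows_reverse, encRows, encRows, encRows, List.flatMap_append]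
  -- The instructions are split into those that are consumed and the surplus.
  have hins : encInstrs (idInstrs l n n) ++ encInstrs F =
      ((rowData l q rows).map Prod.snd).flatMap encInstr ++
        (F.reverse.drop n).flatMap encInstr := by
    rw [hsnd, List.flatMap_append, List.append_assoc, ← List.flatMap_append,
      List.take_append_drop, encInstrs, encInstrs]
  have hlen : (rowData l q rows).length = n * l + n := by
    rw [← List.length_map (f := Prod.fst), hfst]
    simp [hn]
  have hL : ∀ p ∈ rowData l q rows,
      p.1.length = n ∧ p.2.length = l ∧ ∀ v ∈ p.2, v.length ≤ 2 * n + 1 := by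
    intro p hp
    constructor
    · have := List.mem_map_of_mem (f := Prod.fst) hp
      rw [hfst, List.mem_append] at this
      rcases this with h | h
      · rw [List.eq_of_mem_replicate h, List.length_replicate]
      · exact hrows _ (List.mem_reverse.1 h)
    · have := List.mem_map_of_mem (f := Prod.snd) hp
      rw [hsnd, List.mem_append] at this
      rcases this with h | h
      · exact mem_idInstrs (List.mem_reverse.1 h)
      · exact hFmem _ (List.mem_reverse.1 (List.mem_of_mem_take h))
  have hleft : ((F.reverse.drop n).flatMap encInstr).length ≤
      n * (l * q) * (l * (2 * n + 2)) := by
    refine (length_flatMap_encInstr fun V hV =>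
      hFmem _ (List.mem_reverse.1 (List.mem_of_mem_drop hV))).trans ?_
    refine Nat.mul_le_mul_right _ ?_
    simp [hFlen]
  have e₁ := runs_readInput (rows.flatMap fun X => X.map some ++ [none]) B
  rw [count_none_rows, hn] at e₁
  have e₂ := runs_logarithm (S := Regs.get {
      mat := ((rows.flatMap fun X => X.map some ++ [none]).map Sum.inl).reverse,
      one := unary n }) (R := R) (n := n) (a := .one) (b := .qs) hR (by decide) (by decide)
    (by decide) (by decide) (by decide) rfl rfl rfl rfl rfl
  have e₃ := runs_logarithm (S := Regs.get {
      mat := ((rows.flatMap fun X => X.map some ++ [none]).map Sum.inl).reverse,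
      one := unary n, qs := unary q }) (R := 2) (n := q) (a := .qs) (b := .ss) (by norm_num)
    (by decide) (by decide) (by decide) (by decide) (by decide) rfl rfl rfl rfl rfl
  have e₄ := runs_putColors (l := l) (n := n) (q := q) {
      mat := ((rows.flatMap fun X => X.map some ++ [none]).map Sum.inl).reverse,
      one := unary n, qs := unary q, ss := unary (numDigits 2 q) } rfl rfl rfl rfl rfl rfl rfl rfl
    rfl
  have e₅ := runs_putIds (l := l) (n := n) {
      mat := ((rows.flatMap fun X => X.map some ++ [none]).map Sum.inl).reverse,
      one := unary n, qs := unary q, ss := unary (numDigits 2 q), ins := encInstrs F }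
      rfl rfl rfl rfl rfl
  have e₆ := runs_putRows (l := l) (n := n) (m := 2 * n + 1) {
      one := unary n, qs := unary q, ss := unary (numDigits 2 q) }
      rfl rfl rfl rfl rfl rfl _ hL ((F.reverse.drop n).flatMap encInstr)
  rw [← hmat, ← hins, hlen] at e₆
  refine (e₁.seq ((e₂.congr rfl le_rfl ?_).seq ((e₃.congr rfl le_rfl ?_).seq
    ((e₄.congr rfl le_rfl ?_).seq (e₅.seq (e₆.seq (.seq
    (runs_clear.mono (t' := n * (l * q) * (l * (2 * n + 2)) * 2 + 1) ?_) (.seq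
    (runs_clear.mono (t' := n * 2 + 1) ?_) (.seq (runs_clear.mono (t' := q * 2 + 1) ?_)
    runs_pushN))))))))).congr rfl ?_ ?_
  · funext k; cases k <;> rfl
  · funext k; cases k <;> rfl
  · funext k; cases k <;> first | rfl | simp [Regs.get]; rfl
  · exact Nat.succ_le_succ (Nat.mul_le_mul_right 2 hleft)
  · simp [Regs.get]
  · simp [Regs.get]
  · simp only [reductionTime, ← hq]
    omega
  · funext k
    cases k <;> first | rfl | simp [Regs.get, unary, add_comm]

end StackProgram

/-! ### Polynomial bound on the time of the reduction. -/

namespace StackProgram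

open Turing TM2 Routine

theorem numDigits_le {R : ℕ} (hR : 1 < R) (n : ℕ) : numDigits R n ≤ n := by
  induction n using Nat.strong_induction_on with
  | _ n ih =>
    rcases Nat.eq_zero_or_pos n with rfl | hn
    · simp [numDigits]
    · have h := Nat.div_lt_self hn hR
      have := ih _ h
      rw [numDigits, Nat.digits_def' hR hn, List.length_cons]
      exact (Nat.succ_le_succ this).trans h

/-- `R`, `l` and `s` are constants, so `(n + 1) ^ l` is a polynomial; the number of digits is at
most `n`. -/
theorem polyBdd_reductionTime {α : Type*} {sz n c : α → ℕ} {R : ℕ} (hR : 1 < R) (l s : ℕ)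
    (hn : PolyBdd sz n) (hc : PolyBdd sz c) :
    PolyBdd sz fun a => reductionTime R l s (n a) (c a) := by
  have hq : PolyBdd sz fun a => numDigits R (n a) := hn.mono fun a => numDigits_le hR _
  unfold reductionTime
  dsimp only
  repeat first
    | exact PolyBdd.const _
    | exact hn
    | exact hc
    | exact hq
    | apply PolyBdd.add
    | apply PolyBdd.mul
    | apply PolyBdd.pow

end StackProgram

/-! ### The concept class of a graph -/

namespace CliqueReduction

open StackProgram

/-- The lists of length `l` of numbers below `n`. -/
def tuples (n : ℕ) : ℕ → List (List ℕ)
  | 0 => [[]]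
  | l + 1 => (tuples n l).flatMap fun t => (List.range n).map fun w => t ++ [w]

theorem mem_tuples {n l : ℕ} {t : List ℕ} :
    t ∈ tuples n l ↔ t.length = l ∧ ∀ x ∈ t, x < n := by
  induction l generalizing t with
  | zero => simp +contextual [tuples]
  | succ l ih =>
    simp only [tuples, List.mem_flatMap, List.mem_map, List.mem_range, ih]
    constructor
    · rintro ⟨t, ⟨rfl, ht⟩, w, hw, rfl⟩
      refine ⟨by simp, fun x hx => ?_⟩
      rcases List.mem_append.1 hx with h | h
      · exact ht x h
      · rw [List.mem_singleton.1 h]; exact hw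
    · rintro ⟨hl, ht⟩
      obtain ⟨t, w, rfl⟩ := List.eq_nil_or_concat'.{0} t |>.resolve_left (by rintro rfl; simp at hl)
      exact ⟨t, ⟨by simpa using hl, fun x hx => ht x (by simp [hx])⟩, w, ht w (by simp), rfl⟩

theorem nodup_tuples (n l : ℕ) : (tuples n l).Nodup := by
  induction l with
  | zero => simp [tuples]
  | succ l ih =>
    rw [tuples, List.nodup_flatMap]
    refine ⟨fun t _ => List.nodup_range.map fun w w' h => by simpa using h, ?_⟩
    refine ih.imp fun {t t'} hne => ?_
    simp only [Function.onFun, List.disjoint_left, List.mem_map, not_exists, not_and]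
    rintro _ ⟨w, _, rfl⟩ w' _ h
    exact hne (List.append_inj_left' h rfl).symm

/-- The entry of a row of the matrix at a tuple. -/
def entry (X : List Bool) (V : List (List Bool)) (t : List ℕ) : Bool :=
  (V.zip t).all fun p => X.getD p.2 false && p.1.getD p.2 true

theorem maskBy_eq (X v : List Bool) :
    maskBy X v = (List.range X.length).map fun w => X.getD w false && v.getD w true := by
  induction X generalizing v with
  | nil => rfl
  | cons b X ih =>
    rw [maskBy, ih, List.length_cons, List.range_succ_eq_map, List.map_cons, List.map_map]
    cases v <;> simp

/-- Both sides are built by appending the last coordinate, which varies fastest, so even the orders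
agree. -/
theorem tensor_eq (X : List Bool) (V : List (List Bool)) :
    tensor X V = (tuples X.length V.length).map (entry X V) := by
  induction V using List.reverseRecOn with
  | nil => rfl
  | append_singleton V v ih =>
    rw [tensor_append_singleton, ih, List.length_append, List.length_singleton, tuples,
      List.map_flatMap, List.flatMap_map]
    refine List.flatMap_congr fun t ht => ?_
    rw [maskBy_eq, List.map_map, List.map_map]
    refine List.map_congr_left fun w _ => ?_
    simp [entry, List.zip_append (mem_tuples.1 ht).1.symm]

/-- Every factor contributes the entry of `X` at its coordinate; only factor `j` has a nontrivial
mask. -/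
theorem entry_instr {l j : ℕ} (hj : j < l) (X v : List Bool) {t : List ℕ} (ht : t.length = l) :
    entry X (instr l j v) t = (t.all (X.getD · false) && v.getD (t.getD j 0) true) := by
  have hrep (k : ℕ) (t : List ℕ) (hk : t.length = k) :
      ((List.replicate k []).zip t).all (fun p => X.getD p.2 false && p.1.getD p.2 true) =
        t.all (X.getD · false) := by
    induction t generalizing k with
    | nil => simp
    | cons w t ih =>
      subst hk
      rw [List.length_cons, List.replicate_succ, List.zip_cons_cons, List.all_cons, ih _ rfl]
      simp
  have hjt : j < t.length := ht ▸ hj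
  have hsplit : t = t.take j ++ t[j] :: t.drop (j + 1) := by simp
  rw [List.getD_eq_getElem _ _ hjt]
  generalize hw : t[j] = w at *
  conv_lhs => rw [hsplit]
  conv_rhs => rw [hsplit]
  rw [entry, instr, List.zip_append (by simp [hjt.le]), List.zip_cons_cons, List.all_append,
    List.all_cons, hrep _ _ (by simp [hjt.le]), hrep _ _ (by simp; omega), List.all_append,
    List.all_cons]
  cases (t.take j).all (X.getD · false) <;> cases X.getD w false <;>
    cases (t.drop (j + 1)).all (X.getD · false) <;> simp

/-- The rows of the matrix: those that tell the columns from each other, and one for each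
vertex. -/
abbrev Row := (ℕ × ℕ) ⊕ ℕ

/-- The colour of a vertex. -/
def colour (l q n u : ℕ) : ℕ := (n * (l * q - 1) + u) % (l * q)

/-- The data from which a row is computed. -/
def rowPair (l q : ℕ) (A : List (List Bool)) : Row → List Bool × List (List Bool)
  | .inl p => (List.replicate A.length true, instr l p.2 (unitVec A.length p.1))
  | .inr u => (A.getD u [], instr l (colour l q A.length u / q)
      (mask A.length (colour l q A.length u % q)))

/-- The list of all rows. -/
def rowList (l n : ℕ) : List Row :=
  ((List.range n).flatMap fun w => (List.range l).map fun j => Sum.inl (w, j)).reverse ++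
    ((List.range n).map Sum.inr).reverse

theorem mem_rowList {l n : ℕ} {ρ : Row} :
    ρ ∈ rowList l n ↔ (∃ w < n, ∃ j < l, ρ = .inl (w, j)) ∨ ∃ u < n, ρ = .inr u := by
  simp [rowList, eq_comm]

theorem nodup_rowList (l n : ℕ) : (rowList l n).Nodup := by
  rw [rowList, List.nodup_append]
  refine ⟨List.nodup_reverse.2 (List.nodup_flatMap.2 ⟨fun w _ => List.nodup_range.map
    fun j j' h => by simpa using h, List.nodup_range.imp fun {w w'} hne => ?_⟩),
    List.nodup_reverse.2 (List.nodup_range.map Sum.inr_injective), ?_⟩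
  · simp only [Function.onFun, List.disjoint_left, List.mem_map, not_exists, not_and]
    rintro _ ⟨j, _, rfl⟩ j' _ h
    simp at h
    exact hne h.1.symm
  · intro a ha b hb
    simp at ha hb
    obtain ⟨w, _, j, _, rfl⟩ := ha
    obtain ⟨u, _, rfl⟩ := hb
    simp

/-- The colour number `c` stands for the coordinate `c / q` and the bit `c % q`. -/
theorem colorInstrs_eq {l n q : ℕ} (hq : 0 < q) : colorInstrs l n q =
    (List.range (l * q)).map fun c => instr l (c / q) (mask n (c % q)) := by
  have h (m : ℕ) : (List.range m).flatMap (fun j => maskInstrs l n q j) =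
      (List.range (m * q)).map fun c => instr l (c / q) (mask n (c % q)) := by
    induction m with
    | zero => simp
    | succ m ih =>
      rw [List.range_succ, List.flatMap_append, ih, add_mul, one_mul, List.range_add,
        List.map_append, List.map_map]
      congr 1
      rw [List.flatMap_cons, List.flatMap_nil, List.append_nil, maskInstrs]
      refine List.map_congr_left fun i hi => ?_
      have hi := List.mem_range.1 hi
      simp only [Function.comp]
      rw [mul_comm m q, Nat.mul_add_div hq, Nat.div_eq_of_lt hi, add_zero, Nat.mul_add_mod,
        Nat.mod_eq_of_lt hi]
  exact h l

theorem flatten_replicate_map_range {α : Type*} (m Q : ℕ) (g : ℕ → α) :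
    (List.replicate m ((List.range Q).map g)).flatten =
      (List.range (m * Q)).map fun c => g (c % Q) := by
  induction m with
  | zero => simp
  | succ m ih =>
    rw [List.replicate_succ', List.flatten_append, ih, add_mul, one_mul, List.range_add,
      List.map_append, List.map_map]
    congr 1
    rw [List.flatten_singleton]
    refine List.map_congr_left fun i hi => ?_
    have hi := List.mem_range.1 hi
    simp only [Function.comp]
    rw [Nat.mul_add_mod_self_right, Nat.mod_eq_of_lt hi]

/-- This is where the form of `colour` comes from: reading rows and instructions backwards from
their ends pairs vertex `u` with instruction `n * (l * q - 1) + u` of the periodic list. -/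
theorem rowData_eq {l q : ℕ} (hl : 0 < l) (A : List (List Bool)) (hq : A.length ≠ 0 → 0 < q) :
    rowData l q A = (rowList l A.length).map (rowPair l q A) := by
  rw [rowData, rowList, List.map_append]
  congr 1
  · rw [List.map_reverse, List.map_reverse, idInstrs, List.map_flatMap, List.map_flatMap]
    congr 1
    refine List.flatMap_congr fun w _ => ?_
    rw [List.map_map, List.map_map]
    rfl
  · rcases Nat.eq_zero_or_pos A.length with hA | hA
    · simp [List.length_eq_zero_iff.1 hA]
    · have hq := hq hA.ne'
      have hQ : 0 < l * q := by positivity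
      rw [colorInstrs_eq hq, flatten_replicate_map_range]
      apply List.ext_getElem
      · simp
        exact Nat.le_mul_of_pos_right _ hQ
      · intro i h₁ h₂
        have hi : i < A.length := by simpa using h₂
        have hle : A.length ≤ A.length * (l * q) := Nat.le_mul_of_pos_right _ hQ
        have he : A.length * (l * q) - 1 - i =
            A.length * (l * q - 1) + (A.length - 1 - i) := by
          rw [Nat.mul_sub, mul_one]
          omega
        simp only [List.getElem_zip, List.getElem_reverse, List.getElem_map, List.getElem_range,
          List.length_map, List.length_range, rowPair, colour, he]
        rw [List.getD_eq_getElem]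

open Learning

/-- The entry of the matrix at a row and a tuple. -/
def value (l q : ℕ) (A : List (List Bool)) (ρ : Row) (t : List ℕ) : Bool :=
  entry (rowPair l q A ρ).1 (rowPair l q A ρ).2 t

theorem value_inl {l q : ℕ} {A : List (List Bool)} {w j : ℕ} (hw : w < A.length) (hj : j < l)
    {t : List ℕ} (ht : t ∈ tuples A.length l) :
    value l q A (.inl (w, j)) t = decide (t.getD j 0 = w) := by
  obtain ⟨htl, htn⟩ := mem_tuples.1 ht
  have hjt : j < t.length := htl ▸ hj
  rw [value, rowPair, entry_instr hj _ _ htl]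
  have h : t.all ((List.replicate A.length true).getD · false) = true :=
    List.all_eq_true.2 fun x hx => by simp [List.getD, htn x hx]
  have hx : t.getD j 0 < A.length := by
    rw [List.getD_eq_getElem _ _ hjt]
    exact htn _ (List.getElem_mem _)
  rw [h, Bool.true_and]
  generalize t.getD j 0 = x at hx
  simp only [unitVec]
  rcases lt_trichotomy x w with h | rfl | h
  · rw [List.getD_append _ _ _ _ (by simpa using h)]
    simp [List.getD, h, h.ne]
  · rw [List.getD_append_right _ _ _ _ (by simp)]
    simp
  · rw [List.getD_append_right _ _ _ _ (by simpa using h.le)]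
    obtain ⟨d, rfl⟩ := Nat.exists_eq_add_of_lt h
    have : d < A.length := by omega
    simp [add_assoc, List.getD, this]

theorem value_inr {l q : ℕ} {A : List (List Bool)} (hq : 0 < q) (hl : 0 < l) (u : ℕ)
    {t : List ℕ} (ht : t ∈ tuples A.length l) :
    value l q A (.inr u) t = (t.all ((A.getD u []).getD · false) &&
      (t.getD (colour l q A.length u / q) 0 + 1).testBit (colour l q A.length u % q)) := by
  obtain ⟨htl, htn⟩ := mem_tuples.1 ht
  have hj : colour l q A.length u / q < l := by
    rw [Nat.div_lt_iff_lt_mul hq]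
    exact Nat.mod_lt _ (by positivity)
  have hjt : colour l q A.length u / q < t.length := by rw [htl]; exact hj
  rw [value, rowPair, entry_instr hj _ _ htl]
  congr 1
  have hx : t.getD (colour l q A.length u / q) 0 < A.length := by
    rw [List.getD_eq_getElem _ _ hjt]
    exact htn _ (List.getElem_mem _)
  generalize t.getD (colour l q A.length u / q) 0 = x at hx
  simp [mask, List.getD, hx]

/-- The columns of the matrix. -/
def columns (l n : ℕ) : List (List ℕ) := if n = 0 then [[]] else tuples n l

/-- The concept class constructed from an adjacency matrix. -/
def matrixClass (l q : ℕ) (A : List (List Bool)) : ExplicitClass where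
  m := (rowList l A.length).length
  n := (columns l A.length).length
  entry i j := value l q A ((rowList l A.length).get i) ((columns l A.length).get j)
  n_pos := by
    rw [columns]
    split_ifs with h
    · simp
    · have : List.replicate l 0 ∈ tuples A.length l :=
        mem_tuples.2 ⟨by simp, fun x hx => by rw [List.eq_of_mem_replicate hx]; omega⟩
      exact List.length_pos_of_mem this
  columns_injective := by
    intro j j' h
    have hnd : (columns l A.length).Nodup := by
      rw [columns]
      split_ifs
      · simp
      · exact nodup_tuples _ _
    refine hnd.injective_get ?_
    -- Without vertices there are no rows, and the columns are distinct only because there is just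
    -- one.
    by_cases hA : A.length = 0
    · have hall : ∀ t ∈ columns l A.length, t = [] := by simp [columns, hA]
      rw [hall _ (List.get_mem _ j), hall _ (List.get_mem _ j')]
    · have hall : ∀ t ∈ columns l A.length, t ∈ tuples A.length l := by simp [columns, hA]
      have ht := hall _ (List.get_mem _ j)
      have ht' := hall _ (List.get_mem _ j')
      have hl := (mem_tuples.1 ht).1
      have hl' := (mem_tuples.1 ht').1
      refine List.ext_getElem (hl.trans hl'.symm) fun i h₁ h₂ => ?_
      -- Tuples are compared coordinate by coordinate: the row `(x, i)` is `true` exactly at the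
      -- tuples whose coordinate `i` is `x`.
      set x := ((columns l A.length).get j)[i] with hx
      have hxn : x < A.length := (mem_tuples.1 ht).2 _ (List.getElem_mem _)
      have hil : i < l := hl ▸ h₁
      obtain ⟨ρ, hρ⟩ := List.mem_iff_get.1
        (mem_rowList.2 (.inl ⟨x, hxn, i, hil, rfl⟩) : Sum.inl (x, i) ∈ rowList l A.length)
      have := congrFun h ρ
      simp only [hρ] at this
      rw [value_inl hxn hil ht, value_inl hxn hil ht', List.getD_eq_getElem _ _ h₁,
        List.getD_eq_getElem _ _ h₂, ← hx, decide_eq_decide] at this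
      exact (this.1 rfl).symm

theorem map_finRange_get {α β : Type*} (L : List α) (f : α → β) :
    (List.finRange L.length).map (fun i => f (L.get i)) = L.map f := by
  apply List.ext_getElem <;> simp

theorem encode_matrixClass {l q : ℕ} (hl : 0 < l) (A : List (List Bool))
    (hq : A.length ≠ 0 → 0 < q) (hA : ∀ X ∈ A, X.length = A.length) :
    (matrixClass l q A).encode =
      (rowData l q A).flatMap fun p => (tensor p.1 p.2).map some ++ [none] := by
  have h : (matrixClass l q A).encode = (rowList l A.length).flatMap fun ρ =>
      (columns l A.length).map (fun t => some (value l q A ρ t)) ++ [none] := by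
    rw [ExplicitClass.encode, encodeMatrix, List.flatMap_def, List.flatMap_def]
    congr 1
    have := map_finRange_get (rowList l A.length) fun ρ =>
      (columns l A.length).map (fun t => some (value l q A ρ t)) ++ [none]
    rw [← this]
    refine List.map_congr_left fun i _ => ?_
    congr 1
    exact map_finRange_get (columns l A.length) fun t =>
      some (value l q A ((rowList l A.length).get i) t)
  rw [h, rowData_eq hl A hq, List.flatMap_map]
  refine List.flatMap_congr fun ρ hρ => ?_
  have hn : A.length ≠ 0 := by
    rcases mem_rowList.1 hρ with ⟨w, hw, -⟩ | ⟨u, hu, -⟩ <;> omega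
  have h₁ : (rowPair l q A ρ).1.length = A.length ∧ (rowPair l q A ρ).2.length = l := by
    rcases mem_rowList.1 hρ with ⟨w, hw, j, hj, rfl⟩ | ⟨u, hu, rfl⟩
    · exact ⟨by simp [rowPair], length_instr hj _⟩
    · refine ⟨?_, length_instr ?_ _⟩
      · rw [rowPair, List.getD_eq_getElem _ _ hu]
        exact hA _ (List.getElem_mem _)
      · rw [Nat.div_lt_iff_lt_mul (hq hn)]
        have := hq hn
        exact Nat.mod_lt _ (by positivity)
  rw [tensor_eq, h₁.1, h₁.2, columns, if_neg hn, List.map_map]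
  rfl

end CliqueReduction

namespace StackProgram

open Turing TM2 Routine

/-! ### From routines to machines -/

/-- The machine that runs a routine, and then resets its internal state. -/
def Routine.toFinTM2 {K : Type} [DecidableEq K] [Fintype K] {Γ : K → Type} {σ : Type} [Fintype σ]
    (R : Routine Γ σ) (k₀ k₁ : K) [Fintype (Γ k₀)] (v₀ : σ) : FinTM2 where
  K := K
  k₀ := k₀
  k₁ := k₁
  Γ := Γ
  Λ := Option R.Λ
  main := some R.main
  σ := σ
  initialState := v₀
  m
    | none => .load (fun _ => v₀) .halt
    | some l => relabel some (some none) (R.code l)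

theorem initList_eq (tm : FinTM2) (l : List (tm.Γ tm.k₀)) :
    initList tm l =
      ⟨some tm.main, tm.initialState, Function.update (fun _ => []) tm.k₀ l⟩ := by
  unfold initList
  congr 1
  funext k
  by_cases h : k = tm.k₀
  · subst h; simp
  · simp [h]

theorem haltList_eq (tm : FinTM2) (l : List (tm.Γ tm.k₁)) :
    haltList tm l = ⟨none, tm.initialState, Function.update (fun _ => []) tm.k₁ l⟩ := by
  unfold haltList
  congr 1
  funext k
  by_cases h : k = tm.k₁
  · subst h; simp
  · simp [h]

/-- A machine must halt in its initial internal state, whereas a routine may end in any state; the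
additional step resets it. -/
theorem Routine.Runs.outputsInTime {K : Type} [DecidableEq K] [Fintype K] {Γ : K → Type}
    {σ : Type} [Fintype σ] {R : Routine Γ σ} {k₀ k₁ : K} [Fintype (Γ k₀)] {v₀ : σ}
    {l : List (Γ k₀)} {l' : List (Γ k₁)} {t : ℕ}
    (h : R.Runs (Function.update (fun _ => []) k₀ l) t (Function.update (fun _ => []) k₁ l')) :
    Nonempty (TM2OutputsInTime (R.toFinTM2 k₀ k₁ v₀) l (some l') (t + 1)) := by
  obtain ⟨v', s, hs, h⟩ := h v₀
  have h₁ := h.relabel (M' := (R.toFinTM2 k₀ k₁ v₀).m) (f := some) (e := some none)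
    fun _ => rfl
  have h₂ : StepsTo (R.toFinTM2 k₀ k₁ v₀).m 1
      ⟨some none, v', Function.update (fun _ => []) k₁ l'⟩
      ⟨none, v₀, Function.update (fun _ => []) k₁ l'⟩ := .head (.refl _)
  have h₃ := (h₁.trans h₂).iterate
  refine ⟨⟨⟨s + 1, ?_⟩, Nat.succ_le_succ hs⟩⟩
  exact (congrArg (fun c => (flip bind (R.toFinTM2 k₀ k₁ v₀).step)^[s + 1] (some c))
    (initList_eq (R.toFinTM2 k₀ k₁ v₀) l)).trans
      (h₃.trans (congrArg some (haltList_eq (R.toFinTM2 k₀ k₁ v₀) l').symm))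

/-- A machine as a routine. -/
def machineRoutine (tm : FinTM2) : Routine tm.Γ tm.σ :=
  letI := tm.ΛFin
  { Λ := Option tm.Λ
    main := none
    code
      | none => .load (fun _ => tm.initialState) (.goto fun _ => some tm.main)
      | some l => relabel some none (tm.m l) }

theorem runs_machineRoutine {tm : FinTM2} {l : List (tm.Γ tm.k₀)} {l' : List (tm.Γ tm.k₁)} {t : ℕ}
    (h : TM2OutputsInTime tm l (some l') t) :
    (machineRoutine tm).Runs (Function.update (fun _ => []) tm.k₀ l) (t + 1)
      (Function.update (fun _ => []) tm.k₁ l') := by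
  intro v
  obtain ⟨⟨s, hs⟩, hst⟩ := h
  rw [initList_eq, Option.map_some, haltList_eq] at hs
  have h₁ : StepsTo tm.m s _ _ := .of_iterate hs
  exact ⟨_, s + 1, Nat.succ_le_succ hst, .head (h₁.relabel (f := some) (e := none) fun _ => rfl)⟩

/-! ### The test -/

section Test

variable (tm : FinTM2)

/-- The alphabets of the stacks of the test: the work stacks, the output stack, and those of the
given machine. -/
abbrev TestΓ : Stack ⊕ Option tm.K → Type
  | .inl _ => Sym
  | .inr none => Bool
  | .inr (some k) => tm.Γ k

/-- The internal states of the test. -/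
abbrev TestState := Option Sym × ((Option Sym × Unit) × tm.σ)

/-- The contents of the stacks of the test. -/
def testStacks (r : Regs) (o : List Bool) (T : ∀ k, List (tm.Γ k)) :
    ∀ k, List (TestΓ tm k)
  | .inl k => r.get k
  | .inr none => o
  | .inr (some k) => T k

/-- The stacks of the given machine. -/
abbrev tmStack (k : tm.K) : Stack ⊕ Option tm.K := .inr (some k)

/-- Compute the matrix, let the given machine process it, and compare the length of the result with
the number on `ss`. -/
def testRoutine (f : Sym → tm.Γ tm.k₀) (P : Prog) : Routine (TestΓ tm) (TestState tm) :=
  (P.lift (K' := Stack ⊕ Option tm.K) .inl (TestΓ tm) (fun v => v.2.1)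
    (fun a v => (v.1, a, v.2.2))).seq
  ((loop (A := Sym) (.inl .out) (fun a : Sym => a) Option.isSome
    ((switch (A := Sym) (.inl .out) (fun a : Sym => a) fun o =>
      o.elim skip fun a => push (tmStack tm tm.k₀) (f a)).seq (pop (.inl .out)))).seq
  (((machineRoutine tm).lift (K' := Stack ⊕ Option tm.K) (tmStack tm) (TestΓ tm)
    (fun v => v.2.2) (fun a v => (v.1, v.2.1, a))).seq
  ((loop (A := Sym) (.inl .ss) (fun a : Sym => a) Option.isSome
    ((pop (tmStack tm tm.k₁)).seq (pop (.inl .ss)))).seq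
  ((switch (A := Sym) (tmStack tm tm.k₁) (fun _ => sep) fun o =>
    push (.inr none) (o.isSome : Bool)).seq
  (loop (A := Sym) (tmStack tm tm.k₁) (fun _ => sep) Option.isSome
    (pop (tmStack tm tm.k₁)))))))

variable {tm}

/-- Moving `out` to the input stack of the machine undoes the reversal of the matrix. Afterwards `m`
symbols of its output are dropped, and a symbol remains exactly if the output is longer than `m`. -/
theorem runs_testRoutine {f : Sym → tm.Γ tm.k₀} {P : Prog} {inp : List Sym} {L : List Sym}
    {m t t' : ℕ} {l' : List (tm.Γ tm.k₁)}
    (hP : P.Runs (Regs.get { inp := inp }) t (Regs.get { out := L.reverse, ss := unary m }))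
    (htm : TM2OutputsInTime tm (L.map f) (some l') t') :
    (testRoutine tm f P).Runs (Function.update (fun _ => []) (.inl .inp) inp)
      (t + (L.length * 4 + 1) + (t' + 1) + (m * 3 + 1) + 2 + (l'.length * 2 + 1))
      (Function.update (fun _ => []) (.inr none) [decide (m < l'.length)]) := by
  have e₁ := Routine.Runs.lift (ι := Sum.inl) (Γ := TestΓ tm) (σ' := TestState tm)
    (get := fun v => v.2.1) (set := fun a v => (v.1, a, v.2.2)) Sum.inl_injective
    (fun _ _ => rfl) (R := P) (S := testStacks tm { inp := inp } [] fun _ => [])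
    (S' := testStacks tm { out := L.reverse, ss := unary m } [] fun _ => []) hP
    (by rintro (k | _ | k) hk
        · exact (hk ⟨k, rfl⟩).elim
        · rfl
        · rfl)
  have e₂ := Runs.loop_foldl (Γ := TestΓ tm) (τ := (Option Sym × Unit) × tm.σ)
    (k := .inl .out) (e := fun a : Sym => a) (p := Option.isSome)
    (P := ((switch (A := Sym) (.inl .out) (fun a : Sym => a) fun o =>
      o.elim skip fun a => push (tmStack tm tm.k₀) (f a)).seq (pop (.inl .out))))
    (fun _ => True) 3
    (fun (l : List Sym) (g : List (tm.Γ tm.k₀)) => testStacks tm { out := l, ss := unary m } []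
      (Function.update (fun _ => []) tm.k₀ g)) (fun g a => f a :: g)
    (fun g => rfl) (fun s l g => rfl)
    (fun s l g _ => (Runs.seq (Runs.switch (some s) rfl .push) .pop).congr rfl le_rfl (by
      funext k
      rcases k with k | _ | k
      · cases k <;> rfl
      · rfl
      · by_cases hk : k = tm.k₀
        · subst hk; simp [testStacks]
        · simp [testStacks, hk]))
    L.reverse (fun _ _ => trivial) []
  have hf : ∀ L : List Sym, L.reverse.foldl (fun g a => f a :: g) [] = L.map f := by
    intro L
    induction L with
    | nil => rfl
    | cons a L ih => rw [List.reverse_cons, List.foldl_append, ih]; rfl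
  rw [hf, List.length_reverse] at e₂
  have e₃ := Routine.Runs.lift (ι := tmStack tm) (Γ := TestΓ tm) (σ' := TestState tm)
    (get := fun v => v.2.2) (set := fun a v => (v.1, v.2.1, a))
    (fun a b h => by simpa using h)
    (fun _ _ => rfl) (R := machineRoutine tm)
    (S := testStacks tm { ss := unary m } [] (Function.update (fun _ => []) tm.k₀ (L.map f)))
    (S' := testStacks tm { ss := unary m } [] (Function.update (fun _ => []) tm.k₁ l'))
    (runs_machineRoutine htm)
    (by rintro (k | _ | k) hk
        · rfl
        · rfl
        · exact (hk ⟨k, rfl⟩).elim)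
  have e₄ := Runs.loop_iterate (Γ := TestΓ tm) (τ := (Option Sym × Unit) × tm.σ)
    (k := .inl .ss) (e := fun a : Sym => a) (p := Option.isSome)
    (P := ((pop (tmStack tm tm.k₁)).seq (pop (.inl .ss)))) m 2
    (fun i => testStacks tm { ss := unary (m - i) } []
      (Function.update (fun _ => []) tm.k₁ (l'.drop i)))
    (by simp [testStacks, Regs.get])
    (fun i hi => by
      obtain ⟨j, hj⟩ : ∃ j, m - i = j + 1 := ⟨m - i - 1, by omega⟩
      simp [testStacks, Regs.get, hj, List.replicate_succ])
    (fun i hi => (Runs.seq .pop .pop).congr rfl le_rfl (by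
      funext k
      rcases k with k | _ | k
      · cases k <;> first | rfl | simp [testStacks, Regs.get, unary, List.tail_replicate]; omega
      · rfl
      · by_cases hk : k = tm.k₁
        · subst hk; simp [testStacks]
        · simp [testStacks, hk]))
  have e₅ : (switch (A := Sym) (tmStack tm tm.k₁) (fun _ => sep) fun o =>
      (push (.inr none) (o.isSome : Bool) : Routine (TestΓ tm) (TestState tm))).Runs
      (testStacks tm {} [] (Function.update (fun _ => []) tm.k₁ (l'.drop m))) 2
      (testStacks tm {} [decide (m < l'.length)]
        (Function.update (fun _ => []) tm.k₁ (l'.drop m))) := by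
    refine (Runs.switch _ rfl .push).congr rfl le_rfl ?_
    funext k
    rcases k with k | _ | k
    · rfl
    · have : ((l'.drop m).head?.map fun _ => sep).isSome = decide (m < l'.length) := by
        rw [Option.isSome_map, List.head?_drop]
        by_cases h : m < l'.length
        · simp [h]
        · simp [h]
      simp [testStacks, ← this]
    · rfl
  have e₆ := Runs.loop_foldl (Γ := TestΓ tm) (τ := (Option Sym × Unit) × tm.σ)
    (k := tmStack tm tm.k₁) (e := fun _ => sep) (p := Option.isSome)
    (P := pop (tmStack tm tm.k₁)) (fun _ => True) 1
    (fun l (_ : Unit) => testStacks tm {} [decide (m < l'.length)]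
      (Function.update (fun _ => []) tm.k₁ l)) (fun g _ => g)
    (fun g => by simp [testStacks]) (fun s l g => by simp [testStacks])
    (fun s l g _ => Runs.pop.congr rfl le_rfl (by
      funext k
      rcases k with k | _ | k
      · rfl
      · rfl
      · by_cases hk : k = tm.k₁
        · subst hk; simp [testStacks]
        · simp [testStacks, hk]))
    (l'.drop m) (fun _ _ => trivial) ()
  refine ((e₁.congr ?_ le_rfl rfl).seq ((e₂.congr ?_ le_rfl rfl).seq (e₃.seq
    ((e₄.congr ?_ le_rfl ?_).seq (e₅.seq e₆))))).congr rfl ?_ ?_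
  · funext k
    rcases k with k | _ | k
    · cases k <;> rfl
    · rfl
    · rfl
  · simp
  · simp
  · simp
  · rw [List.length_drop]
    omega
  · funext k
    rcases k with k | _ | k
    · cases k <;> rfl
    · rfl
    · simp [testStacks]

end Test

end StackProgram

/-! ### From an approximation algorithm to a test on graphs. -/

namespace CliqueReduction

open StackProgram StackProgram.Routine Turing Learning PlantedClique

theorem encodePosNum_length (p : PosNum) (k : ℕ) : k < (encodePosNum p).length ↔ 2 ^ k ≤ (p : ℕ) := by
  induction p generalizing k with
  | one =>
    change k < 1 ↔ 2 ^ k ≤ 1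
    cases k with
    | zero => simp
    | succ k =>
      have : 2 ≤ 2 ^ (k + 1) := by rw [pow_succ]; have := Nat.one_le_two_pow (n := k); omega
      omega
  | bit0 p ih =>
    rw [encodePosNum, PosNum.cast_bit0, List.length_cons]
    cases k with
    | zero =>
      have := PosNum.to_nat_pos p
      simp; omega
    | succ k =>
      rw [Nat.add_lt_add_iff_right, ih, pow_succ]; omega
  | bit1 p ih =>
    rw [encodePosNum, PosNum.cast_bit1, List.length_cons]
    cases k with
    | zero => simp
    | succ k =>
      rw [Nat.add_lt_add_iff_right, ih, pow_succ]; omega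

/-- Comparison with a power of two reduces to measuring the length of the binary representation; for
this reason the threshold of the test is a power of two. -/
theorem lt_length_encodeNat (n k : ℕ) : k < (encodeNat n).length ↔ 2 ^ k ≤ n := by
  conv_rhs => rw [← Num.to_of_nat n]
  rw [encodeNat]
  generalize (n : Num) = m
  cases m with
  | zero => simp [encodeNum]
  | pos p => exact encodePosNum_length p k

theorem length_encodeNat_le (n : ℕ) : (encodeNat n).length ≤ n := by
  by_contra! h
  have := (lt_length_encodeNat n n).1 h
  exact absurd n.lt_two_pow_self (by omega)

open Classical in
/-- The adjacency matrix as a list of rows. -/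
noncomputable def adjRows (G : Graph) : List (List Bool) :=
  (List.finRange G.1).map fun u => (List.finRange G.1).map fun v => decide (G.2.Adj u v)

theorem length_adjRows (G : Graph) : (adjRows G).length = G.1 := by simp [adjRows]

theorem length_of_mem_adjRows {G : Graph} {X : List Bool} (hX : X ∈ adjRows G) :
    X.length = G.1 := by
  obtain ⟨u, -, rfl⟩ := List.mem_map.1 hX
  simp

theorem encodeGraph_eq (G : Graph) :
    encodeGraph G = (adjRows G).flatMap fun X => X.map some ++ [none] := by
  simp [encodeGraph, encodeMatrix, adjRows, List.flatMap_map, Function.comp_def]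

/-- The concept class constructed from a graph. -/
noncomputable def graphClass (R l : ℕ) (G : Graph) : ExplicitClass :=
  matrixClass l (numDigits R G.1) (adjRows G)

theorem numDigits_pos {R n : ℕ} (hR : 1 < R) (hn : n ≠ 0) : 0 < numDigits R n := by
  rw [numDigits, Nat.digits_def' hR (Nat.pos_of_ne_zero hn)]
  simp

theorem length_rowList (l n : ℕ) : (rowList l n).length = n * l + n := by
  simp [rowList, List.length_flatMap]

theorem length_tuples (n l : ℕ) : (tuples n l).length = n ^ l := by
  induction l with
  | zero => rfl
  | succ l ih => simp [tuples, List.length_flatMap, ih, pow_succ]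

theorem length_encode (I : ExplicitClass) : I.encode.length = I.m * (I.n + 1) := by
  simp [ExplicitClass.encode, encodeMatrix, List.length_flatMap]

theorem length_encode_graphClass_le (R l : ℕ) (G : Graph) :
    (graphClass R l G).encode.length ≤ (G.1 * l + G.1) * ((G.1 + 1) ^ l + 1) := by
  rw [length_encode]
  refine Nat.mul_le_mul ?_ (Nat.succ_le_succ ?_)
  · change (rowList l (adjRows G).length).length ≤ _
    rw [length_rowList, length_adjRows]
  · change (columns l (adjRows G).length).length ≤ _
    rw [columns, length_adjRows]
    split_ifs with h
    · simp [h]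
    · rw [length_tuples]
      exact Nat.pow_le_pow_left (Nat.le_succ _) _

theorem encOutput_eq {R l : ℕ} (hR : 1 < R) (hl : 0 < l) (G : Graph) :
    encOutput (rowData l (numDigits R G.1) (adjRows G)) =
      ((graphClass R l G).encode.map Sum.inl).reverse := by
  rw [graphClass, encode_matrixClass hl, encOutput]
  · simp [List.map_flatMap, Function.comp_def]
  · rw [length_adjRows]
    exact numDigits_pos hR
  · intro X hX
    rw [length_adjRows, length_of_mem_adjRows hX]

theorem le_length_encodeGraphCoins (x : Graph × List Bool) :
    x.1.1 ≤ (encodeGraphCoins x).length := by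
  rw [encodeGraphCoins, encodeGraph, encodeMatrix]
  simp [List.length_flatMap]
  have : x.1.1 ≤ x.1.1 * (x.1.1 + 1) := Nat.le_mul_of_pos_right x.1.1 (Nat.succ_pos x.1.1)
  omega

theorem polyBdd_eval {α : Type*} {sz f : α → ℕ} (p : Polynomial ℕ) (hf : PolyBdd sz f) :
    PolyBdd sz fun a => p.eval (f a) := by
  obtain ⟨q, hq⟩ := hf
  exact ⟨p.comp q, fun a => (eval_mono p (hq a)).trans (by simp)⟩

/-- A polynomial-time algorithm on concept classes, with values that are not too large, yields a
test on graphs that compares the value on the constructed class with a threshold. -/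
theorem exists_randomizedTest {alg : ExplicitClass → ℕ} (halg : PolyTime alg)
    (hle : ∀ I, alg I ≤ I.m) {R l : ℕ} (hR : 1 < R) (hl : 0 < l) (s : ℕ) :
    ∃ A : RandomizedTest, ∀ x, A.run x =
      decide (2 ^ (numDigits 2 (numDigits R x.1.1) + s) ≤ alg (graphClass R l x.1)) := by
  obtain ⟨M⟩ := halg
  let _ := M.tm.kFin
  let _ := M.tm.σFin
  -- Coin symbols do not occur in the computed matrix; their image `none` is arbitrary.
  let f : Sym → M.tm.Γ M.tm.k₀ := fun a => M.inputAlphabet.symm (a.elim id fun _ => none)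
  let sz : Graph × List Bool → ℕ := fun x => (encodeGraphCoins x).length
  have hn : PolyBdd sz fun x => x.1.1 := PolyBdd.self.mono le_length_encodeGraphCoins
  have hlen : PolyBdd sz fun x => (graphClass R l x.1).encode.length := by
    refine PolyBdd.mono ?_ fun x => length_encode_graphClass_le R l x.1
    exact ((hn.mul (.const _)).add hn).mul (((hn.add (.const 1)).pow l).add (.const 1))
  have hq : PolyBdd sz fun x => numDigits 2 (numDigits R x.1.1) + s :=
    (hn.mono fun x => (numDigits_le (by norm_num) _).trans (numDigits_le hR _)).add (.const s)
  -- The output must be short for the final loop; its length is at most its value, which `hle`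
  -- bounds by the number of rows.
  have hout : PolyBdd sz fun x => (encodeNat (alg (graphClass R l x.1))).length := by
    refine PolyBdd.mono ((hn.mul (.const l)).add hn) fun x => ?_
    refine (length_encodeNat_le _).trans ((hle _).trans ?_)
    change (rowList l (adjRows x.1).length).length ≤ _
    rw [length_rowList, length_adjRows]
  obtain ⟨p, hp⟩ : PolyBdd sz fun x =>
      reductionTime R l s x.1.1 (sz x) + ((graphClass R l x.1).encode.length * 4 + 1) +
        (M.time.eval (graphClass R l x.1).encode.length + 1) +
        ((numDigits 2 (numDigits R x.1.1) + s) * 3 + 1) + 2 +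
        ((encodeNat (alg (graphClass R l x.1))).length * 2 + 1) + 1 :=
    ((((((polyBdd_reductionTime hR l s hn .self).add ((hlen.mul (.const 4)).add (.const 1))).add
      ((polyBdd_eval _ hlen).add (.const 1))).add ((hq.mul (.const 3)).add (.const 1))).add
      (.const 2)).add ((hout.mul (.const 2)).add (.const 1))).add (.const 1)
  have key (x : Graph × List Bool) := Runs.outputsInTime (v₀ := ((none, (none, ()),
      M.tm.initialState) : TestState M.tm)) (runs_testRoutine (tm := M.tm) (f := f)
    (P := reduction R l s) (inp := encodeGraphCoins x)
    (L := (graphClass R l x.1).encode.map Sum.inl)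
    (m := numDigits 2 (numDigits R x.1.1) + s) (t := reductionTime R l s x.1.1 (sz x))
    (l' := (encodeNat (alg (graphClass R l x.1))).map M.outputAlphabet.invFun)
    (t' := M.time.eval (graphClass R l x.1).encode.length)
    (by
      have h := runs_reduction (l := l) (s := s) hR hl (adjRows x.1) (length_adjRows x.1)
        (fun X hX => length_of_mem_adjRows hX) x.2
      rw [← encodeGraph_eq, encOutput_eq hR hl] at h
      refine h.congr rfl ?_ rfl
      simp [sz, encodeGraphCoins])
    (by
      have h := M.outputsFun (graphClass R l x.1)
      rw [List.map_map]
      exact h))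
  -- The test is deterministic: the polynomial for the number of coins is `0`.
  refine ⟨⟨fun x => decide (2 ^ (numDigits 2 (numDigits R x.1.1) + s) ≤
    alg (graphClass R l x.1)), 0, ⟨⟨⟨(testRoutine M.tm f (reduction R l s)).toFinTM2 (.inl .inp)
      (.inr none) (none, (none, ()), M.tm.initialState), Equiv.refl _, Equiv.refl _⟩, p,
      fun x => ⟨⟨(key x).some.steps, ?_⟩, (key x).some.steps_le_m.trans ?_⟩⟩⟩⟩, fun x => rfl⟩
  · have h₂ := (key x).some.evals_in_steps
    simp only [List.length_map] at h₂
    have h₁ : (encodeGraphCoins x).map (Equiv.refl Sym).invFun = encodeGraphCoins x :=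
      List.map_id _
    have h₃ : (encodeBool (decide (2 ^ (numDigits 2 (numDigits R x.1.1) + s) ≤
        alg (graphClass R l x.1)))).map (Equiv.refl Bool).invFun =
        [decide (numDigits 2 (numDigits R x.1.1) + s <
          (encodeNat (alg (graphClass R l x.1))).length)] := by
      simp only [lt_length_encodeNat]
      rfl
    exact (congrArg (fun L => (flip bind ((testRoutine M.tm f (reduction R l s)).toFinTM2
      (.inl .inp) (.inr none) (none, (none, ()), M.tm.initialState)).step)^[(key x).some.steps]
        (some (initList _ L))) h₁).trans (h₂.trans (congrArg (fun L => some (haltList _ L))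
        h₃.symm))
  · simp only [List.length_map]
    exact hp x

end CliqueReduction

namespace Learning

/-! ### Bounds on Littlestone's dimension -/

variable {X : Type*}

/-- The labels opposite to the predictions of the learner. -/
def adversary (A : OnlineLearner X) : List (X × Bool) → List X → List (X × Bool)
  | _, [] => []
  | past, x :: L => (x, !A past x) :: adversary A (past ++ [(x, !A past x)]) L

theorem map_fst_adversary (A : OnlineLearner X) (past : List (X × Bool)) (L : List X) :
    (adversary A past L).map Prod.fst = L := by
  induction L generalizing past with
  | nil => rfl
  | cons x L ih => simp [adversary, ih]

theorem mistakesFrom_adversary (A : OnlineLearner X) (past : List (X × Bool)) (L : List X) :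
    mistakesFrom A past (adversary A past L) = L.length := by
  induction L generalizing past with
  | nil => rfl
  | cons x L ih => simp [adversary, mistakesFrom, ih, add_comm]

variable [DecidableEq X]

/-- The concepts that agree with the labelled samples. -/
def consistent (𝒞 : Finset (Finset X)) (s : List (X × Bool)) : Finset (Finset X) :=
  𝒞.filter fun c => ∀ p ∈ s, p.2 = decide (p.1 ∈ c)

theorem mem_consistent_append {𝒞 : Finset (Finset X)} {s : List (X × Bool)} {x : X} {y : Bool}
    {c : Finset X} : c ∈ consistent 𝒞 (s ++ [(x, y)]) ↔
      c ∈ consistent 𝒞 s ∧ y = decide (x ∈ c) := by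
  simp only [consistent, Finset.mem_filter, List.mem_append, List.mem_singleton, or_imp,
    forall_and, forall_eq, and_assoc]

/-- The samples labelled `true`. -/
def positives (s : List (X × Bool)) : Finset X := ((s.filter Prod.snd).map Prod.fst).toFinset

theorem card_positives {s : List (X × Bool)} (hs : (s.map Prod.fst).Nodup) :
    (positives s).card = s.countP Prod.snd := by
  rw [positives, List.toFinset_card_of_nodup, List.length_map, List.countP_eq_length_filter]
  exact hs.sublist (List.filter_sublist.map _)

theorem positives_subset {𝒞 : Finset (Finset X)} {s : List (X × Bool)} {c : Finset X}
    (hc : c ∈ consistent 𝒞 s) : positives s ⊆ c := by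
  intro x hx
  simp only [positives, List.mem_toFinset, List.mem_map, List.mem_filter] at hx
  obtain ⟨p, ⟨hp, hp'⟩, rfl⟩ := hx
  exact of_decide_eq_true (((Finset.mem_filter.1 hc).2 p hp).symm.trans hp')

/-- The learner that predicts `false` until `D` samples were labelled `true`, and then follows the
majority of the consistent concepts. -/
def delayedMajority (𝒞 : Finset (Finset X)) (D : ℕ) : OnlineLearner X := fun past x =>
  decide (D ≤ past.countP Prod.snd) &&
    decide ((consistent 𝒞 past).card ≤ 2 * (consistent 𝒞 (past ++ [(x, true)])).card)

theorem card_consistent_append_add (𝒞 : Finset (Finset X)) (s : List (X × Bool)) (x : X) :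
    (consistent 𝒞 (s ++ [(x, true)])).card + (consistent 𝒞 (s ++ [(x, false)])).card =
      (consistent 𝒞 s).card := by
  rw [← Finset.card_filter_add_card_filter_not (s := consistent 𝒞 s) fun c => x ∈ c]
  congr 2 <;> ext c <;> simp [mem_consistent_append]

/-- Halving: in the majority phase each mistake at least halves the number of consistent concepts,
which stays positive. -/
theorem mistakesFrom_delayedMajority_le_of_le {𝒞 : Finset (Finset X)} {D : ℕ} (s) :
    ∀ {past : List (X × Bool)} {b : ℕ}, D ≤ past.countP Prod.snd →
      (consistent 𝒞 past).card ≤ 2 ^ b → (consistent 𝒞 (past ++ s)).Nonempty →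
      mistakesFrom (delayedMajority 𝒞 D) past s ≤ b := by
  induction s with
  | nil => simp [mistakesFrom]
  | cons p s ih =>
    obtain ⟨x, y⟩ := p
    intro past b hD hb hne
    have hne' : (consistent 𝒞 ((past ++ [(x, y)]) ++ s)).Nonempty := by simpa using hne
    have hD' : D ≤ (past ++ [(x, y)]).countP Prod.snd := by
      rw [List.countP_append]; omega
    have hpos : 0 < (consistent 𝒞 (past ++ [(x, y)])).card := by
      obtain ⟨c, hc⟩ := hne'
      refine Finset.card_pos.2 ⟨c, ?_⟩
      rw [consistent, Finset.mem_filter] at hc ⊢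
      exact ⟨hc.1, fun p hp => hc.2 p (List.mem_append_left _ hp)⟩
    have hadd := card_consistent_append_add 𝒞 past x
    rw [mistakesFrom]
    split_ifs with h
    · have hhalf : 2 * (consistent 𝒞 (past ++ [(x, y)])).card ≤ (consistent 𝒞 past).card := by
        cases y <;> simp [delayedMajority, hD] at h <;> omega
      cases b with
      | zero => omega
      | succ b =>
        have := ih (b := b) hD' (by rw [pow_succ] at hb; omega) hne'
        omega
    · have := ih (b := b) hD' (by cases y <;> omega) hne'
      omega

/-- In the first phase every mistake is a label `true` and reduces the number still missing to `D`.
In the second phase all consistent concepts contain the at least `D` positive samples, so halving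
starts from at most `2 ^ b` concepts. -/
theorem mistakesFrom_delayedMajority_le {𝒞 : Finset (Finset X)} {D b : ℕ}
    (h : ∀ T : Finset X, D ≤ T.card → (𝒞.filter (T ⊆ ·)).card ≤ 2 ^ b) (s) :
    ∀ {past : List (X × Bool)}, ((past ++ s).map Prod.fst).Nodup →
      (consistent 𝒞 (past ++ s)).Nonempty →
      mistakesFrom (delayedMajority 𝒞 D) past s ≤ (D - past.countP Prod.snd) + b := by
  induction s with
  | nil => simp [mistakesFrom]
  | cons p s ih =>
    obtain ⟨x, y⟩ := p
    intro past hs hne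
    by_cases hD : D ≤ past.countP Prod.snd
    · refine (mistakesFrom_delayedMajority_le_of_le _ hD ?_ hne).trans (Nat.le_add_left _ _)
      have hp : (past.map Prod.fst).Nodup := by
        rw [List.map_append] at hs
        exact hs.of_append_left
      refine (Finset.card_le_card ?_).trans (h (positives past) ((card_positives hp).symm ▸ hD))
      exact fun c hc => Finset.mem_filter.2 ⟨(Finset.mem_filter.1 hc).1, positives_subset hc⟩
    · have := ih (past := past ++ [(x, y)]) (by simpa using hs) (by simpa using hne)
      rw [List.countP_append] at this
      rw [mistakesFrom]
      cases y <;> simp [delayedMajority, hD] at this ⊢ <;> omega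

/-- If few concepts contain any given `D` points then Littlestone's dimension is small. -/
theorem littlestoneDim_le {𝒞 : Finset (Finset X)} {D b : ℕ}
    (h : ∀ T : Finset X, D ≤ T.card → (𝒞.filter (T ⊆ ·)).card ≤ 2 ^ b) :
    littlestoneDim 𝒞 ≤ D + b := by
  refine Nat.sInf_le ⟨delayedMajority 𝒞 D, fun s hs ⟨c, hc, hcs⟩ => ?_⟩
  exact mistakesFrom_delayedMajority_le h s (past := []) hs ⟨c, Finset.mem_filter.2 ⟨hc, hcs⟩⟩

theorem realizable_of_shatters {𝒞 : Finset (Finset X)} {T : Finset X} (hT : 𝒞.Shatters T)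
    {s : List (X × Bool)} (hs : (s.map Prod.fst).Nodup) (hsT : ∀ p ∈ s, p.1 ∈ T) :
    Realizable 𝒞 s := by
  obtain ⟨c, hc, hTc⟩ := hT (t := positives s) fun x hx => by
    simp only [positives, List.mem_toFinset, List.mem_map, List.mem_filter] at hx
    obtain ⟨p, ⟨hp, -⟩, rfl⟩ := hx
    exact hsT p hp
  refine ⟨c, hc, fun p hp => ?_⟩
  have : p.1 ∈ c ↔ p.1 ∈ positives s := by
    rw [← hTc, Finset.mem_inter, and_iff_right (hsT p hp)]
  rw [decide_eq_decide.2 this, Bool.eq_iff_iff, decide_eq_true_iff, positives, List.mem_toFinset,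
    List.mem_map]
  refine ⟨fun h => ⟨p, List.mem_filter.2 ⟨hp, h⟩, rfl⟩, ?_⟩
  rintro ⟨p', hp', hpp⟩
  rw [List.mem_filter] at hp'
  -- The samples are distinct, so the one labelled `true` at this point is `p` itself.
  exact List.inj_on_of_nodup_map hs hp'.1 hp hpp ▸ hp'.2

/-- On a shattered set the adversary may contradict every prediction: all labellings are realizable.
-/
theorem card_le_littlestoneDim [Fintype X] {𝒞 : Finset (Finset X)} {T : Finset X}
    (hT : 𝒞.Shatters T) : T.card ≤ littlestoneDim 𝒞 := by
  obtain ⟨A, hA⟩ := exists_hasMistakeBound_littlestoneDim 𝒞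
  have hmap := map_fst_adversary A [] T.toList
  have hnd : ((adversary A [] T.toList).map Prod.fst).Nodup := by
    rw [hmap]
    exact T.nodup_toList
  have := hA _ hnd (realizable_of_shatters hT hnd fun p hp => by
    rw [← Finset.mem_toList, ← hmap]
    exact List.mem_map_of_mem hp)
  rwa [mistakes, mistakesFrom_adversary, Finset.length_toList] at this

theorem littlestoneDim_le_card [Fintype X] (𝒞 : Finset (Finset X)) :
    littlestoneDim 𝒞 ≤ Fintype.card X := by
  refine Nat.sInf_le ⟨fun _ _ => true, fun s hs _ => (mistakesFrom_le _ _ _).trans ?_⟩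
  have h := hs.length_le_card
  rwa [List.length_map] at h

theorem vcDim_le_littlestoneDim [Fintype X] (𝒞 : Finset (Finset X)) :
    𝒞.vcDim ≤ littlestoneDim 𝒞 :=
  Finset.sup_le fun _ hT => card_le_littlestoneDim (Finset.mem_shatterer.1 hT)

end Learning

namespace CliqueReduction

open StackProgram Learning PlantedClique

/-! ### The dimensions of the constructed class -/

theorem getD_adjRows {N : ℕ} (H : SimpleGraph (Fin N)) [DecidableRel H.Adj] (u v : Fin N) :
    ((adjRows ⟨N, H⟩).getD u []).getD v false = decide (H.Adj u v) := by
  simp [adjRows]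

theorem mem_concepts_graphClass {R l N : ℕ} (hN : N ≠ 0) {H : SimpleGraph (Fin N)}
    {c : Finset (Fin (graphClass R l ⟨N, H⟩).m)} :
    c ∈ (graphClass R l ⟨N, H⟩).concepts ↔ ∃ t ∈ tuples N l, ∀ i, i ∈ c ↔
      value l (numDigits R N) (adjRows ⟨N, H⟩)
        ((rowList l (adjRows ⟨N, H⟩).length).get i) t = true := by
  have hcol : columns l (adjRows ⟨N, H⟩).length = tuples N l := by
    rw [columns, length_adjRows, if_neg hN]
  simp only [ExplicitClass.concepts, Finset.mem_image, Finset.mem_univ, true_and]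
  constructor
  · rintro ⟨j, rfl⟩
    refine ⟨(columns l (adjRows ⟨N, H⟩).length).get j, hcol ▸ List.get_mem _ j, fun i => by
      rw [Finset.mem_filter, and_iff_right (Finset.mem_univ _)]; rfl⟩
  · rintro ⟨t, ht, h⟩
    rw [← hcol] at ht
    obtain ⟨j, hj⟩ := List.get_of_mem ht
    refine ⟨j, ?_⟩
    ext i
    rw [Finset.mem_filter, and_iff_right (Finset.mem_univ _), h, ← hj]
    rfl

/-- The quantifier over `h` only supplies the bound for the index; the bound always holds here, as
`colour` is a residue modulo `l * q`. -/
theorem value_vertex {R l N : ℕ} (hR : 1 < R) (hl : 0 < l) (H : SimpleGraph (Fin N)) (u : Fin N)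
    (f : Fin l → Fin N) :
    value l (numDigits R N) (adjRows ⟨N, H⟩) (.inr u) (List.ofFn fun j => (f j : ℕ)) = true ↔
      (∀ j, H.Adj u (f j)) ∧
        ∀ h : colour l (numDigits R N) N u / numDigits R N < l,
          ((f ⟨_, h⟩ : ℕ) + 1).testBit (colour l (numDigits R N) N u % numDigits R N) = true := by
  classical
  have hq : 0 < numDigits R N := numDigits_pos hR u.pos.ne'
  have hlen : (adjRows ⟨N, H⟩).length = N := length_adjRows _
  have hc : colour l (numDigits R N) N u / numDigits R N < l := by
    rw [Nat.div_lt_iff_lt_mul hq]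
    exact Nat.mod_lt _ (Nat.mul_pos hl hq)
  rw [value_inr hq hl, hlen, Bool.and_eq_true, List.all_eq_true]
  · refine and_congr ?_ ?_
    · rw [List.forall_mem_ofFn_iff]
      exact forall_congr' fun j => by rw [getD_adjRows, decide_eq_true_iff]
    · rw [forall_prop_of_true hc]
      simp [hc]
  · rw [hlen, mem_tuples]
    simp

theorem exists_ofFn {N l : ℕ} {t : List ℕ} (ht : t ∈ tuples N l) :
    ∃ f : Fin l → Fin N, t = List.ofFn fun j => (f j : ℕ) := by
  obtain ⟨rfl, h⟩ := mem_tuples.1 ht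
  exact ⟨fun j => ⟨t.get j, h _ (List.get_mem _ _)⟩, by simp⟩

/-- A clique that meets all the classes of vertices yields a large shattered set. -/
theorem exists_shatters_graphClass {R l N : ℕ} (hR : 1 < R) (hl : 0 < l) {H : SimpleGraph (Fin N)}
    {S : Finset (Fin N)} (hS : ∀ u ∈ S, ∀ v ∈ S, u ≠ v → H.Adj u v) {h : ℕ}
    (hrow : ∀ c < l * numDigits R N, ∃ u ∈ S, (u : ℕ) < h ∧ colour l (numDigits R N) N u = c)
    (hcol : ∀ r < 2 ^ numDigits R N, ∃ w ∈ S, h ≤ (w : ℕ) ∧ ((w : ℕ) + 1) % 2 ^ numDigits R N = r) :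
    ∃ T, (graphClass R l ⟨N, H⟩).concepts.Shatters T ∧ T.card = l * numDigits R N := by
  have hN : N ≠ 0 := by
    obtain ⟨w, -⟩ := hcol 0 (by positivity)
    exact w.pos.ne'
  have hq : 0 < numDigits R N := numDigits_pos hR hN
  generalize hqq : numDigits R N = q at *
  choose u huS huh huc using fun c : Fin (l * q) => hrow c c.2
  choose w hwS hwh hwr using fun r : Fin (2 ^ q) => hcol r r.2
  have hidx (c : Fin (l * q)) : ∃ i : Fin (graphClass R l ⟨N, H⟩).m,
      (rowList l (adjRows ⟨N, H⟩).length).get i = .inr (u c : ℕ) :=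
    List.get_of_mem (mem_rowList.2 (.inr ⟨_, (length_adjRows ⟨N, H⟩).symm ▸ (u c).2, rfl⟩))
  choose idx hidx using hidx
  have hinj : Function.Injective idx := fun c c' hcc => by
    have := (hidx c).symm.trans ((congrArg _ hcc).trans (hidx c'))
    rw [Sum.inr.injEq] at this
    exact Fin.ext (by rw [← huc c, ← huc c', this])
  refine ⟨Finset.univ.image idx, fun t ht => ?_, by
    rw [Finset.card_image_of_injective _ hinj, Finset.card_fin]⟩
  have hlt (j : Fin l) (i : Fin q) : (j : ℕ) * q + i < l * q := by
    calc (j : ℕ) * q + i < (j + 1) * q := by rw [add_mul, one_mul]; omega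
      _ ≤ l * q := Nat.mul_le_mul_right _ j.2
  -- The part of the pattern `t` on the colours with coordinate `j` is read as a number of `q` bits;
  -- `f j` is the clique vertex whose successor has this residue.
  let r (j : Fin l) : Fin (2 ^ q) :=
    ⟨Nat.ofBits fun i : Fin q => decide (idx ⟨j * q + i, hlt j i⟩ ∈ t), Nat.ofBits_lt_two_pow _⟩
  let f (j : Fin l) : Fin N := w (r j)
  have key (c : Fin (l * q)) : value l q (adjRows ⟨N, H⟩) (.inr (u c : ℕ))
      (List.ofFn fun j => (f j : ℕ)) = true ↔ idx c ∈ t := by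
    have hcl : (c : ℕ) / q < l := (Nat.div_lt_iff_lt_mul hq).2 c.2
    have hval := value_vertex hR hl H (u c) f
    rw [hqq, huc c] at hval
    rw [hval, and_iff_right, forall_prop_of_true hcl]
    · have h₁ := Nat.testBit_mod_two_pow ((f ⟨_, hcl⟩ : ℕ) + 1) q (c % q)
      rw [hwr, decide_eq_true (Nat.mod_lt _ hq), Bool.true_and] at h₁
      rw [← h₁]
      change (Nat.ofBits fun i : Fin q => _).testBit _ = true ↔ _
      rw [Nat.testBit_ofBits_lt _ _ (Nat.mod_lt _ hq), decide_eq_true_iff]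
      have : (⟨(c : ℕ) / q * q + c % q, hlt ⟨_, hcl⟩ ⟨_, Nat.mod_lt _ hq⟩⟩ : Fin (l * q)) = c :=
        Fin.ext (Nat.div_add_mod' _ _)
      rw [this]
    · intro j
      -- The point lies below `h` and the coordinate does not, so they are distinct clique vertices,
      -- hence adjacent.
      refine hS _ (huS c) _ (hwS _) fun he => ?_
      have h₁ := huh c
      have h₂ := hwh (r j)
      rw [he] at h₁
      exact absurd h₁ (by simpa [f] using h₂)
  refine ⟨Finset.univ.filter fun i => value l q (adjRows ⟨N, H⟩)
    ((rowList l (adjRows ⟨N, H⟩).length).get i) (List.ofFn fun j => (f j : ℕ)) = true,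
    (mem_concepts_graphClass hN).2 ⟨_, ?_, fun i => by
      rw [Finset.mem_filter, and_iff_right (Finset.mem_univ _), hqq]⟩, ?_⟩
  · rw [mem_tuples]
    simp
  · ext i
    simp only [Finset.mem_inter, Finset.mem_image, Finset.mem_univ, true_and, Finset.mem_filter]
    constructor
    · rintro ⟨⟨c, rfl⟩, hv⟩
      rw [hidx] at hv
      exact (key c).1 hv
    · intro hi
      obtain ⟨c, -, rfl⟩ := Finset.mem_image.1 (ht hi)
      refine ⟨⟨c, rfl⟩, ?_⟩
      rw [hidx]
      exact (key c).2 hi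

/-- The graph contains two disjoint sets of `k` vertices with all edges between them. -/
def HasBiclique {N : ℕ} (H : SimpleGraph (Fin N)) (k : ℕ) : Prop :=
  ∃ U W : Finset (Fin N), U.card = k ∧ W.card = k ∧ Disjoint U W ∧ ∀ u ∈ U, ∀ w ∈ W, H.Adj u w

/-- Without large bicliques, Littlestone's dimension of the constructed class is small. -/
theorem ldim_graphClass_le {R l N k b : ℕ} (hR : 1 < R) (hl : 0 < l) (hN : N ≠ 0)
    {H : SimpleGraph (Fin N)} (hH : ¬ HasBiclique H k) (hb : k ^ l ≤ 2 ^ b) :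
    (graphClass R l ⟨N, H⟩).ldim ≤ k + l + b := by
  classical
  have hlen : (adjRows ⟨N, H⟩).length = N := length_adjRows _
  refine littlestoneDim_le fun T hT => ?_
  rcases Finset.eq_empty_or_nonempty ((graphClass R l ⟨N, H⟩).concepts.filter (T ⊆ ·)) with he | hne
  · simp [he]
  let row (i : Fin (graphClass R l ⟨N, H⟩).m) : Row := (rowList l (adjRows ⟨N, H⟩).length).get i
  have hrow : Function.Injective row := List.nodup_iff_injective_get.1 (nodup_rowList _ _)
  -- `U` consists of the vertices among the points of `T`, and `W` of their common neighbours.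
  let U : Finset (Fin N) := Finset.univ.filter fun u => .inr (u : ℕ) ∈ T.image row
  let W : Finset (Fin N) := Finset.univ.filter fun w => ∀ u ∈ U, H.Adj u w
  have hconcept {c} (hc : c ∈ (graphClass R l ⟨N, H⟩).concepts.filter (T ⊆ ·)) :
      ∃ f : Fin l → Fin N, (∀ i, i ∈ c ↔ value l (numDigits R N) (adjRows ⟨N, H⟩) (row i)
        (List.ofFn fun j => (f j : ℕ)) = true) ∧ ∀ j, f j ∈ W := by
    obtain ⟨hc, hTc⟩ := Finset.mem_filter.1 hc
    obtain ⟨t, ht, h⟩ := (mem_concepts_graphClass hN).1 hc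
    obtain ⟨f, rfl⟩ := exists_ofFn ht
    refine ⟨f, h, fun j => Finset.mem_filter.2 ⟨Finset.mem_univ _, fun u hu => ?_⟩⟩
    obtain ⟨i, hi, hiu⟩ := Finset.mem_image.1 (Finset.mem_filter.1 hu).2
    have hv := (h i).1 (hTc hi)
    change value _ _ _ (row i) _ = true at hv
    rw [hiu] at hv
    exact ((value_vertex hR hl H u f).1 hv).1 j
  have hU : k ≤ U.card := by
    obtain ⟨c, hc⟩ := hne
    obtain ⟨f, hf, -⟩ := hconcept hc
    have hTc := (Finset.mem_filter.1 hc).2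
    -- A concept contains `(w, j)` only for `w = f j`; so at most `l` of the at least `k + l` points
    -- are not vertices.
    have hsub : T.image row ⊆ (U.image fun u : Fin N => (.inr (u : ℕ) : Row)) ∪
        Finset.univ.image fun j : Fin l => (.inl ((f j : ℕ), (j : ℕ)) : Row) := by
      intro ρ hρ
      obtain ⟨i, hi, rfl⟩ := Finset.mem_image.1 hρ
      have hv := (hf i).1 (hTc hi)
      have hmem : row i ∈ rowList l (adjRows ⟨N, H⟩).length := List.get_mem _ _
      rw [Finset.mem_union]
      rcases mem_rowList.1 hmem with ⟨w, hw, j, hj, he⟩ | ⟨u, hu, he⟩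
      · right
        rw [he, value_inl hw hj, decide_eq_true_iff] at hv
        · refine Finset.mem_image.2 ⟨⟨j, hj⟩, Finset.mem_univ _, ?_⟩
          rw [he, ← hv]
          simp [hj]
        · rw [hlen, mem_tuples]
          simp
      · left
        rw [hlen] at hu
        refine Finset.mem_image.2 ⟨⟨u, hu⟩, Finset.mem_filter.2 ⟨Finset.mem_univ _, ?_⟩, he.symm⟩
        rw [← he]
        exact hρ
    have h₁ := (Finset.card_le_card hsub).trans (Finset.card_union_le _ _)
    rw [Finset.card_image_of_injective _ hrow] at h₁
    have h₂ := Finset.card_image_le (s := U) (f := fun u : Fin N => (.inr (u : ℕ) : Row))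
    have h₃ := Finset.card_image_le (s := (Finset.univ : Finset (Fin l)))
      (f := fun j : Fin l => (.inl ((f j : ℕ), (j : ℕ)) : Row))
    rw [Finset.card_fin] at h₃
    omega
  have hW : W.card ≤ k := by
    by_contra! hW
    obtain ⟨U', hU', hcU⟩ := Finset.exists_subset_card_eq hU
    obtain ⟨W', hW', hcW⟩ := Finset.exists_subset_card_eq hW.le
    have hadj : ∀ u ∈ U', ∀ w ∈ W', H.Adj u w := fun u hu w hw =>
      (Finset.mem_filter.1 (hW' hw)).2 u (hU' hu)
    -- Disjointness is automatic, because a common element would be adjacent to itself.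
    exact hH ⟨U', W', hcU, hcW, Finset.disjoint_left.2 fun x hx hx' => (hadj x hx x hx').ne rfl,
      hadj⟩
  have : Nonempty (Fin l → Fin N) := ⟨fun _ => ⟨0, Nat.pos_of_ne_zero hN⟩⟩
  choose! F hF hFW using fun c => hconcept (c := c)
  calc ((graphClass R l ⟨N, H⟩).concepts.filter (T ⊆ ·)).card
      ≤ (Fintype.piFinset fun _ : Fin l => W).card := by
        -- A concept is determined by its tuple, whose coordinates all lie in `W`.
        refine Finset.card_le_card_of_injOn F (fun c hc => ?_) fun c hc c' hc' he => ?_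
        · exact Fintype.mem_piFinset.2 (hFW c hc)
        · ext i
          rw [hF c hc, hF c' hc', he]
    _ ≤ 2 ^ b := by
        rw [Fintype.card_piFinset_const]
        exact (Nat.pow_le_pow_left hW _).trans hb

end CliqueReduction

namespace PlantedClique

open MeasureTheory
open scoped ENNReal

/-! ### Random graphs -/

theorem measurableSingletonClass_simpleGraph (N : ℕ) :
    MeasurableSingletonClass (SimpleGraph (Fin N)) := ⟨fun G => by
  have : ({G} : Set (SimpleGraph (Fin N))) = SimpleGraph.edgeSet ⁻¹' {G.edgeSet} := by
    ext H
    simp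
  rw [this]
  exact SimpleGraph.measurable_edgeSet (measurableSet_singleton _)⟩

/-- At edge probability `1/2` all graphs are equally likely. -/
theorem binomialRandom_half_singleton {N : ℕ} (G : SimpleGraph (Fin N)) :
    SimpleGraph.binomialRandom (Fin N) half {G} = (2⁻¹ : ℝ≥0∞) ^ N.choose 2 := by
  have h₁ : unitInterval.toNNReal half = 2⁻¹ := by
    ext; simp [half]
  have h₂ : unitInterval.toNNReal (unitInterval.symm half) = 2⁻¹ := by
    ext; simp [half]; norm_num
  have hcard : G.edgeSet.ncard ≤ N.choose 2 := by
    classical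
    rw [← SimpleGraph.coe_edgeFinset, Set.ncard_coe_finset]
    simpa using G.card_edgeFinset_le_card_choose_two
  rw [SimpleGraph.binomialRandom_singleton, h₁, h₂, ← pow_add, Nat.card_fin,
    Nat.add_sub_cancel' hcard]
  simp

theorem binomialRandom_half_coe {N : ℕ} (E : Finset (SimpleGraph (Fin N))) :
    SimpleGraph.binomialRandom (Fin N) half E = E.card * (2⁻¹ : ℝ≥0∞) ^ N.choose 2 := by
  have := measurableSingletonClass_simpleGraph N
  rw [← sum_measure_singleton]
  simp only [binomialRandom_half_singleton, Finset.sum_const, nsmul_eq_mul]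

/-- Two given disjoint sets are completely joined with probability at most `2 ^ (-k ^ 2)`. -/
theorem binomialRandom_half_complete_le {N k : ℕ} {U W : Finset (Fin N)} (hU : U.card = k)
    (hW : W.card = k) (hUW : Disjoint U W) :
    SimpleGraph.binomialRandom (Fin N) half {G | ∀ u ∈ U, ∀ w ∈ W, G.Adj u w} ≤
      (2⁻¹ : ℝ≥0∞) ^ (k * k) := by
  classical
  let E : Finset (SimpleGraph (Fin N)) := Finset.univ.filter fun G => ∀ u ∈ U, ∀ w ∈ W, G.Adj u w
  -- From a graph in `E` delete any set `B` of pairs in `U ×ˢ W`. The result determines `B`, as its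
  -- missing pairs, and then the graph.
  have hcard : E.card * 2 ^ (k * k) ≤ (Finset.univ : Finset (SimpleGraph (Fin N))).card := by
    have hB : (U ×ˢ W).powerset.card = 2 ^ (k * k) := by
      rw [Finset.card_powerset, Finset.card_product, hU, hW]
    rw [← hB, ← Finset.card_product]
    let D (B : Finset (Fin N × Fin N)) : SimpleGraph (Fin N) :=
      SimpleGraph.fromRel fun u w => (u, w) ∈ B
    have hD {B} (hB : B ⊆ U ×ˢ W) {u w} (hu : u ∈ U) (hw : w ∈ W) :
        (D B).Adj u w ↔ (u, w) ∈ B := by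
      rw [SimpleGraph.fromRel_adj]
      refine ⟨fun h => h.2.resolve_right fun h => ?_, fun h => ⟨?_, .inl h⟩⟩
      · exact Finset.disjoint_left.1 hUW (Finset.mem_product.1 (hB h)).1 hw |>.elim
      · rintro rfl
        exact Finset.disjoint_left.1 hUW hu hw
    have hDE {G} (hG : G ∈ E) {B} (hB : B ⊆ U ×ˢ W) : D B ≤ G := by
      intro u w h
      have hG := (Finset.mem_filter.1 hG).2
      obtain ⟨-, h | h⟩ := (SimpleGraph.fromRel_adj _ _ _).1 h
      · have := Finset.mem_product.1 (hB h)
        exact hG _ this.1 _ this.2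
      · have := Finset.mem_product.1 (hB h)
        exact (hG _ this.1 _ this.2).symm
    refine Finset.card_le_card_of_injOn (fun p => p.1 \ D p.2) (fun _ _ => Finset.mem_univ _) ?_
    rintro ⟨G, B⟩ h ⟨G', B'⟩ h' he
    rw [Finset.mem_coe, Finset.mem_product, Finset.mem_powerset] at h h'
    have hBB : B = B' := by
      ext ⟨u, w⟩
      have key (u w) (hu : u ∈ U) (hw : w ∈ W) : (u, w) ∈ B ↔ (u, w) ∈ B' := by
        have h₁ := (Finset.mem_filter.1 h.1).2 u hu w hw
        have h₂ := (Finset.mem_filter.1 h'.1).2 u hu w hw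
        have h₃ : (G \ D B).Adj u w ↔ (G' \ D B').Adj u w := by
          rw [show G \ D B = G' \ D B' from he]
        rw [SimpleGraph.sdiff_adj, SimpleGraph.sdiff_adj, hD h.2 hu hw, hD h'.2 hu hw] at h₃
        tauto
      constructor
      · intro hm
        have := Finset.mem_product.1 (h.2 hm)
        exact (key u w this.1 this.2).1 hm
      · intro hm
        have := Finset.mem_product.1 (h'.2 hm)
        exact (key u w this.1 this.2).2 hm
    subst hBB
    rw [Prod.mk.injEq]
    refine ⟨?_, rfl⟩
    dsimp only at h h'
    rw [← sdiff_sup_cancel (hDE h.1 h.2), ← sdiff_sup_cancel (hDE h'.1 h'.2)]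
    exact congrArg (· ⊔ D B) he
  have hE : {G : SimpleGraph (Fin N) | ∀ u ∈ U, ∀ w ∈ W, G.Adj u w} = E := by
    ext G
    simp [E]
  have hone : ((Finset.univ : Finset (SimpleGraph (Fin N))).card : ℝ≥0∞) *
      2⁻¹ ^ N.choose 2 = 1 := by
    rw [← binomialRandom_half_coe, Finset.coe_univ, measure_univ]
  rw [hE, binomialRandom_half_coe, ← ENNReal.inv_pow (n := k * k), ENNReal.le_inv_iff_mul_le]
  calc (E.card * 2⁻¹ ^ N.choose 2 * 2 ^ (k * k) : ℝ≥0∞)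
      = ((E.card * 2 ^ (k * k) : ℕ) : ℝ≥0∞) * 2⁻¹ ^ N.choose 2 := by push_cast; ring
    _ ≤ 1 := by
        rw [← hone]
        gcongr

theorem binomialRandom_half_biclique_le {N k L : ℕ} (hN : N ≤ 2 ^ L) (hk : k = 2 * L + 2) :
    SimpleGraph.binomialRandom (Fin N) half {G | CliqueReduction.HasBiclique G k} ≤ 1 / 3 := by
  classical
  let P : Finset (Finset (Fin N) × Finset (Fin N)) :=
    (Finset.univ.powersetCard k ×ˢ Finset.univ.powersetCard k).filter fun p => Disjoint p.1 p.2
  have hP : P.card ≤ 2 ^ (k * (2 * L)) := by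
    calc P.card ≤ N.choose k * N.choose k := by
          refine (Finset.card_filter_le _ _).trans ?_
          simp [Finset.card_product]
      _ ≤ N ^ k * N ^ k := Nat.mul_le_mul (Nat.choose_le_pow _ _) (Nat.choose_le_pow _ _)
      _ ≤ (2 ^ L) ^ k * (2 ^ L) ^ k := by gcongr
      _ = 2 ^ (k * (2 * L)) := by rw [← pow_mul, ← pow_add]; congr 1; ring
  have hsub : {G : SimpleGraph (Fin N) | CliqueReduction.HasBiclique G k} ⊆
      ⋃ p ∈ P, {G | ∀ u ∈ p.1, ∀ w ∈ p.2, G.Adj u w} := by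
    rintro G ⟨U, W, hU, hW, hUW, h⟩
    refine Set.mem_biUnion (x := (U, W)) ?_ h
    simp [P, Finset.mem_powersetCard, hU, hW, hUW]
  calc SimpleGraph.binomialRandom (Fin N) half {G | CliqueReduction.HasBiclique G k}
      ≤ ∑ p ∈ P, (2⁻¹ : ℝ≥0∞) ^ (k * k) := by
        refine (measure_mono hsub).trans ((measure_biUnion_finset_le _ _).trans ?_)
        refine Finset.sum_le_sum fun p hp => ?_
        simp only [P, Finset.mem_filter, Finset.mem_product, Finset.mem_powersetCard] at hp
        exact binomialRandom_half_complete_le hp.1.1.2 hp.1.2.2 hp.2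
    _ ≤ 2 ^ (k * (2 * L)) * (2⁻¹ : ℝ≥0∞) ^ (k * k) := by
        rw [Finset.sum_const, nsmul_eq_mul]
        gcongr
        exact_mod_cast hP
    _ = 2⁻¹ ^ (2 * k) := by
        -- This is the purpose of `k = 2 * L + 2`: the probability of one biclique beats the number
        -- of candidates by a factor `2 ^ (2 * k)`.
        have : k * k = k * (2 * L) + 2 * k := by rw [hk]; ring
        rw [this, pow_add, ← mul_assoc, ← mul_pow,
          ENNReal.mul_inv_cancel (by norm_num) (by norm_num), one_pow, one_mul]
    _ ≤ 2⁻¹ ^ 2 := pow_le_pow_of_le_one (by simp) (by simp) (by omega)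
    _ ≤ 1 / 3 := by
        rw [← ENNReal.inv_pow, one_div, ENNReal.inv_le_inv]
        norm_num

/-- A random `κ`-subset of `n` points lies in a given set of `m` points with probability at most `(m
/ n) ^ κ`: sampling without replacement only lowers it. -/
theorem choose_mul_pow_le {m n : ℕ} (h : m ≤ n) (κ : ℕ) :
    m.choose κ * n ^ κ ≤ n.choose κ * m ^ κ := by
  have hd : m.descFactorial κ * n ^ κ ≤ n.descFactorial κ * m ^ κ := by
    induction κ with
    | zero => simp
    | succ κ ih =>
      have h₁ : (m - κ) * n ≤ (n - κ) * m := by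
        rw [Nat.sub_mul, Nat.sub_mul, Nat.mul_comm m n]
        exact Nat.sub_le_sub_left (Nat.mul_le_mul_left _ h) _
      calc m.descFactorial (κ + 1) * n ^ (κ + 1)
          = ((m - κ) * n) * (m.descFactorial κ * n ^ κ) := by
            rw [Nat.descFactorial_succ]; ring
        _ ≤ ((n - κ) * m) * (n.descFactorial κ * m ^ κ) := Nat.mul_le_mul h₁ ih
        _ = n.descFactorial (κ + 1) * m ^ (κ + 1) := by
            rw [Nat.descFactorial_succ]; ring
  rw [Nat.descFactorial_eq_factorial_mul_choose, Nat.descFactorial_eq_factorial_mul_choose,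
    mul_assoc, mul_assoc] at hd
  exact Nat.le_of_mul_le_mul_left hd κ.factorial_pos

/-- If a planted set meeting every set of a family forces the event, and few sets miss a set of the
family, then the event is likely. -/
theorem le_plantedLaw {N κ p : ℕ} (hκ : κ ≤ N) {𝒬 : Finset (Finset (Fin N))}
    (hp : ∀ P ∈ 𝒬, p ≤ P.card) (hcard : 3 * (𝒬.card * (N - p).choose κ) ≤ N.choose κ)
    {E : Set (SimpleGraph (Fin N))}
    (hE : ∀ S : Finset (Fin N), (∀ P ∈ 𝒬, ∃ x ∈ S, x ∈ P) → ∀ G, G ⊔ cliqueOn S ∈ E) (x : unitInterval) :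
    2 / 3 ≤ plantedLaw N x κ E := by
  classical
  have := measurableSingletonClass_simpleGraph N
  let good := (Finset.univ.powersetCard κ).filter fun S : Finset (Fin N) =>
    ∀ P ∈ 𝒬, ∃ x ∈ S, x ∈ P
  have hbad : N.choose κ ≤ good.card + 𝒬.card * (N - p).choose κ := by
    have h := Finset.card_filter_add_card_filter_not
      (s := (Finset.univ : Finset (Fin N)).powersetCard κ) fun S => ∀ P ∈ 𝒬, ∃ x ∈ S, x ∈ P
    rw [Finset.card_powersetCard, Finset.card_fin] at h
    rw [← h]
    refine Nat.add_le_add_left ?_ _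
    -- Union bound: a bad set misses some `P`, hence lies in its complement.
    calc _ ≤ (𝒬.biUnion fun P => Pᶜ.powersetCard κ).card := by
          refine Finset.card_le_card fun S hS => ?_
          simp only [Finset.mem_filter, Finset.mem_powersetCard, not_forall] at hS
          obtain ⟨⟨-, hSκ⟩, P, hP, hSP⟩ := hS
          refine Finset.mem_biUnion.2 ⟨P, hP, Finset.mem_powersetCard.2 ⟨fun x hx => ?_, hSκ⟩⟩
          exact Finset.mem_compl.2 fun hxP => hSP ⟨x, hx, hxP⟩
      _ ≤ 𝒬.card * (N - p).choose κ := by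
          refine Finset.card_biUnion_le_card_mul _ _ _ fun P hP => ?_
          rw [Finset.card_powersetCard, Finset.card_compl, Fintype.card_fin]
          exact Nat.choose_le_choose _ (Nat.sub_le_sub_left (hp P hP) _)
  have hgood : 2 * N.choose κ ≤ 3 * good.card := by omega
  have hc : 0 < N.choose κ := Nat.choose_pos hκ
  have hsum : (good.card : ℝ≥0∞) ≤
      ∑ S ∈ Finset.powersetCard κ (Finset.univ : Finset (Fin N)),
        ((SimpleGraph.binomialRandom (Fin N) x).map fun G => G ⊔ cliqueOn S) E := by
    calc (good.card : ℝ≥0∞) = ∑ S ∈ good,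
          ((SimpleGraph.binomialRandom (Fin N) x).map fun G => G ⊔ cliqueOn S) E := by
          rw [Finset.card_eq_sum_ones, Nat.cast_sum]
          refine Finset.sum_congr rfl fun S hS => ?_
          rw [Measure.map_apply Measurable.of_discrete (Set.toFinite E).measurableSet]
          have : (fun G => G ⊔ cliqueOn S) ⁻¹' E = Set.univ :=
            Set.eq_univ_of_forall fun G => hE S (Finset.mem_filter.1 hS).2 G
          rw [this, measure_univ, Nat.cast_one]
      _ ≤ _ := Finset.sum_le_sum_of_subset (Finset.filter_subset _ _)
  rw [plantedLaw, Measure.smul_apply, Measure.coe_finsetSum, Finset.sum_apply, smul_eq_mul]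
  refine le_trans ?_ (mul_le_mul_right hsum _)
  rw [mul_comm, ← div_eq_mul_inv, ENNReal.le_div_iff_mul_le (.inl (by exact_mod_cast hc.ne'))
    (.inl (by simp)), ← ENNReal.mul_div_right_comm, ENNReal.div_le_iff_le_mul (by simp) (by simp),
    mul_comm (good.card : ℝ≥0∞)]
  exact_mod_cast hgood

/-- The acceptance probability of a test that ignores its random bits. -/
theorem RandomizedTest.acceptProb_eq {A : RandomizedTest} {N : ℕ}
    {μ : Measure (SimpleGraph (Fin N))} [SFinite μ] {E : Set (SimpleGraph (Fin N))}
    (h : ∀ G c, A.run (⟨N, G⟩, c) = true ↔ G ∈ E) : A.acceptProb μ = μ E := by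
  have : {ω : SimpleGraph (Fin N) × (Fin (A.numCoins.eval N) → Bool) |
      A.run (⟨N, ω.1⟩, List.ofFn ω.2) = true} = E ×ˢ Set.univ := by
    ext ω
    simp [h]
  rw [acceptProb, this, Measure.prod_prod, measure_univ, mul_one]

end PlantedClique

namespace CliqueReduction

open StackProgram Learning PlantedClique Filter

/-! ### Hardness of approximation -/

/-- Among `n` consecutive numbers every residue class modulo `Q` occurs once in each of the `n / Q`
full blocks. The offset `a` accommodates both the colours and the residues of `w + 1`. -/
theorem div_le_card_filter_mod {N b n Q r : ℕ} (a : ℕ) (hbn : b + n ≤ N) (hr : r < Q) :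
    n / Q ≤ (Finset.univ.filter fun u : Fin N =>
      b ≤ (u : ℕ) ∧ (u : ℕ) < b + n ∧ (a + u) % Q = r).card := by
  have hQ : 0 < Q := by omega
  -- The position in each block at which the required residue occurs.
  let x := (r + (Q - (a + b) % Q)) % Q
  have hx : x < Q := Nat.mod_lt _ hQ
  have hlt (i : Fin (n / Q)) : i * Q + x < n := by
    calc i * Q + x < (i + 1) * Q := by rw [add_mul, one_mul]; omega
      _ ≤ n := (Nat.mul_le_mul_right _ i.2).trans (Nat.div_mul_le_self _ _)
  let g (i : Fin (n / Q)) : Fin N := ⟨b + (i * Q + x), by have := hlt i; omega⟩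
  have hg : Function.Injective g := fun i j h => by
    have : b + (i * Q + x) = b + (j * Q + x) := congrArg Fin.val h
    exact Fin.ext (Nat.eq_of_mul_eq_mul_right hQ (by omega))
  calc n / Q = (Finset.univ.image g).card := by
        rw [Finset.card_image_of_injective _ hg, Finset.card_fin]
    _ ≤ _ := by
        refine Finset.card_le_card fun u hu => ?_
        obtain ⟨i, -, rfl⟩ := Finset.mem_image.1 hu
        refine Finset.mem_filter.2 ⟨Finset.mem_univ _, Nat.le_add_right _ _,
          Nat.add_lt_add_left (hlt i) _, ?_⟩
        have h₁ : (a + b) % Q < Q := Nat.mod_lt _ hQ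
        calc (a + (b + (i * Q + x))) % Q = ((a + b) + x + i * Q) % Q := by congr 1; ring
          _ = ((a + b) % Q + (r + (Q - (a + b) % Q))) % Q := by
              rw [Nat.add_mul_mod_self_right, Nat.add_mod_mod, Nat.mod_add_mod]
          _ = (r + Q) % Q := by congr 1; omega
          _ = r := by rw [Nat.add_mod_right, Nat.mod_eq_of_lt hr]

/-- With a large planted clique, the constructed class has a large shattered set. -/
theorem le_plantedLaw_graphClass {R l N κ p : ℕ} (hR : 1 < R) (hl : 0 < l) (hκ : κ ≤ N)
    (hp : p = N / 2 / (l * 2 ^ numDigits R N))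
    (h : 3 * ((l * numDigits R N + 2 ^ numDigits R N) * (N - p).choose κ) ≤ N.choose κ)
    {E : Set (SimpleGraph (Fin N))}
    (hE : ∀ H, (∃ T, (graphClass R l ⟨N, H⟩).concepts.Shatters T ∧ T.card = l * numDigits R N) →
      H ∈ E) : 2 / 3 ≤ plantedLaw N half κ E := by
  classical
  set q := numDigits R N with hq
  let P (c : ℕ) : Finset (Fin N) :=
    Finset.univ.filter fun u => (u : ℕ) < N / 2 ∧ colour l q N u = c
  let P' (r : ℕ) : Finset (Fin N) :=
    Finset.univ.filter fun w => N / 2 ≤ (w : ℕ) ∧ ((w : ℕ) + 1) % 2 ^ q = r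
  -- The single modulus `l * 2 ^ q` bounds both numbers of classes, `l * q` and `2 ^ q`, so every
  -- class has at least `p` elements.
  have hmono {Q : ℕ} (hQ : Q ≤ l * 2 ^ q) (hQ' : 0 < Q) : p ≤ N / 2 / Q :=
    hp ▸ Nat.div_le_div_left hQ hQ'
  refine le_plantedLaw (p := p) (𝒬 := (Finset.range (l * q)).image P ∪
    (Finset.range (2 ^ q)).image P') hκ (fun X hX => ?_) ?_ (fun S hS G => hE _ ?_) half
  · rcases Finset.mem_union.1 hX with hX | hX
    · obtain ⟨c, hc, rfl⟩ := Finset.mem_image.1 hX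
      have hc := Finset.mem_range.1 hc
      refine (hmono (Nat.mul_le_mul_left _ q.lt_two_pow_self.le) (by omega)).trans ?_
      refine (div_le_card_filter_mod (N := N) (b := 0) (N * (l * q - 1)) (by omega) hc).trans ?_
      refine Finset.card_le_card fun u hu => ?_
      rw [Finset.mem_filter, zero_add] at hu
      exact Finset.mem_filter.2 ⟨hu.1, hu.2.2⟩
    · obtain ⟨r, hr, rfl⟩ := Finset.mem_image.1 hX
      have hr := Finset.mem_range.1 hr
      refine (hmono (Nat.le_mul_of_pos_left _ hl) (by positivity)).trans ?_
      refine (div_le_card_filter_mod (N := N) (b := N / 2) 1 (by omega) hr).trans ?_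
      refine Finset.card_le_card fun u hu => ?_
      rw [Finset.mem_filter, add_comm 1] at hu
      exact Finset.mem_filter.2 ⟨hu.1, hu.2.1, hu.2.2.2⟩
  · refine le_trans ?_ h
    refine Nat.mul_le_mul_left _ (Nat.mul_le_mul_right _ ?_)
    refine (Finset.card_union_le _ _).trans (Nat.add_le_add ?_ ?_)
    · exact Finset.card_image_le.trans (Finset.card_range _).le
    · exact Finset.card_image_le.trans (Finset.card_range _).le
  · refine exists_shatters_graphClass hR hl (S := S) (h := N / 2) (fun u hu v hv huv => ?_)
      (fun c hc => ?_) fun r hr => ?_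
    · exact .inr ((SimpleGraph.fromRel_adj _ _ _).2 ⟨huv, .inl ⟨hu, hv⟩⟩)
    · obtain ⟨u, hu, hu'⟩ := hS (P c)
        (Finset.mem_union_left _ (Finset.mem_image_of_mem _ (Finset.mem_range.2 hc)))
      exact ⟨u, hu, (Finset.mem_filter.1 hu').2⟩
    · obtain ⟨u, hu, hu'⟩ := hS (P' r)
        (Finset.mem_union_right _ (Finset.mem_image_of_mem _ (Finset.mem_range.2 hr)))
      exact ⟨u, hu, (Finset.mem_filter.1 hu').2⟩

/-! ### Asymptotic estimates for the parameters. -/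

theorem pow_numDigits_le {R n : ℕ} (hR : 1 < R) (hn : n ≠ 0) : R ^ numDigits R n ≤ R * n :=
  Nat.base_pow_length_digits_le R n hR hn

theorem lt_pow_numDigits {R : ℕ} (hR : 1 < R) (n : ℕ) : n < R ^ numDigits R n :=
  Nat.lt_base_pow_length_digits hR

/-- The avoidance probability `(1 - p / N) ^ κ` is estimated by `1 - x ≤ exp (-x)`. -/
theorem choose_sub_le {N p κ : ℕ} (hN : N ≠ 0) (hp : p ≤ N) :
    ((N - p).choose κ : ℝ) ≤ N.choose κ * Real.exp (-(p * κ / N)) := by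
  have hN' : (0 : ℝ) < N := by positivity
  have h₁ : ((N - p).choose κ : ℝ) * N ^ κ ≤ N.choose κ * (N - p) ^ κ := by
    have := choose_mul_pow_le (Nat.sub_le N p) κ
    rw [← Nat.cast_sub hp]
    exact_mod_cast this
  have h₂ : ((N : ℝ) - p) ^ κ ≤ N ^ κ * Real.exp (-(p * κ / N)) := by
    have h₃ : ((N : ℝ) - p) ≤ N * Real.exp (-(p / N)) := by
      calc ((N : ℝ) - p) = N * (-(p / N) + 1) := by field_simp; ring
        _ ≤ _ := by gcongr; exact Real.add_one_le_exp _
    have h₄ : (0 : ℝ) ≤ N - p := sub_nonneg.2 (by exact_mod_cast hp)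
    calc ((N : ℝ) - p) ^ κ ≤ (N * Real.exp (-(p / N))) ^ κ := by gcongr
      _ = _ := by
        rw [mul_pow, ← Real.exp_nat_mul]
        congr 2
        ring
  refine le_of_mul_le_mul_right ?_ (pow_pos hN' κ)
  calc ((N - p).choose κ : ℝ) * N ^ κ ≤ N.choose κ * (N ^ κ * Real.exp (-(p * κ / N))) :=
        h₁.trans (by gcongr)
    _ = _ := by ring

/-- Sparse classes of vertices are met by most sets of `N ^ δ` vertices. -/
theorem eventually_choose_le {δ : ℝ} (hδ : 0 < δ) (hδ₁ : δ < 1) {r l : ℕ} (hr : 2 ≤ r * δ)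
    (hl : 0 < l) : ∀ᶠ N : ℕ in atTop,
      3 * ((l * numDigits (2 ^ r) N + 2 ^ numDigits (2 ^ r) N) *
        (N - N / 2 / (l * 2 ^ numDigits (2 ^ r) N)).choose ⌈(N : ℝ) ^ δ⌉₊) ≤
        N.choose ⌈(N : ℝ) ^ δ⌉₊ := by
  have hr₀ : r ≠ 0 := by
    rintro rfl
    norm_num at hr
  have hl' : (0 : ℝ) < l := by positivity
  have hy : Tendsto (fun N : ℕ => (N : ℝ) ^ (δ / 2)) atTop atTop :=
    (tendsto_rpow_atTop (half_pos hδ)).comp tendsto_natCast_atTop_atTop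
  -- With `y = N ^ (δ / 2)` there are `O(y)` classes, each missed with probability at most `exp (-y
  -- / (8 * l))`; the constants make the final bound exactly this expression.
  have hlim : Tendsto (fun y : ℝ => 48 * l * (l + 1) * ((y / (8 * l)) ^ 1 *
      Real.exp (-(y / (8 * l))))) atTop (nhds (48 * (l : ℝ) * (l + 1) * 0)) :=
    ((Real.tendsto_pow_mul_exp_neg_atTop_nhds_zero 1).comp
      (tendsto_id.atTop_div_const (by positivity))).const_mul _
  rw [mul_zero] at hlim
  filter_upwards [hy.eventually (hlim.eventually_le_const one_pos),
    hy.eventually_ge_atTop (8 * (l : ℝ)), eventually_ge_atTop 1] with N h₁ h₂ hN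
  set q := numDigits (2 ^ r) N
  set y := (N : ℝ) ^ (δ / 2)
  set κ := ⌈(N : ℝ) ^ δ⌉₊
  set p := N / 2 / (l * 2 ^ q)
  have hN' : (1 : ℝ) ≤ N := by exact_mod_cast hN
  have hy₀ : 0 < y := by positivity
  have hyκ : y ^ 2 ≤ κ := by
    refine le_trans (le_of_eq ?_) (Nat.le_ceil _)
    rw [← Real.rpow_natCast, ← Real.rpow_mul (by positivity)]
    congr 1
    push_cast
    ring
  have hyN : y ^ 2 ≤ N := by
    calc y ^ 2 = (N : ℝ) ^ δ := by
          rw [← Real.rpow_natCast, ← Real.rpow_mul (by positivity)]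
          congr 1
          push_cast
          ring
      _ ≤ (N : ℝ) ^ (1 : ℝ) := Real.rpow_le_rpow_of_exponent_le hN' hδ₁.le
      _ = N := Real.rpow_one _
  -- Compare `r`-th powers: `(2 ^ r) ^ q ≤ 2 ^ r * N`, and `N ≤ y ^ r` because `r * δ ≥ 2`.
  have hq : (2 : ℝ) ^ q ≤ 2 * y := by
    have h₃ : ((2 : ℝ) ^ q) ^ r ≤ 2 ^ r * N := by
      have := pow_numDigits_le (Nat.one_lt_two_pow hr₀) (n := N) (by omega)
      rw [← pow_mul, mul_comm r, pow_mul] at this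
      exact_mod_cast this
    have h₄ : (N : ℝ) ≤ y ^ r := by
      calc (N : ℝ) = (N : ℝ) ^ (1 : ℝ) := (Real.rpow_one _).symm
        _ ≤ (N : ℝ) ^ (δ / 2 * r) := Real.rpow_le_rpow_of_exponent_le hN' (by linarith)
        _ = y ^ r := by rw [Real.rpow_mul (by positivity), Real.rpow_natCast]
    refine (pow_le_pow_iff_left₀ (by positivity) (by positivity) hr₀).1 ?_
    rw [mul_pow]
    exact h₃.trans (by gcongr)
  have hp : (N : ℝ) / (8 * l * y) ≤ p := by
    have h₃ : p = N / (2 * (l * 2 ^ q)) := Nat.div_div_eq_div_mul _ _ _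
    have h₄ : (N : ℝ) < (p + 1) * (2 * (l * 2 ^ q)) := by
      have : N < (p + 1) * (2 * (l * 2 ^ q)) := by
        rw [h₃, mul_comm]
        exact Nat.lt_mul_div_succ _ (by positivity)
      exact_mod_cast this
    have h₅ : (p + 1 : ℝ) * (2 * (l * 2 ^ q)) ≤ (p + 1) * (2 * (l * (2 * y))) := by gcongr
    rw [div_le_iff₀ (by positivity)]
    -- From `y ≥ 8 * l` and `y ^ 2 ≤ N`; this pays for the rounding in `p`, at the cost of a factor
    -- `2`.
    have h₆ : 8 * l * y ≤ N := by nlinarith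
    nlinarith
  have hpN : p ≤ N := (Nat.div_le_self _ _).trans (Nat.div_le_self _ _)
  have hexp : y / (8 * l) ≤ p * κ / N := by
    rw [le_div_iff₀ (by positivity)]
    calc y / (8 * l) * N = N / (8 * l * y) * y ^ 2 := by field_simp
      _ ≤ p * κ := by gcongr
  have hJ : (3 * (l * q + 2 ^ q) : ℝ) ≤ 6 * (l + 1) * y := by
    have : (q : ℝ) ≤ 2 ^ q := by exact_mod_cast q.lt_two_pow_self.le
    nlinarith
  have hmain : (3 * ((l * q + 2 ^ q) * (N - p).choose κ) : ℝ) ≤ N.choose κ := by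
    calc (3 * ((l * q + 2 ^ q) * (N - p).choose κ) : ℝ)
        = 3 * (l * q + 2 ^ q) * (N - p).choose κ := by ring
      _ ≤ 6 * (l + 1) * y * (N.choose κ * Real.exp (-(p * κ / N))) := by
          gcongr
          exact choose_sub_le (by omega) hpN
      _ ≤ 6 * (l + 1) * y * (N.choose κ * Real.exp (-(y / (8 * l)))) := by gcongr
      _ = N.choose κ * (48 * l * (l + 1) * ((y / (8 * l)) ^ 1 * Real.exp (-(y / (8 * l))))) := by
          field_simp
          ring
      _ ≤ N.choose κ * 1 := by gcongr
      _ = N.choose κ := mul_one _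
  exact_mod_cast hmain

theorem sq_le_two_pow {n : ℕ} (hn : 4 ≤ n) : n ^ 2 ≤ 2 ^ n := by
  induction n, hn using Nat.le_induction with
  | base => norm_num
  | succ n hn ih =>
    rw [pow_succ 2]
    nlinarith

/-- The number `d` of binary digits satisfies `d ^ 2 ≤ 2 ^ d ≤ 2 * x`, so `d` is of order at most
the square root of `x`. If the claim failed, `x < (2 * l + 4) * d`, and squaring contradicts the
size of `x`. -/
theorem mul_numDigits_le {l x : ℕ} (hx : 2 * (2 * l + 4) ^ 2 ≤ x) :
    l * numDigits 2 x + l + 4 ≤ x := by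
  set d := numDigits 2 x
  have hx₃₂ : 32 ≤ x := le_trans (by nlinarith [Nat.zero_le l]) hx
  have hd : 4 ≤ d := by
    by_contra! hd
    have h₁ : x < 2 ^ d := lt_pow_numDigits one_lt_two x
    have h₂ : 2 ^ d ≤ 2 ^ 3 := Nat.pow_le_pow_right two_pos (by omega)
    omega
  have h₁ : 2 ^ d ≤ 2 * x := pow_numDigits_le one_lt_two (by omega)
  have h₂ := (sq_le_two_pow hd).trans h₁
  by_contra! h
  have h₃ : x < (2 * l + 4) * d := by nlinarith
  have h₄ : x * x < (2 * l + 4) * d * ((2 * l + 4) * d) := Nat.mul_self_lt_mul_self h₃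
  have h₅ : (2 * l + 4) * d * ((2 * l + 4) * d) ≤ (2 * l + 4) ^ 2 * (2 * x) := by
    calc (2 * l + 4) * d * ((2 * l + 4) * d) = (2 * l + 4) ^ 2 * d ^ 2 := by ring
      _ ≤ _ := Nat.mul_le_mul_left _ h₂
  have h₆ : (2 * l + 4) ^ 2 * (2 * x) ≤ x * x := by
    calc (2 * l + 4) ^ 2 * (2 * x) = 2 * (2 * l + 4) ^ 2 * x := by ring
      _ ≤ x * x := Nat.mul_le_mul_right _ hx
  omega

/-- Eventually, graphs with large `Ldim` of the constructed class have large bicliques. -/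
theorem eventually_hasBiclique {r l s : ℕ} (hr : r ≠ 0) (hl : 0 < l) (hs : 4 * r ≤ 2 ^ s) :
    ∀ᶠ N : ℕ in atTop, ∀ H : SimpleGraph (Fin N),
      2 ^ (numDigits 2 (numDigits (2 ^ r) N) + s) ≤ (graphClass (2 ^ r) l ⟨N, H⟩).ldim →
        HasBiclique H (2 * (r * numDigits (2 ^ r) N) + 2) := by
  have hR := Nat.one_lt_two_pow hr
  filter_upwards [eventually_ge_atTop ((2 ^ r) ^ (2 * (2 * l + 4) ^ 2))] with N hN H h
  set q := numDigits (2 ^ r) N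
  set k := 2 * (r * q) + 2 with hk
  have hN₀ : N ≠ 0 := by
    have : 0 < (2 ^ r) ^ (2 * (2 * l + 4) ^ 2) := by positivity
    omega
  have hq : 2 * (2 * l + 4) ^ 2 < q :=
    (Nat.pow_lt_pow_iff_right hR).1 (hN.trans_lt (lt_pow_numDigits hR N))
  have hqr : q ≤ r * q := Nat.le_mul_of_pos_left _ (by omega)
  by_contra hH
  have h₁ : (graphClass (2 ^ r) l ⟨N, H⟩).ldim ≤ k + l + numDigits 2 k * l := by
    refine ldim_graphClass_le hR hl hN₀ hH ?_
    rw [pow_mul]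
    exact Nat.pow_le_pow_left (lt_pow_numDigits one_lt_two k).le _
  -- This absorbs the lower-order terms: the dimension is at most `2 * k - 4 = 4 * r * q`, less than
  -- `(q + 1) * (4 * r)`, which is at most the threshold.
  have h₂ := mul_numDigits_le (l := l) (x := k) (by omega)
  have h₃ : q < 2 ^ numDigits 2 q := lt_pow_numDigits one_lt_two q
  have h₄ : (q + 1) * (4 * r) ≤ 2 ^ (numDigits 2 q + s) := by
    rw [pow_add]
    exact Nat.mul_le_mul h₃ hs
  have h₅ : (q + 1) * (4 * r) = 4 * (r * q) + 4 * r := by ring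
  rw [mul_comm (numDigits 2 k)] at h₁
  omega

/-- Under the Planted Clique Hypothesis, no parameter between the sizes of shattered sets and
Littlestone's dimension is approximated within a constant factor in polynomial time. -/
theorem not_exists_approximatesWithin (hPC : Hypothesis) {C : ℝ} (hC : 1 ≤ C)
    {opt : ExplicitClass → ℕ} (hshatter : ∀ I T, I.concepts.Shatters T → T.card ≤ opt I)
    (hldim : ∀ I, opt I ≤ I.ldim) :
    ¬ ∃ alg : ExplicitClass → ℕ, PolyTime alg ∧ ApproximatesWithin C opt alg := by
  rintro ⟨alg, hpoly, happ⟩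
  obtain ⟨δ, hδ, hδ₁, hPC⟩ := hPC
  have hle (I : ExplicitClass) : alg I ≤ opt I := by exact_mod_cast (happ I).2
  have hm (I : ExplicitClass) : alg I ≤ I.m :=
    ((hle I).trans (hldim I)).trans ((littlestoneDim_le_card _).trans (Fintype.card_fin _).le)
  -- Then `2 ^ q` is of order at most `N ^ (δ / 2)`, so the planted clique can meet all classes.
  obtain ⟨r, hr⟩ := exists_nat_ge (2 / δ)
  rw [div_le_iff₀ hδ] at hr
  have hr₀ : r ≠ 0 := by
    rintro rfl
    norm_num at hr
  obtain ⟨s, hs⟩ : ∃ s, 4 * r ≤ 2 ^ s := ⟨4 * r, (4 * r).lt_two_pow_self.le⟩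
  have hC₀ : 0 < ⌈C⌉₊ := Nat.ceil_pos.2 (by linarith)
  -- Chosen such that `l * q / C ≥ 2 ^ (s + 1) * q`, which is at least the threshold because `2 ^
  -- numDigits 2 q ≤ 2 * q`.
  set l := ⌈C⌉₊ * 2 ^ (s + 1) with hl_def
  have hl : 0 < l := by positivity
  have hR := Nat.one_lt_two_pow hr₀
  obtain ⟨A, hA⟩ := exists_randomizedTest hpoly hm hR hl s
  refine hPC ⟨A, ?_⟩
  filter_upwards [eventually_choose_le hδ hδ₁ hr hl, eventually_hasBiclique hr₀ hl hs,
    eventually_ge_atTop 1] with N h₁ h₂ hN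
  have hκ : ⌈(N : ℝ) ^ δ⌉₊ ≤ N := by
    rw [Nat.ceil_le]
    calc (N : ℝ) ^ δ ≤ (N : ℝ) ^ (1 : ℝ) :=
          Real.rpow_le_rpow_of_exponent_le (by exact_mod_cast hN) hδ₁.le
      _ = N := Real.rpow_one _
  have := isProbabilityMeasure_plantedLaw hκ half
  let E : Set (SimpleGraph (Fin N)) := {H |
    2 ^ (numDigits 2 (numDigits (2 ^ r) N) + s) ≤ alg (graphClass (2 ^ r) l ⟨N, H⟩)}
  have hrun (G : SimpleGraph (Fin N)) (c) : A.run (⟨N, G⟩, c) = true ↔ G ∈ E := by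
    rw [hA, decide_eq_true_iff]
    rfl
  rw [RandomizedTest.acceptProb_eq hrun, RandomizedTest.acceptProb_eq hrun]
  constructor
  · refine le_plantedLaw_graphClass hR hl hκ rfl h₁ fun H ⟨T, hT, hcard⟩ => ?_
    set q := numDigits (2 ^ r) N
    have hq : q ≠ 0 := (numDigits_pos hR (by omega)).ne'
    have h₃ : 2 ^ numDigits 2 q ≤ 2 * q := pow_numDigits_le one_lt_two hq
    have h₄ : (l * q : ℝ) / C ≤ alg (graphClass (2 ^ r) l ⟨N, H⟩) := by
      refine le_trans ?_ (happ _).1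
      have := hshatter _ T hT
      rw [hcard] at this
      gcongr
      exact_mod_cast this
    have h₅ : (2 ^ (s + 1) * q : ℝ) ≤ l * q / C := by
      rw [le_div_iff₀ (by linarith), hl_def]
      push_cast
      have := Nat.le_ceil C
      calc (2 ^ (s + 1) * q * C : ℝ) ≤ 2 ^ (s + 1) * q * ⌈C⌉₊ := by gcongr
        _ = _ := by ring
    have h₆ : 2 ^ (s + 1) * q ≤ alg (graphClass (2 ^ r) l ⟨N, H⟩) := by
      exact_mod_cast h₅.trans h₄
    refine le_trans ?_ h₆
    calc 2 ^ (numDigits 2 q + s) = 2 ^ s * 2 ^ numDigits 2 q := by rw [pow_add, mul_comm]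
      _ ≤ 2 ^ s * (2 * q) := Nat.mul_le_mul_left _ h₃
      _ = 2 ^ (s + 1) * q := by ring
  · refine (MeasureTheory.measure_mono fun H hH => ?_).trans
      (binomialRandom_half_biclique_le (L := r * numDigits (2 ^ r) N) ?_ rfl)
    · exact h₂ H (hH.trans ((hle _).trans (hldim _)))
    · rw [pow_mul]
      exact (lt_pow_numDigits hR N).le

end CliqueReduction

theorem mainTheorem5 (hPC : PlantedClique.Hypothesis) (C : ℝ) (hC : 1 ≤ C) :
    (¬ ∃ alg : Learning.ExplicitClass → ℕ,
        Learning.PolyTime alg ∧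
          Learning.ApproximatesWithin C Learning.ExplicitClass.vc alg) ∧
      ¬ ∃ alg : Learning.ExplicitClass → ℕ,
        Learning.PolyTime alg ∧
          Learning.ApproximatesWithin C Learning.ExplicitClass.ldim alg :=
  ⟨CliqueReduction.not_exists_approximatesWithin hPC hC (fun _ _ h => h.card_le_vcDim)
    fun _ => Learning.vcDim_le_littlestoneDim _,
    CliqueReduction.not_exists_approximatesWithin hPC hC
      (fun _ _ h => Learning.card_le_littlestoneDim h) fun _ => le_rfl⟩
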